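/- A non-commutative probability space is a pair $(\mathcal M,\varphi)$ where $\mathcal M$ is a unital complex $*$-algebra and $\varphi:\mathcal M\to\mathbb C$ is a linear form with $\varphi(1)=1$, $\varphi(xy)=\varphi(yx)$, $\varphi(x^*)=\overline{\varphi(x)}$ and $\varphi(xx^*)\ge 0$ for all $x,y\in\mathcal M$. Subalgebras are unital and $*$-stable, and an element $x$ is centered if $\varphi(x)=0$. Two subalgebras are independent if they commute with each other and the product of a centered element of one and a centered element of the other is centered. They are free if every product of finitely many (at least one) centered elements taken alternately from the two subalgebras is centered. Let $t\in[0,+\infty]$. Let $u_t$ denote a unitary element with the distribution of a free unitary Brownian motion at time $t$, that is, for all $k\ge 1$, $$\varphi(u_t^k)=e^{-\frac{kt}{2}}\sum_{j=0}^{k-1}\frac{(-t)^j}{j!}\binom{k}{j+1}k^{j-1}\quad(t<+\infty),\qquad \varphi(u_t^k)=0\quad(t=+\infty).$$ Two subalgebras $\mathcal A,\mathcal B$ of a non-commutative probability space $(\mathcal M,\varphi)$ are $t$-free if there is a non-commutative probability space $(\mathcal X,\psi)$ that contains images, under expectation-preserving unital $*$-homomorphisms $\alpha:\mathcal A\to\mathcal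 X$ and $\beta:\mathcal B\to\mathcal X$ with independent ranges, of $\mathcal A$ and $\mathcal B$, and a unitary $u_t$ as above, such that the subalgebra generated by $\alpha(\mathcal A)\cup\beta(\mathcal B)$ is free with the subalgebra generated by $u_t$, and such that the expectation $\varphi$ of every word in elements of $\mathcal A$ and $\mathcal B$ equals the expectation $\psi$ of the word obtained by replacing each letter $a\in\mathcal A$ by $\alpha(a)$ and each letter $b\in\mathcal B$ by $u_t\beta(b)u_t^*$. For $\sigma\in\mathfrak S_n$ and $m_1,\dots,m_n\in\mathcal M$, let $$\varphi_\sigma(m_1,\dots,m_n)=\prod_{(i_1\,\cdots\,i_r)\text{ cycle of }\sigma}\varphi(m_{i_1}\cdots m_{i_r}),$$ fixed points counting as cycles of length $1$. For $n\ge 2$, a $t$-free cumulant of order $n$ is a family $(c(\sigma))_{\sigma\in\mathfrak S_n}$ of complex numbers such that $\sum_{\sigma\ n\text{-cycle}}c(\sigma)\ne 0$ and such that, for every non-commutative probability space $(\mathcal M,\varphi)$, every pair $(\mathcal A,\mathcal B)$ of $t$-free subalgebras of $\mathcal M$ and all $m_1,\dots,m_n\in\mathcal A\cup\mathcal B$ which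 do not all belong to $\mathcal A$ and do not all belong to $\mathcal B$, $$\sum_{\sigma\in\mathfrak S_n}c(\sigma)\,\varphi_\sigma(m_1,\dots,m_n)=0.$$ Theorem. For $t\in[0,+\infty]$, there exists a $t$-free cumulant of order $7$ if and only if $t=0$ or $t=+\infty$. -/

import Mathlib

universe u v w

/-- The expectation of a non-commutative probability space: a unital, tracial, Hermitian and
positive linear form on a complex unital `*`-algebra `M`.  (By `map_star`, the number
`φ (x * star x)` is real, so that its real part is all there is to it.)  The pair `(M, E)` with
`E : Expectation M` is a non-commutative probability space. -/
structure Expectation (M : Type u) [Ring M] [StarRing M] [Algebra ℂ M] [StarModule ℂ M] where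
  /-- the underlying linear form -/
  φ : M →ₗ[ℂ] ℂ
  map_one : φ 1 = 1
  map_mul_comm : ∀ x y : M, φ (x * y) = φ (y * x)
  map_star : ∀ x : M, φ (star x) = star (φ x)
  nonneg : ∀ x : M, 0 ≤ (φ (x * star x)).re

namespace Expectation

section

variable {M : Type u} [Ring M] [StarRing M] [Algebra ℂ M] [StarModule ℂ M]

/-- The restriction of the expectation to a (unital, `*`-stable) subalgebra. -/
def restrict (E : Expectation M) (A : StarSubalgebra ℂ M) : Expectation A where
  φ := E.φ ∘ₗ A.subtype.toAlgHom.toLinearMap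
  map_one := E.map_one
  map_mul_comm x y := E.map_mul_comm x y
  map_star x := E.map_star x
  nonneg x := E.nonneg x

/-- Independence of a family of subalgebras: they commute, and a product of centered elements of
pairwise distinct members of the family is centered. -/
def Independent {ι : Type v} (E : Expectation M) (A : ι → StarSubalgebra ℂ M) : Prop :=
  (∀ i j : ι, i ≠ j → ∀ a ∈ A i, ∀ b ∈ A j, a * b = b * a) ∧
  ∀ l : List (ι × M), l ≠ [] → l.Pairwise (fun p q => p.1 ≠ q.1) →
    (∀ p ∈ l, p.2 ∈ A p.1 ∧ E.φ p.2 = 0) → E.φ (l.map Prod.snd).prod = 0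

/-- Freeness of a family of subalgebras: a product of centered elements of successively distinct
members of the family is centered. -/
def Free {ι : Type v} (E : Expectation M) (A : ι → StarSubalgebra ℂ M) : Prop :=
  ∀ l : List (ι × M), l ≠ [] → l.IsChain (fun p q => p.1 ≠ q.1) →
    (∀ p ∈ l, p.2 ∈ A p.1 ∧ E.φ p.2 = 0) → E.φ (l.map Prod.snd).prod = 0

end

end Expectation

/-- The `k`-th moment, `k ≥ 1`, of the law `ν_t` on the unit circle of a free unitary Brownian
motion at time `t ∈ [0, +∞]`:
`e^{-kt/2} ∑_{j=0}^{k-1} ((-t)^j / j!) (k choose j+1) k^{j-1}` for finite `t`,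
and `0` (the moment of the uniform law) for `t = +∞`. -/
noncomputable def freeUnitaryBMMoment (t : ENNReal) (k : ℕ) : ℝ :=
  if t = ⊤ then 0
  else Real.exp (-(k * t.toReal) / 2) *
    ∑ j ∈ Finset.range k, (-t.toReal) ^ j / (j.factorial : ℝ) *
      (k.choose (j + 1) : ℝ) * (k : ℝ) ^ ((j : ℤ) - 1)

namespace Expectation

section

variable {M : Type u} [Ring M] [StarRing M] [Algebra ℂ M] [StarModule ℂ M]

/-- `x` is a unitary element distributed as a free unitary Brownian motion at time `t`
(a Haar unitary for `t = +∞`). The moments of negative order are given by the adjoint. -/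
def IsFreeUnitaryBMAt (E : Expectation M) (t : ENNReal) (x : M) : Prop :=
  x ∈ unitary M ∧ ∀ k : ℕ, 1 ≤ k → E.φ (x ^ k) = (freeUnitaryBMMoment t k : ℂ)

end

end Expectation

/-- The `t`-free product of `(A, EA)` and `(B, EB)` is realized inside the non-commutative
probability space `(X, F)`: `X` contains, through `α` and `β`, expectation-preserving independent
copies of `A` and `B` (so that `α` and `β` induce an expectation-preserving map from the tensor
product), and a unitary `x`, distributed as a free unitary Brownian motion at time `t`, such that
the algebra generated by the copies of `A` and `B` is free with the algebra generated by `x`. The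
`t`-free product is then the subalgebra generated by `α A` and `x (β B) x*`. -/
structure IsTFreeProduct (t : ENNReal)
    {A : Type u} [Ring A] [StarRing A] [Algebra ℂ A] [StarModule ℂ A] (EA : Expectation A)
    {B : Type v} [Ring B] [StarRing B] [Algebra ℂ B] [StarModule ℂ B] (EB : Expectation B)
    {X : Type w} [Ring X] [StarRing X] [Algebra ℂ X] [StarModule ℂ X] (F : Expectation X)
    (α : A →⋆ₐ[ℂ] X) (β : B →⋆ₐ[ℂ] X) (x : X) : Prop where
  map_left : ∀ a : A, F.φ (α a) = EA.φ a
  map_right : ∀ b : B, F.φ (β b) = EB.φ b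
  independent : F.Independent ![α.range, β.range]
  brownian : F.IsFreeUnitaryBMAt t x
  free : F.Free ![α.range ⊔ β.range, StarAlgebra.adjoin ℂ {x}]

namespace Expectation

section

variable {M : Type u} [Ring M] [StarRing M] [Algebra ℂ M] [StarModule ℂ M]

/-- The subalgebras `A` and `B` are `t`-free: the canonical correspondence between words in the
elements of `A` and `B` taken in their `t`-free product (where `b ∈ B` is represented by
`x (β b) x*`) and the same words taken in `M` preserves the expectation. -/
def TFree (E : Expectation M) (t : ENNReal) (A B : StarSubalgebra ℂ M) : Prop :=
  ∃ (X : Type u) (_ : Ring X) (_ : StarRing X) (_ : Algebra ℂ X) (_ : StarModule ℂ X)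
    (F : Expectation X) (α : A →⋆ₐ[ℂ] X) (β : B →⋆ₐ[ℂ] X) (x : X),
    IsTFreeProduct t (E.restrict A) (E.restrict B) F α β x ∧
    ∀ l : List (A ⊕ B),
      E.φ (l.map (Sum.elim (fun a : A => (a : M)) (fun b : B => (b : M)))).prod =
        F.φ (l.map (Sum.elim (fun a : A => α a) (fun b : B => x * β b * star x))).prod

/-- The `n`-linear form `φ_σ`: the product, over the cycles `(i₁ … i_r)` of `σ` (fixed points
included), of `φ (m_{i₁} ⋯ m_{i_r})`.  Each cycle is written from its smallest element; since `φ`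
is tracial, the starting point is immaterial. -/
noncomputable def permForm (E : Expectation M) {n : ℕ} (σ : Equiv.Perm (Fin n))
    (m : Fin n → M) : ℂ :=
  ∏ i : Fin n with ∀ j : Fin n, σ.SameCycle i j → i ≤ j,
    E.φ (List.ofFn fun k : Fin (Function.minimalPeriod σ i) => m ((σ ^ (k : ℕ)) i)).prod

end

end Expectation

/-- `c` is a `t`-free cumulant of order `n` (for `n ≥ 2`). -/
def IsTFreeCumulant (t : ENNReal) (n : ℕ) (c : Equiv.Perm (Fin n) → ℂ) : Prop :=
  (∑ σ : Equiv.Perm (Fin n) with σ.cycleType = {n}, c σ) ≠ 0 ∧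
  ∀ (M : Type u) [Ring M] [StarRing M] [Algebra ℂ M] [StarModule ℂ M] (E : Expectation M)
    (A B : StarSubalgebra ℂ M), E.TFree t A B →
    ∀ m : Fin n → M, (∀ i, m i ∈ A ∨ m i ∈ B) → (¬ ∀ i, m i ∈ A) → (¬ ∀ i, m i ∈ B) →
      ∑ σ : Equiv.Perm (Fin n), c σ * E.permForm σ m = 0

open Equiv Function

/-! Existence at `t = 0` and `t = ⊤` rests on a formula of Good's type, writing cumulants as
averages over colourings with roots of unity. To a colouring `f : Fin n → ZMod n` attach the moment
`Ψ f` of the word in which the letter at place `i` is replaced by its copy number `f i`, the copies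
of the ambient algebra being independent for `t = 0` and free for `t = ⊤`. Such a moment is a
universal combination of the forms `φ_σ` with `σ` preserving `f`, and it is the moment of the
original word when `f` is constant. Take for `c` the coefficients of `∑ f, exp(2πi ∑ f(i) / n) Ψ f`.
An `n`-cycle preserves only constant colourings, each of which has weight `1`; hence `c` has a
nonzero sum over `n`-cycles. In a mixed word let `S` be the set of places of the letters of `A`.
Adding `1` to `f` on `S` does not change `Ψ f`, because the copies of `A` and those of `B` are
themselves independent, respectively free, from each other; but it multiplies the weight by `exp(2πi
|S| / n) ≠ 1`. So the average vanishes. The carriers are `exists_coeff_of_expansion`,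
`MixedWord.map_prod_eq_mul` for `t = 0`, and `FreeWord.exists_coeff` with
`MixedWord.exists_free_copies` for `t = ⊤`.

For `0 < t < ∞` the relation is tested on unitaries of finite order. Let `A` be the algebra of the
first factor of `ℤ/60 × ℤ/60` and `B` the conjugate by `u_t` of the algebra of the second one. The
relation is summed over all rearrangements of a word of seven letters different from `1`. The result
depends on `c` only through its sums over conjugacy classes, and classes with fixed points
contribute nothing, since such letters are centered. Four unknowns remain, for the cycle types `7`,
`5+2`, `4+3` and `3+2+2`. The moments needed here are all powers of `q = e^{-t}` or zero: when no
proper cyclic subword has trivial image in `ℤ/60 × ℤ/60`, every `u_t` and `u_t*` may be replaced by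
its expectation `e^{-t/2}` (`Expectation.map_alternating`). Four words give four linear equations,
and eliminating the last three unknowns leaves `q³ (1 - q)² C₁ = 0`, where `C₁` is the sum over
`7`-cycles; so `C₁ = 0`.

This test needs a positive model containing `u_t`, free from a group algebra
(`exists_freeUnitaryBM`). By Lagrange inversion, `1 + 2 ∑ m_k z^k`, with `m_k` the prescribed
moments, is the Cayley transform of the inverse of `w ↦ w exp(t (1 + w) / (2 (1 - w)))`. It is
approximated by functions of positive real part on the disc, which yield probability measures. By
the law of large numbers these are approximated by uniform measures on finite families of points,
which are realized by unitaries in group algebras of cyclic groups; free products of groups provide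
freeness, and an ultrafilter limit concludes. -/

theorem List.ofFn_eq_map_range {α : Type*} (p : ℕ) (g : ℕ → α) :
    List.ofFn (fun k : Fin p => g k) = (List.range p).map g := by
  apply List.ext_getElem <;> simp

theorem Equiv.Perm.mem_periodicPts {α : Type*} [Finite α] (σ : Perm α) (i : α) :
    i ∈ periodicPts σ := by
  obtain ⟨n, hn, h⟩ := isOfFinOrder_iff_pow_eq_one.1 (isOfFinOrder_of_finite σ)
  exact ⟨n, hn, by rw [IsPeriodicPt, IsFixedPt, Perm.iterate_eq_pow, h]; rfl⟩

/-! ### Permutation forms, cycle by cycle -/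

namespace Expectation

section

variable {M : Type u} [Ring M] [StarRing M] [Algebra ℂ M] [StarModule ℂ M]

/-- The factor of `permForm` attached to the cycle of `i`, written starting from `i`. -/
noncomputable def cycleMoment (E : Expectation M) {n : ℕ} (σ : Perm (Fin n)) (m : Fin n → M)
    (i : Fin n) : ℂ :=
  E.φ ((List.range (minimalPeriod σ i)).map fun k => m ((σ ^ k) i)).prod

theorem permForm_eq (E : Expectation M) {n : ℕ} (σ : Perm (Fin n)) (m : Fin n → M) :
    E.permForm σ m = ∏ i : Fin n with ∀ j, σ.SameCycle i j → i ≤ j, E.cycleMoment σ m i := by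
  unfold permForm cycleMoment
  refine Finset.prod_congr rfl fun i _ => ?_
  rw [List.ofFn_eq_map_range (minimalPeriod σ i) fun k => m ((σ ^ k) i)]

/-- Traciality: starting the cycle one step later moves its first letter to the end of the product.
-/
theorem cycleMoment_apply (E : Expectation M) {n : ℕ} (σ : Perm (Fin n)) (m : Fin n → M)
    (i : Fin n) : E.cycleMoment σ m (σ i) = E.cycleMoment σ m i := by
  unfold cycleMoment
  rw [minimalPeriod_apply (σ.mem_periodicPts i)]
  obtain ⟨p, hp⟩ := Nat.exists_eq_succ_of_ne_zero
    (minimalPeriod_pos_of_mem_periodicPts (σ.mem_periodicPts i)).ne'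
  have hper : (σ ^ (p + 1)) i = i := by
    have := iterate_minimalPeriod (f := σ) (x := i)
    rwa [hp, Perm.iterate_eq_pow] at this
  rw [hp]
  have h1 : (List.range (p + 1)).map (fun k => m ((σ ^ k) i)) =
      m i :: (List.range p).map (fun k => m ((σ ^ k) (σ i))) := by
    rw [List.range_succ_eq_map, List.map_cons, List.map_map]
    simp [comp_def, pow_succ]
  have h2 : (List.range (p + 1)).map (fun k => m ((σ ^ k) (σ i))) =
      (List.range p).map (fun k => m ((σ ^ k) (σ i))) ++ [m i] := by
    rw [List.range_succ, List.map_append]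
    have : (σ ^ p) (σ i) = i := by rw [← Perm.mul_apply, ← pow_succ, hper]
    simp [this]
  rw [h1, h2, List.prod_append, List.prod_singleton, List.prod_cons, E.map_mul_comm]

theorem cycleMoment_eq_of_sameCycle (E : Expectation M) {n : ℕ} {σ : Perm (Fin n)}
    (m : Fin n → M) {i j : Fin n} (h : σ.SameCycle i j) :
    E.cycleMoment σ m i = E.cycleMoment σ m j := by
  obtain ⟨k, rfl⟩ := h.exists_nat_pow_eq
  induction k with
  | zero => simp
  | succ k ih =>
    rw [ih ⟨k, by simp⟩, pow_succ', Perm.mul_apply, cycleMoment_apply]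

/-- The permutation form may be computed with any set of representatives of the cycles. -/
theorem permForm_eq_prod_of_transversal (E : Expectation M) {n : ℕ} {σ : Perm (Fin n)}
    (m : Fin n → M) (R : Finset (Fin n)) (hR : ∀ i, ∃ r ∈ R, σ.SameCycle r i)
    (hR' : ∀ r ∈ R, ∀ s ∈ R, σ.SameCycle r s → r = s) :
    E.permForm σ m = ∏ r ∈ R, E.cycleMoment σ m r := by
  classical
  have key : ∀ R : Finset (Fin n), (∀ i, ∃ r ∈ R, σ.SameCycle r i) →
      (∀ r ∈ R, ∀ s ∈ R, σ.SameCycle r s → r = s) →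
      ∏ r ∈ R, E.cycleMoment σ m r =
        ∏ x : Quotient (Perm.SameCycle.setoid σ),
          x.lift (E.cycleMoment σ m) fun _ _ h => E.cycleMoment_eq_of_sameCycle m h := by
    intro R hR hR'
    refine Finset.prod_bij (fun r _ => Quotient.mk _ r) (fun _ _ => Finset.mem_univ _) ?_ ?_ ?_
    · intro r hr s hs h
      exact hR' r hr s hs (Quotient.exact h)
    · intro x _
      induction x using Quotient.inductionOn with
      | h i =>
        obtain ⟨r, hr, h⟩ := hR i
        exact ⟨r, hr, Quotient.sound h⟩
    · intro r _
      rfl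
  rw [permForm_eq, key _ _ _, key R hR hR']
  · intro i
    obtain ⟨r, hr, hmin⟩ := (Finset.univ.filter fun j => σ.SameCycle i j).exists_min_image id
      ⟨i, by simpa using Perm.SameCycle.refl σ i⟩
    simp only [Finset.mem_filter, Finset.mem_univ, true_and, id] at hr hmin
    exact ⟨r, by simpa using fun j hj => hmin j (hr.trans hj), hr.symm⟩
  · intro r hr s hs h
    simp only [Finset.mem_filter, Finset.mem_univ, true_and] at hr hs
    exact le_antisymm (hr s h) (hs r h.symm)

theorem cycleMoment_conj (E : Expectation M) {n : ℕ} (σ τ : Perm (Fin n)) (m : Fin n → M)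
    (i : Fin n) : E.cycleMoment (τ * σ * τ⁻¹) m (τ i) = E.cycleMoment σ (m ∘ τ) i := by
  have hpow : ∀ k : ℕ, ((τ * σ * τ⁻¹) ^ k) (τ i) = τ ((σ ^ k) i) := by
    intro k
    rw [conj_pow]
    simp
  have hper : minimalPeriod (τ * σ * τ⁻¹) (τ i) = minimalPeriod σ i := by
    rw [minimalPeriod_eq_minimalPeriod_iff]
    intro k
    simp only [IsPeriodicPt, IsFixedPt, Perm.iterate_eq_pow, hpow]
    exact τ.injective.eq_iff
  unfold cycleMoment
  rw [hper]
  simp only [hpow, comp_apply]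

/-- `τ` carries the cycles of `σ` to those of the conjugate. It need not carry least elements of
cycles to least elements, so the product has to be computed on an arbitrary set of representatives.
-/
theorem permForm_conj (E : Expectation M) {n : ℕ} (σ τ : Perm (Fin n)) (m : Fin n → M) :
    E.permForm (τ * σ * τ⁻¹) m = E.permForm σ (m ∘ τ) := by
  classical
  rw [permForm_eq E σ, E.permForm_eq_prod_of_transversal m
    ((Finset.univ.filter fun i => ∀ j, σ.SameCycle i j → i ≤ j).map τ.toEmbedding)]
  · rw [Finset.prod_map]
    exact Finset.prod_congr rfl fun i _ => E.cycleMoment_conj σ τ m i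
  · intro i
    obtain ⟨r, hr, hmin⟩ := (Finset.univ.filter fun j => σ.SameCycle (τ⁻¹ i) j).exists_min_image id
      ⟨τ⁻¹ i, by simpa using Perm.SameCycle.refl σ _⟩
    simp only [Finset.mem_filter, Finset.mem_univ, true_and, id] at hr hmin
    refine ⟨τ r, Finset.mem_map.2 ⟨r, ?_, rfl⟩, ?_⟩
    · simpa using fun j hj => hmin j (hr.trans hj)
    · rw [Perm.sameCycle_conj]
      simpa using hr.symm
  · intro r hr s hs h
    obtain ⟨r, hr₁, rfl⟩ := Finset.mem_map.1 hr
    obtain ⟨s, hs₁, rfl⟩ := Finset.mem_map.1 hs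
    replace hr := (Finset.mem_filter.1 hr₁).2
    replace hs := (Finset.mem_filter.1 hs₁).2
    rw [Perm.sameCycle_conj] at h
    replace h : σ.SameCycle r s := by simpa using h
    rw [le_antisymm (hr s h) (hs r h.symm)]

end

end Expectation

/-! ### Permutations prescribed by the lists of their cycles -/

theorem eq_of_mem_of_flatten_nodup {α : Type*} {P : List (List α)} (hnd : P.flatten.Nodup)
    {L L' : List α} (hL : L ∈ P) (hL' : L' ∈ P) {i : α} (hi : i ∈ L) (hi' : i ∈ L') : L = L' := by
  induction P with
  | nil => simp at hL
  | cons K P ih =>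
    rw [List.flatten_cons, List.nodup_append'] at hnd
    obtain ⟨-, h2, h3⟩ := hnd
    rcases List.mem_cons.1 hL with rfl | hK <;> rcases List.mem_cons.1 hL' with rfl | hK'
    · rfl
    · exact (h3 hi (List.mem_flatten.2 ⟨L', hK', hi'⟩)).elim
    · exact (h3 hi' (List.mem_flatten.2 ⟨L, hK, hi⟩)).elim
    · exact ih h2 hK hK'

/-- Disjoint lists covering a finite type are the cycles of a permutation. -/
theorem exists_perm_of_flatten_nodup {α : Type*} [Finite α] (P : List (List α))
    (hnd : P.flatten.Nodup) (hmem : ∀ i, i ∈ P.flatten) :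
    ∃ σ : Perm α, ∀ L ∈ P, ∀ k (hk : k < L.length),
      σ L[k] = L[(k + 1) % L.length]'(Nat.mod_lt _ (by omega)) := by
  classical
  cases nonempty_fintype α
  obtain ⟨hnd1, hdisj⟩ := List.nodup_flatten.1 hnd
  have hex : ∀ i, ∃ L ∈ P, i ∈ L := fun i => by simpa using hmem i
  choose C hC hiC using hex
  have huniq : ∀ L ∈ P, ∀ i ∈ L, C i = L := fun L hL i hi =>
    eq_of_mem_of_flatten_nodup hnd (hC i) hL (hiC i) hi
  have hform : ∀ i, (C i).formPerm i ∈ C i := fun i =>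
    List.formPerm_apply_mem_of_mem (hiC i)
  have hCf : ∀ i, C ((C i).formPerm i) = C i := fun i => huniq _ (hC i) _ (hform i)
  have hinj : Injective fun i => (C i).formPerm i := by
    intro i j h
    have h' : C i = C j := by rw [← hCf i, ← hCf j]; exact congrArg C h
    simp only [h'] at h
    exact (C j).formPerm.injective h
  refine ⟨Equiv.ofBijective _ (Finite.injective_iff_bijective.1 hinj), ?_⟩
  intro L hL k hk
  rw [Equiv.ofBijective_apply, huniq L hL _ (List.getElem_mem hk),
    List.formPerm_apply_getElem _ (hnd1 L hL)]

/-- The permutation form of a permutation whose cycles are given as lists. -/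
theorem permForm_eq_prod_of_lists {n : ℕ} {P : List (List (Fin n))} (hne : ∀ L ∈ P, L ≠ [])
    (hnd : P.flatten.Nodup) (hmem : ∀ i, i ∈ P.flatten) {σ : Perm (Fin n)}
    (hσ : ∀ L ∈ P, ∀ k (hk : k < L.length),
      σ L[k] = L[(k + 1) % L.length]'(Nat.mod_lt _ (by omega)))
    {M : Type u} [Ring M] [StarRing M] [Algebra ℂ M] [StarModule ℂ M] (E : Expectation M)
    (m : Fin n → M) :
    E.permForm σ m = (P.map fun L => E.φ (L.map m).prod).prod := by
  classical
  obtain ⟨hnd1, hdisj⟩ := List.nodup_flatten.1 hnd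
  have hinv : ∀ L ∈ P, ∀ i ∈ L, σ i ∈ L := by
    intro L hL i hi
    obtain ⟨k, hk, rfl⟩ := List.getElem_of_mem hi
    rw [hσ L hL k hk]
    exact List.getElem_mem _
  have hpos : ∀ L ∈ P, 0 < L.length := fun L hL => List.length_pos_iff.2 (hne L hL)
  have hpow : ∀ L (hL : L ∈ P) (k : ℕ),
      (σ ^ k) (L[0]'(hpos L hL)) = L[k % L.length]'(Nat.mod_lt _ (hpos L hL)) := by
    intro L hL k
    induction k with
    | zero => simp
    | succ k ih =>
      rw [pow_succ', Perm.mul_apply, ih, hσ L hL]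
      simp
  have hper : ∀ L (hL : L ∈ P), minimalPeriod σ (L[0]'(hpos L hL)) = L.length := by
    intro L hL
    have h1 : IsPeriodicPt σ L.length (L[0]'(hpos L hL)) := by
      rw [IsPeriodicPt, IsFixedPt, Perm.iterate_eq_pow, hpow L hL]
      simp
    refine le_antisymm (h1.minimalPeriod_le (hpos L hL)) ?_
    by_contra hlt
    rw [not_le] at hlt
    have h2 := iterate_minimalPeriod (f := σ) (x := L[0]'(hpos L hL))
    rw [Perm.iterate_eq_pow, hpow L hL, (hnd1 L hL).getElem_inj_iff, Nat.mod_eq_of_lt hlt] at h2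
    have := minimalPeriod_pos_of_mem_periodicPts (σ.mem_periodicPts (L[0]'(hpos L hL)))
    omega
  have hcyc : ∀ L (hL : L ∈ P), E.cycleMoment σ m (L[0]'(hpos L hL)) = E.φ (L.map m).prod := by
    intro L hL
    unfold Expectation.cycleMoment
    rw [hper L hL]
    congr 2
    apply List.ext_getElem
    · simp
    · intro k h1 h2
      simp only [List.length_map, List.length_range] at h1
      simp [hpow L hL, Nat.mod_eq_of_lt h1]
  have hsame : ∀ L ∈ P, ∀ i ∈ L, ∀ j, σ.SameCycle i j → j ∈ L := by
    intro L hL i hi j hij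
    obtain ⟨k, rfl⟩ := hij.exists_nat_pow_eq
    clear hij
    induction k with
    | zero => simpa
    | succ k ih =>
      rw [pow_succ', Perm.mul_apply]
      exact hinv L hL _ ih
  have hPnd : P.Nodup := by
    refine hdisj.imp_of_mem fun {L L'} hL _ h => ?_
    rintro rfl
    exact h (List.getElem_mem (hpos L hL)) (List.getElem_mem (hpos L hL))
  have hhnd : (P.attach.map fun L => L.1[0]'(hpos L.1 L.2)).Nodup := by
    refine List.Nodup.map_on ?_ (List.nodup_attach.2 hPnd)
    intro L _ L' _ h
    refine Subtype.ext (eq_of_mem_of_flatten_nodup hnd L.2 L'.2 (List.getElem_mem (hpos L.1 L.2)) ?_)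
    rw [h]
    exact List.getElem_mem _
  rw [E.permForm_eq_prod_of_transversal m
    (P.attach.map fun L => L.1[0]'(hpos L.1 L.2)).toFinset, List.prod_toFinset _ hhnd,
    List.map_map]
  · conv_rhs => rw [← List.attach_map_subtype_val P, List.map_map]
    exact congrArg List.prod (List.map_congr_left fun L _ => hcyc L.1 L.2)
  · intro i
    obtain ⟨L, hL, hi⟩ := List.mem_flatten.1 (hmem i)
    obtain ⟨k, hk, rfl⟩ := List.getElem_of_mem hi
    refine ⟨L[0]'(hpos L hL), ?_, ⟨k, ?_⟩⟩
    · simp only [List.mem_toFinset, List.mem_map, List.mem_attach, true_and, Subtype.exists]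
      exact ⟨L, hL, rfl⟩
    · rw [zpow_natCast, hpow L hL]
      simp [Nat.mod_eq_of_lt hk]
  · intro r hr s hs h
    simp only [List.mem_toFinset, List.mem_map, List.mem_attach, true_and, Subtype.exists] at hr hs
    obtain ⟨L, hL, rfl⟩ := hr
    obtain ⟨L', hL', rfl⟩ := hs
    have : L = L' := eq_of_mem_of_flatten_nodup hnd hL hL'
      (hsame L hL _ (List.getElem_mem _) _ h) (List.getElem_mem _)
    subst this
    rfl

theorem permForm_finRotate {n : ℕ} (hn : 0 < n)
    {M : Type u} [Ring M] [StarRing M] [Algebra ℂ M] [StarModule ℂ M] (E : Expectation M)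
    (m : Fin n → M) :
    E.permForm (finRotate n) m = E.φ (List.ofFn m).prod := by
  obtain ⟨n, rfl⟩ := Nat.exists_eq_succ_of_ne_zero hn.ne'
  rw [permForm_eq_prod_of_lists (P := [List.finRange (n + 1)]), List.map_singleton,
    List.prod_singleton, List.ofFn_eq_map]
  · simp [← List.length_eq_zero_iff]
  · simpa using List.nodup_finRange _
  · simp
  · intro L hL k hk
    rw [List.mem_singleton] at hL
    subst hL
    ext
    simp [Fin.val_add]

/-! ### Averaging over colourings with roots of unity -/

theorem sum_prod_stdAddChar_mul_eq_zero {n : ℕ} [NeZero n] {S : Finset (Fin n)}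
    (hS : 0 < S.card) (hS' : S.card < n) (a : (Fin n → ZMod n) → ℂ)
    (ha : ∀ f, a (f + Set.indicator (S : Set (Fin n)) 1) = a f) :
    ∑ f, (∏ i, ZMod.stdAddChar (f i)) * a f = 0 := by
  classical
  set s : Fin n → ZMod n := Set.indicator (S : Set (Fin n)) 1 with hs
  have hprod : ∏ i, ZMod.stdAddChar (s i) = ZMod.stdAddChar ((S.card : ℕ) : ZMod n) := by
    have : ∀ i, ZMod.stdAddChar (s i) = if i ∈ S then ZMod.stdAddChar (1 : ZMod n) else 1 := by
      intro i
      by_cases hi : i ∈ S <;> simp [hs, hi]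
    simp_rw [this]
    rw [Finset.prod_ite_mem, Finset.univ_inter, Finset.prod_const,
      ← AddChar.map_nsmul_eq_pow, nsmul_one]
  have hne : ZMod.stdAddChar ((S.card : ℕ) : ZMod n) ≠ 1 := by
    rw [← AddChar.map_zero_eq_one (ZMod.stdAddChar (N := n))]
    intro h
    have := ZMod.injective_stdAddChar h
    rw [ZMod.natCast_eq_zero_iff] at this
    exact absurd (Nat.le_of_dvd hS this) (by omega)
  -- The change of variable `f ↦ f + s` multiplies the sum by the character at `|S|`, which is not
  -- `1` because `0 < |S| < n`.
  have key : ∑ f, (∏ i, ZMod.stdAddChar (f i)) * a f =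
      ZMod.stdAddChar ((S.card : ℕ) : ZMod n) * ∑ f, (∏ i, ZMod.stdAddChar (f i)) * a f := by
    conv_lhs => rw [← Equiv.sum_comp (Equiv.addRight s)]
    rw [Finset.mul_sum]
    refine Finset.sum_congr rfl fun f _ => ?_
    simp only [Equiv.coe_addRight, ha, Pi.add_apply, AddChar.map_add_eq_mul,
      Finset.prod_mul_distrib, hprod]
    ring
  have : (1 - ZMod.stdAddChar ((S.card : ℕ) : ZMod n)) *
      ∑ f, (∏ i, ZMod.stdAddChar (f i)) * a f = 0 := by
    rw [sub_mul, ← key]; ring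
  exact (mul_eq_zero.1 this).resolve_left (sub_ne_zero.2 hne.symm)

/-- Averaging with roots of unity a family of functionals indexed by colourings produces
coefficients of a cumulant. -/
theorem exists_coeff_of_expansion {n : ℕ} [NeZero n] (hn : 2 ≤ n) {Ω : Type*}
    (pf : Perm (Fin n) → Ω → ℂ) (Ψ : (Fin n → ZMod n) → Ω → ℂ)
    (hΨ : ∀ f, Ψ f ∈ Submodule.span ℂ (pf '' {σ | f ∘ σ = f}))
    (hconst : ∀ k, Ψ (fun _ => k) = pf (finRotate n))
    (hshift : ∀ ω, ∃ S : Finset (Fin n), 0 < S.card ∧ S.card < n ∧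
      ∀ f, Ψ (f + Set.indicator (S : Set (Fin n)) 1) ω = Ψ f ω) :
    ∃ c : Perm (Fin n) → ℂ,
      (∑ σ : Perm (Fin n) with σ.cycleType = {n}, c σ) ≠ 0 ∧
      ∀ ω, ∑ σ, c σ * pf σ ω = 0 := by
  classical
  -- Expansions are not unique, so they are chosen with a controlled sum over `n`-cycles: the single
  -- term `finRotate n` for constant colourings, and only permutations preserving `f` otherwise.
  have hd : ∀ f, ∃ d : Perm (Fin n) → ℂ, (∀ ω, Ψ f ω = ∑ σ, d σ * pf σ ω) ∧
      ∑ σ : Perm (Fin n) with σ.cycleType = {n}, d σ =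
        if ∃ k, f = fun _ => k then 1 else 0 := by
    intro f
    by_cases hf : ∃ k, f = fun _ => k
    · obtain ⟨k, rfl⟩ := hf
      refine ⟨Pi.single (finRotate n) 1, fun ω => ?_, ?_⟩
      · rw [hconst, Finset.sum_eq_single (finRotate n)]
        · simp
        · intro σ _ h; simp [h]
        · simp
      · rw [if_pos ⟨k, rfl⟩, Finset.sum_eq_single (finRotate n)]
        · simp
        · intro σ _ h; simp [h]
        · simp [cycleType_finRotate_of_le hn]
    · obtain ⟨l, hl, hl'⟩ := (Finsupp.mem_span_image_iff_linearCombination ℂ).1 (hΨ f)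
      refine ⟨l, fun ω => ?_, ?_⟩
      · rw [← hl', Finsupp.linearCombination_apply, Finsupp.sum_fintype]
        · simp
        · simp
      · rw [if_neg hf]
        refine Finset.sum_eq_zero fun σ hσ => ?_
        by_contra hne
        have hfσ : f ∘ σ = f := hl (Finsupp.mem_support_iff.2 hne)
        have hcyc : σ.cycleType = {n} := (Finset.mem_filter.1 hσ).2
        have hIs : σ.IsCycle := Perm.card_cycleType_eq_one.1 (by rw [hcyc]; rfl)
        have hsupp : σ.support = Finset.univ := by
          rw [← Finset.card_eq_iff_eq_univ, ← Perm.sum_cycleType, hcyc]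
          simp
        -- A colouring preserved by an `n`-cycle is constant along its only orbit.
        refine hf ⟨f 0, funext fun i => ?_⟩
        have h0 : σ 0 ≠ 0 := Perm.mem_support.1 (hsupp ▸ Finset.mem_univ _)
        have hi : σ i ≠ i := Perm.mem_support.1 (hsupp ▸ Finset.mem_univ _)
        obtain ⟨k, rfl⟩ := (hIs.sameCycle h0 hi).exists_nat_pow_eq
        clear hi
        induction k with
        | zero => simp
        | succ k ih =>
          rw [pow_succ', Perm.mul_apply, ← ih]
          exact congrFun hfσ _
  choose d hd hd' using hd
  refine ⟨fun σ => ∑ f, (∏ i, ZMod.stdAddChar (f i)) * d f σ, ?_, fun ω => ?_⟩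
  · rw [Finset.sum_comm]
    simp_rw [← Finset.mul_sum, hd', mul_ite, mul_one, mul_zero]
    rw [← Finset.sum_filter]
    have h1 : ∀ f ∈ Finset.univ.filter (fun f : Fin n → ZMod n => ∃ k, f = fun _ => k),
        ∏ i, ZMod.stdAddChar (f i) = 1 := by
      intro f hf
      obtain ⟨k, rfl⟩ := (Finset.mem_filter.1 hf).2
      rw [Finset.prod_const, ← AddChar.map_nsmul_eq_pow]
      simp
    rw [Finset.sum_congr rfl h1, Finset.sum_const, nsmul_one, Nat.cast_ne_zero, ← Nat.pos_iff_ne_zero,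
      Finset.card_pos]
    exact ⟨fun _ => 0, Finset.mem_filter.2 ⟨Finset.mem_univ _, 0, rfl⟩⟩
  · obtain ⟨S, hS, hS', hinv⟩ := hshift ω
    rw [← sum_prod_stdAddChar_mul_eq_zero hS hS' (fun f => Ψ f ω) hinv]
    simp_rw [hd, Finset.sum_mul, Finset.mul_sum]
    rw [Finset.sum_comm]
    simp_rw [mul_assoc]

/-- Empty lists are allowed, with factor `φ(1) = 1`, so that the classes of a colouring can be used
without asking which colours occur. -/
theorem exists_permForm_eq_prod {n : ℕ} (P : List (List (Fin n)))
    (hnd : P.flatten.Nodup) (hmem : ∀ i, i ∈ P.flatten) :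
    ∃ σ : Perm (Fin n), (∀ L ∈ P, ∀ i ∈ L, σ i ∈ L) ∧
      ∀ {M : Type u} [Ring M] [StarRing M] [Algebra ℂ M] [StarModule ℂ M] (E : Expectation M)
        (m : Fin n → M),
        E.permForm σ m = (P.map fun L => E.φ (L.map m).prod).prod := by
  classical
  obtain ⟨σ, hσ⟩ := exists_perm_of_flatten_nodup P hnd hmem
  refine ⟨σ, fun L hL i hi => ?_, ?_⟩
  · obtain ⟨k, hk, rfl⟩ := List.getElem_of_mem hi
    rw [hσ L hL k hk]
    exact List.getElem_mem _
  intro M _ _ _ _ E m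
  have hfl : (P.filter fun L => !L.isEmpty).flatten = P.flatten :=
    List.flatten_filter_not_isEmpty
  rw [permForm_eq_prod_of_lists (P := P.filter fun L => !L.isEmpty)]
  · clear hσ hfl hmem hnd
    induction P with
    | nil => simp
    | cons L P ih =>
      by_cases hL : L = []
      · subst hL
        simpa [E.map_one] using ih
      · rw [List.filter_cons_of_pos (by simpa using hL), List.map_cons, List.prod_cons, ih,
          List.map_cons, List.prod_cons]
  · intro L hL
    simpa using (List.mem_filter.1 hL).2
  · rwa [hfl]
  · rwa [hfl]
  · intro L hL
    exact hσ L (List.mem_filter.1 hL).1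

/-! ### The semi-inner product of an expectation, and independence -/

namespace Expectation

section

variable {M : Type u} [Ring M] [StarRing M] [Algebra ℂ M] [StarModule ℂ M]

/-- The semi-inner product `⟨x, y⟩ = φ (y x*)`. -/
@[reducible]
noncomputable def innerCore (E : Expectation M) : PreInnerProductSpace.Core ℂ M where
  inner x y := E.φ (y * star x)
  conj_inner_symm x y := by
    change star (E.φ (x * star y)) = E.φ (y * star x)
    rw [← E.map_star, star_mul, star_star]
  re_inner_nonneg x := E.nonneg x
  add_left x y z := by simp [mul_add]
  smul_left x y r := by simp

theorem norm_sq_le (E : Expectation M) (x y : M) :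
    ‖E.φ (y * star x)‖ ^ 2 ≤ (E.φ (x * star x)).re * (E.φ (y * star y)).re := by
  have h := @InnerProductSpace.Core.inner_mul_inner_self_le ℂ M _ _ _ E.innerCore x y
  have h' : ‖E.φ (y * star x)‖ * ‖E.φ (x * star y)‖ ≤
      (E.φ (x * star x)).re * (E.φ (y * star y)).re := h
  have hs : ‖E.φ (x * star y)‖ = ‖E.φ (y * star x)‖ := by
    rw [← norm_star, ← E.map_star, star_mul, star_star]
  rw [hs] at h'
  rwa [sq]

/-- Cauchy–Schwarz: an element of norm zero is orthogonal to everything. At time `0` this lets the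
unitary be replaced by `1` although it need not equal `1`. -/
theorem map_mul_eq_zero_of_null (E : Expectation M) {x : M} (hx : E.φ (x * star x) = 0) (z : M) :
    E.φ (x * z) = 0 := by
  have h := E.norm_sq_le (star z) x
  rw [hx, star_star] at h
  have : ‖E.φ (x * z)‖ = 0 := by
    apply pow_eq_zero_iff (two_ne_zero) |>.1
    exact le_antisymm (by simpa using h) (by positivity)
  simpa using this

theorem norm_map_unitary_le (E : Expectation M) {x : M} (hx : x ∈ unitary M) : ‖E.φ x‖ ≤ 1 := by
  have h := E.norm_sq_le 1 x
  rw [Unitary.mul_star_self_of_mem hx, star_one, mul_one, mul_one, E.map_one] at h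
  have : ‖E.φ x‖ ^ 2 ≤ 1 := by simpa using h
  exact (sq_le_one_iff₀ (norm_nonneg _)).1 this

theorem map_conj_unitary (E : Expectation M) {x : M} (hx : x ∈ unitary M) (y : M) :
    E.φ (x * y * star x) = E.φ y := by
  rw [E.map_mul_comm, ← mul_assoc, Unitary.star_mul_self_of_mem hx, one_mul]

theorem map_mul_of_independent (E : Expectation M) {A B : StarSubalgebra ℂ M}
    (h : E.Independent ![A, B]) {a b : M} (ha : a ∈ A) (hb : b ∈ B) :
    E.φ (a * b) = E.φ a * E.φ b := by
  have h1 : E.φ ((a - algebraMap ℂ M (E.φ a)) * (b - algebraMap ℂ M (E.φ b))) = 0 := by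
    have := h.2 [(0, a - algebraMap ℂ M (E.φ a)), (1, b - algebraMap ℂ M (E.φ b))] (by simp)
      (by simp) (by
        have hα : ∀ c : ℂ, E.φ (algebraMap ℂ M c) = c := fun c => by
          rw [Algebra.algebraMap_eq_smul_one, map_smul, E.map_one, smul_eq_mul, mul_one]
        simp only [List.mem_cons, List.not_mem_nil, or_false, forall_eq_or_imp, forall_eq,
          map_sub, hα, sub_self, and_true]
        exact ⟨sub_mem ha (algebraMap_mem A _), sub_mem hb (algebraMap_mem B _)⟩)
    simpa using this
  simp only [Algebra.algebraMap_eq_smul_one, sub_mul, mul_sub, map_sub, mul_smul_comm,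
    smul_mul_assoc, one_mul, mul_one, map_smul, smul_eq_mul, E.map_one] at h1
  linear_combination h1

end

end Expectation

/-! ### Mixed words in two `t`-free subalgebras -/

/-- The data to which a `t`-free cumulant of order `n` applies. -/
structure MixedWord (t : ENNReal) (n : ℕ) : Type (u + 1) where
  M : Type u
  [ring : Ring M]
  [starRing : StarRing M]
  [algebra : Algebra ℂ M]
  [starModule : StarModule ℂ M]
  E : Expectation M
  A : StarSubalgebra ℂ M
  B : StarSubalgebra ℂ M
  tfree : E.TFree t A B
  m : Fin n → M
  mem : ∀ i, m i ∈ A ∨ m i ∈ B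
  not_left : ¬ ∀ i, m i ∈ A
  not_right : ¬ ∀ i, m i ∈ B

attribute [instance] MixedWord.ring MixedWord.starRing MixedWord.algebra MixedWord.starModule

/-- With all mixed words collected in one type, a span of functions on that type provides
coefficients that serve every probability space at once. -/
theorem exists_isTFreeCumulant {t : ENNReal} {n : ℕ} [NeZero n] (hn : 2 ≤ n)
    (Ψ : (Fin n → ZMod n) → MixedWord.{u} t n → ℂ)
    (hΨ : ∀ f, Ψ f ∈ Submodule.span ℂ
      ((fun σ (ω : MixedWord.{u} t n) => ω.E.permForm σ ω.m) '' {σ | f ∘ σ = f}))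
    (hconst : ∀ k ω, Ψ (fun _ => k) ω = ω.E.permForm (finRotate n) ω.m)
    (hshift : ∀ ω, ∃ S : Finset (Fin n), 0 < S.card ∧ S.card < n ∧
      ∀ f, Ψ (f + Set.indicator (S : Set (Fin n)) 1) ω = Ψ f ω) :
    ∃ c : Perm (Fin n) → ℂ, IsTFreeCumulant.{u} t n c := by
  obtain ⟨c, hc, hc'⟩ := exists_coeff_of_expansion hn
    (fun σ (ω : MixedWord.{u} t n) => ω.E.permForm σ ω.m) Ψ hΨ (fun k => funext (hconst k)) hshift
  refine ⟨c, hc, ?_⟩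
  intro M _ _ _ _ E A B hAB m h1 h2 h3
  exact hc' ⟨M, E, A, B, hAB, m, h1, h2, h3⟩

namespace MixedWord

variable {t : ENNReal} {n : ℕ}

open Classical in
/-- The positions of the letters taken in the first subalgebra. -/
noncomputable def left (ω : MixedWord.{u} t n) : Finset (Fin n) :=
  Finset.univ.filter fun i => ω.m i ∈ ω.A

theorem mem_left (ω : MixedWord.{u} t n) {i : Fin n} : i ∈ ω.left ↔ ω.m i ∈ ω.A := by
  simp [left]

theorem mem_right (ω : MixedWord.{u} t n) {i : Fin n} (h : i ∉ ω.left) : ω.m i ∈ ω.B :=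
  (ω.mem i).resolve_left fun h' => h (ω.mem_left.2 h')

theorem card_left_pos (ω : MixedWord.{u} t n) : 0 < ω.left.card := by
  rw [Finset.card_pos]
  by_contra h
  rw [Finset.not_nonempty_iff_eq_empty] at h
  exact ω.not_right fun i => ω.mem_right (by simp [h])

theorem card_left_lt (ω : MixedWord.{u} t n) : ω.left.card < n := by
  refine lt_of_le_of_ne ((Finset.card_le_univ _).trans (by simp)) fun h => ω.not_left fun i => ?_
  rw [← ω.mem_left, Finset.eq_univ_of_card ω.left (by simpa using h)]
  exact Finset.mem_univ i

/-- The letters of a mixed word represented in the `t`-free product. -/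
theorem exists_model (ω : MixedWord.{u} t n) :
    ∃ (X : Type u) (_ : Ring X) (_ : StarRing X) (_ : Algebra ℂ X) (_ : StarModule ℂ X)
      (F : Expectation X) (A B : StarSubalgebra ℂ X) (x : X) (y : Fin n → X),
      F.Independent ![A, B] ∧ F.IsFreeUnitaryBMAt t x ∧ F.Free ![A ⊔ B, StarAlgebra.adjoin ℂ {x}] ∧
      (∀ i ∈ ω.left, y i ∈ A) ∧ (∀ i ∉ ω.left, y i ∈ B) ∧
      ∀ L : List (Fin n), ω.E.φ (L.map ω.m).prod =
        F.φ (L.map fun i => if i ∈ ω.left then y i else x * y i * star x).prod := by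
  classical
  obtain ⟨X, _, _, _, _, F, α, β, x, h, hw⟩ := ω.tfree
  let s : Fin n → ω.A ⊕ ω.B := fun i =>
    if hi : i ∈ ω.left then Sum.inl ⟨ω.m i, ω.mem_left.1 hi⟩ else Sum.inr ⟨ω.m i, ω.mem_right hi⟩
  refine ⟨X, _, _, _, _, F, α.range, β.range, x, fun i => Sum.elim α β (s i), h.independent,
    h.brownian, h.free, fun i hi => ?_, fun i hi => ?_, fun L => ?_⟩
  · simp only [s, dif_pos hi, Sum.elim_inl]
    exact ⟨_, rfl⟩
  · simp only [s, dif_neg hi, Sum.elim_inr]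
    exact ⟨_, rfl⟩
  · have := hw (L.map s)
    rw [List.map_map, List.map_map] at this
    convert this using 4 with i
    · funext i
      by_cases hi : i ∈ ω.left <;> simp [s, hi]
    · funext i
      by_cases hi : i ∈ ω.left <;> simp [s, hi]

end MixedWord

/-! ### Time `0`: cumulants from independent copies -/

theorem freeUnitaryBMMoment_zero (k : ℕ) (hk : 1 ≤ k) : freeUnitaryBMMoment 0 k = 1 := by
  have hk' : (k : ℝ) ≠ 0 := by positivity
  rw [freeUnitaryBMMoment, if_neg ENNReal.zero_ne_top, Finset.sum_eq_single 0]
  · simp [hk']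
  · intro j _ hj
    simp [hj]
  · simp

/-- Traciality brings each letter to the front of the word, where it can be exchanged. -/
theorem Expectation.map_list_prod_congr {X : Type u} [Ring X] [StarRing X] [Algebra ℂ X]
    [StarModule ℂ X] (F : Expectation X) {ι : Type*} (y z : ι → X)
    (h : ∀ i w, F.φ (y i * w) = F.φ (z i * w)) (L : List ι) (w : X) :
    F.φ ((L.map y).prod * w) = F.φ ((L.map z).prod * w) := by
  induction L generalizing w with
  | nil => rfl
  | cons i L ih =>
    simp only [List.map_cons, List.prod_cons]
    rw [mul_assoc, h, F.map_mul_comm, mul_assoc, ih, F.map_mul_comm _ (w * z i), mul_assoc,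
      F.map_mul_comm w, mul_assoc]

theorem Commute.list_prod_map_filter {X ι : Type*} [Monoid X] (y : ι → X) (p : ι → Prop)
    [DecidablePred p] (h : ∀ i j, p i → ¬ p j → Commute (y i) (y j)) (L : List ι) :
    (L.map y).prod = ((L.filter p).map y).prod * ((L.filter fun i => ¬ p i).map y).prod := by
  induction L with
  | nil => simp
  | cons i L ih =>
    rw [List.map_cons, List.prod_cons, ih]
    by_cases hi : p i
    · simp [hi, mul_assoc]
    · have hc : Commute (y i) ((L.filter p).map y).prod := by
        refine Commute.list_prod_right _ _ fun z hz => ?_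
        obtain ⟨j, hj, rfl⟩ := List.mem_map.1 hz
        exact (h j i (by simpa using (List.mem_filter.1 hj).2) hi).symm
      simp only [hi, decide_false, Bool.false_eq_true, not_false_eq_true, List.filter_cons_of_neg,
        decide_true, List.filter_cons_of_pos, List.map_cons, List.prod_cons]
      rw [← mul_assoc, hc.eq, mul_assoc]

/-- At time `0` a moment factorises into the contributions of the two subalgebras. -/
theorem MixedWord.map_prod_eq_mul {n : ℕ} (ω : MixedWord.{u} 0 n) (L : List (Fin n)) :
    ω.E.φ (L.map ω.m).prod = ω.E.φ ((L.filter fun i => i ∈ ω.left).map ω.m).prod *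
      ω.E.φ ((L.filter fun i => i ∉ ω.left).map ω.m).prod := by
  obtain ⟨X, _, _, _, _, F, A, B, x, y, hind, hx, -, hyA, hyB, hw⟩ := ω.exists_model
  have hx1 : F.φ x = 1 := by
    have := hx.2 1 le_rfl
    rwa [pow_one, freeUnitaryBMMoment_zero 1 le_rfl, Complex.ofReal_one] at this
  have hx1' : F.φ (star x) = 1 := by rw [F.map_star, hx1, star_one]
  -- A unitary of expectation `1` is at distance zero from `1` in the semi-norm: the four terms of
  -- `φ((x - 1)(x - 1)*)` cancel.
  have hnull : ∀ w, F.φ ((x - 1) * w) = 0 := F.map_mul_eq_zero_of_null (by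
    simp [sub_mul, mul_sub, Unitary.mul_star_self_of_mem hx.1, hx1, hx1', F.map_one])
  have hnull' : ∀ w, F.φ ((star x - 1) * w) = 0 := F.map_mul_eq_zero_of_null (by
    simp [sub_mul, mul_sub, Unitary.star_mul_self_of_mem hx.1, hx1, hx1', F.map_one])
  have hx2 : ∀ w, F.φ (x * w) = F.φ w := fun w => by
    have := hnull w
    rwa [sub_mul, one_mul, map_sub, sub_eq_zero] at this
  have hx2' : ∀ w, F.φ (star x * w) = F.φ w := fun w => by
    have := hnull' w
    rwa [sub_mul, one_mul, map_sub, sub_eq_zero] at this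
  have hw' : ∀ L : List (Fin n), ω.E.φ (L.map ω.m).prod = F.φ (L.map y).prod := by
    intro L
    rw [hw, ← mul_one (L.map y).prod, ← F.map_list_prod_congr _ y _ L 1, mul_one]
    intro i w
    by_cases hi : i ∈ ω.left
    · rw [if_pos hi]
    · rw [if_neg hi, mul_assoc, mul_assoc, hx2, F.map_mul_comm, mul_assoc, hx2', F.map_mul_comm]
  rw [hw', hw', hw', Commute.list_prod_map_filter y (fun i => i ∈ ω.left)]
  · refine F.map_mul_of_independent hind (list_prod_mem ?_) (list_prod_mem ?_)
    · intro z hz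
      obtain ⟨j, hj, rfl⟩ := List.mem_map.1 hz
      exact hyA j (by simpa using (List.mem_filter.1 hj).2)
    · intro z hz
      obtain ⟨j, hj, rfl⟩ := List.mem_map.1 hz
      exact hyB j (by simpa using (List.mem_filter.1 hj).2)
  · intro i j hi hj
    exact hind.1 0 1 (by decide) _ (hyA i hi) _ (hyB j hj)

theorem nodup_flatten_fibers {α κ : Type*} [Fintype α] [DecidableEq κ] (l : List α) (hl : l.Nodup)
    (f : α → κ) (K : List κ) (hK : K.Nodup) :
    (K.map fun k => l.filter fun i => f i = k).flatten.Nodup := by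
  rw [List.nodup_flatten]
  refine ⟨?_, ?_⟩
  · intro L hL
    obtain ⟨k, -, rfl⟩ := List.mem_map.1 hL
    exact hl.filter _
  · rw [List.pairwise_map]
    refine hK.imp fun {a b} hab i hi hi' => hab ?_
    have h1 : f i = a := by simpa using (List.mem_filter.1 hi).2
    have h2 : f i = b := by simpa using (List.mem_filter.1 hi').2
    rw [← h1, h2]

theorem exists_isTFreeCumulant_zero {n : ℕ} [NeZero n] (hn : 2 ≤ n) :
    ∃ c : Perm (Fin n) → ℂ, IsTFreeCumulant.{u} 0 n c := by
  classical
  -- In independent copies a moment is the product, over the colours, of the moment of the subword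
  -- of that colour.
  refine exists_isTFreeCumulant hn (fun f ω => ∏ k : ZMod n,
    ω.E.φ (((List.finRange n).filter fun i => f i = k).map ω.m).prod) ?_ ?_ ?_
  · intro f
    apply Submodule.subset_span
    set K := (Finset.univ : Finset (ZMod n)).toList with hK
    obtain ⟨σ, hσ, hσ'⟩ := exists_permForm_eq_prod.{u}
      (K.map fun k => (List.finRange n).filter fun i => f i = k)
      (nodup_flatten_fibers _ (List.nodup_finRange n) f K (Finset.nodup_toList _))
      (fun i => List.mem_flatten.2 ⟨_, List.mem_map.2 ⟨f i, by simp [hK], rfl⟩, by simp⟩)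
    refine ⟨σ, funext fun i => ?_, funext fun ω => ?_⟩
    · have := hσ _ (List.mem_map.2 ⟨f i, by simp [hK], rfl⟩) i (by simp)
      simpa using this
    · simp only [hσ', List.map_map]
      rw [← Finset.prod_map_toList]
      rfl
  · intro k ω
    rw [permForm_finRotate (by omega), Finset.prod_eq_single k]
    · simp [List.ofFn_eq_map]
    · intro k' _ hk'
      simp [hk'.symm, ω.E.map_one]
    · simp
  · intro ω
    refine ⟨ω.left, ω.card_left_pos, ω.card_left_lt, fun f => ?_⟩
    have hsplit : ∀ f : Fin n → ZMod n, ∏ k : ZMod n,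
        ω.E.φ (((List.finRange n).filter fun i => f i = k).map ω.m).prod =
        (∏ k : ZMod n, ω.E.φ
          (((List.finRange n).filter fun i => i ∈ ω.left ∧ f i = k).map ω.m).prod) *
        ∏ k : ZMod n, ω.E.φ
          (((List.finRange n).filter fun i => i ∉ ω.left ∧ f i = k).map ω.m).prod := by
      intro f
      rw [← Finset.prod_mul_distrib]
      refine Finset.prod_congr rfl fun k _ => ?_
      rw [ω.map_prod_eq_mul, List.filter_filter, List.filter_filter]
      simp only [Bool.decide_and]
    rw [hsplit, hsplit]
    congr 1
    -- The shift permutes the colour classes of the letters of `A`, so the first factor is only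
    -- reindexed; the classes of the letters of `B` do not move.
    · rw [← Equiv.prod_comp (Equiv.addRight (1 : ZMod n))]
      refine Finset.prod_congr rfl fun k _ => ?_
      congr 4
      funext i
      by_cases hi : i ∈ ω.left <;> simp [hi]
    · refine Finset.prod_congr rfl fun k _ => ?_
      congr 4
      funext i
      by_cases hi : i ∈ ω.left <;> simp [hi]

/-! ### The universal moment formula of a free family -/

theorem Expectation.map_algebraMap {M : Type u} [Ring M] [StarRing M] [Algebra ℂ M]
    [StarModule ℂ M] (E : Expectation M) (c : ℂ) : E.φ (algebraMap ℂ M c) = c := by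
  rw [Algebra.algebraMap_eq_smul_one, map_smul, E.map_one, smul_eq_mul, mul_one]

theorem Expectation.map_sub_algebraMap {M : Type u} [Ring M] [StarRing M] [Algebra ℂ M]
    [StarModule ℂ M] (E : Expectation M) (x : M) : E.φ (x - algebraMap ℂ M (E.φ x)) = 0 := by
  rw [map_sub, E.map_algebraMap, sub_self]

/-- A word in the members of a free family, with prescribed colours. -/
structure FreeWord (K : Type v) (n : ℕ) (g : Fin n → K) : Type (max (u + 1) v) where
  M : Type u
  [ring : Ring M]
  [starRing : StarRing M]
  [algebra : Algebra ℂ M]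
  [starModule : StarModule ℂ M]
  E : Expectation M
  A : K → StarSubalgebra ℂ M
  free : E.Free A
  m : Fin n → M
  mem : ∀ i, m i ∈ A (g i)

attribute [instance] FreeWord.ring FreeWord.starRing FreeWord.algebra FreeWord.starModule

namespace FreeWord

variable {K : Type v} {n : ℕ} {g : Fin n → K}

/-- The linear combinations of products of monochromatic moments along lists which together
exhaust the indices `I`. -/
def momentSpan (g : Fin n → K) (I : List (Fin n)) : Submodule ℂ (FreeWord.{u} K n g → ℂ) :=
  Submodule.span ℂ {F | ∃ P : List (List (Fin n)), (∀ L ∈ P, ∃ k, ∀ i ∈ L, g i = k) ∧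
    P.flatten.Perm I ∧ F = fun ω => (P.map fun L => ω.E.φ (L.map ω.m).prod).prod}

theorem mul_mem_momentSpan {I J : List (Fin n)} {F G : FreeWord.{u} K n g → ℂ}
    (hF : F ∈ momentSpan g I) (hG : G ∈ momentSpan g J) : F * G ∈ momentSpan g (I ++ J) := by
  have h := Submodule.mul_mem_mul hF hG
  rw [momentSpan, momentSpan, Submodule.span_mul_span] at h
  refine Submodule.span_mono ?_ h
  rintro _ ⟨_, ⟨P, h1, h2, rfl⟩, _, ⟨Q, h3, h4, rfl⟩, rfl⟩
  refine ⟨P ++ Q, ?_, ?_, ?_⟩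
  · intro L hL
    exact (List.mem_append.1 hL).elim (h1 L) (h3 L)
  · rw [List.flatten_append]
    exact h2.append h4
  · funext ω
    simp

theorem momentSpan_perm {I J : List (Fin n)} (h : I.Perm J) :
    momentSpan.{u} g I = momentSpan g J := by
  unfold momentSpan
  congr 1
  ext F
  refine exists_congr fun P => and_congr_right fun _ => and_congr_left fun _ => ?_
  exact ⟨fun h' => h'.trans h, fun h' => h'.trans h.symm⟩

/-- The product of the letters of `ω` with indices in a list. -/
def letter (ω : FreeWord.{u} K n g) (q : K × List (Fin n)) : ω.M := (q.2.map ω.m).prod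

/-- The centred version of a letter. -/
noncomputable def letterC (ω : FreeWord.{u} K n g) (q : K × List (Fin n)) : ω.M :=
  ω.letter q - algebraMap ℂ ω.M (ω.E.φ (ω.letter q))

theorem letter_mem (ω : FreeWord.{u} K n g) {q : K × List (Fin n)} (hq : ∀ i ∈ q.2, g i = q.1) :
    ω.letter q ∈ ω.A q.1 := by
  refine list_prod_mem fun z hz => ?_
  obtain ⟨i, hi, rfl⟩ := List.mem_map.1 hz
  exact hq i hi ▸ ω.mem i

theorem letter_mem_momentSpan {q : K × List (Fin n)} (hq : ∀ i ∈ q.2, g i = q.1) :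
    (fun ω : FreeWord.{u} K n g => ω.E.φ (ω.letter q)) ∈ momentSpan g q.2 := by
  refine Submodule.subset_span ⟨[q.2], ?_, by simp, ?_⟩
  · intro L hL
    rw [List.mem_singleton] at hL
    subst hL
    exact ⟨q.1, hq⟩
  · funext ω
    simp [letter]

/-- Letters are centered one at a time. For a letter `x` with centered version `x°`, `φ(p x° s°) =
φ(p x s°) - φ(x) φ(p s°)`. The first term is handled by moving `x` into the prefix `p`; the second
contains a shorter word, and `φ(p s°)` differs from `φ(p s)` by an element of the span. -/
theorem sub_centered_mem_momentSpan (N : ℕ)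
    (ih : ∀ w : List (K × List (Fin n)), w.length < N → (∀ q ∈ w, ∀ i ∈ q.2, g i = q.1) →
      (fun ω : FreeWord.{u} K n g => ω.E.φ (w.map ω.letter).prod) ∈
        momentSpan g (w.map Prod.snd).flatten)
    (s p : List (K × List (Fin n))) (hN : p.length + s.length ≤ N)
    (hp : ∀ q ∈ p, ∀ i ∈ q.2, g i = q.1) (hs : ∀ q ∈ s, ∀ i ∈ q.2, g i = q.1) :
    (fun ω : FreeWord.{u} K n g => ω.E.φ ((p.map ω.letter).prod * (s.map ω.letter).prod) -
        ω.E.φ ((p.map ω.letter).prod * (s.map ω.letterC).prod)) ∈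
      momentSpan g ((p ++ s).map Prod.snd).flatten := by
  induction s generalizing p with
  | nil =>
    convert Submodule.zero_mem _ using 1
    funext ω
    simp
  | cons x s ihs =>
    have hs' : ∀ q ∈ s, ∀ i ∈ q.2, g i = q.1 := fun q hq => hs q (List.mem_cons_of_mem _ hq)
    have hx : ∀ i ∈ x.2, g i = x.1 := hs x List.mem_cons_self
    simp only [List.length_cons] at hN
    have h1 := ihs (p ++ [x]) (by simp; omega)
      (fun q hq => (List.mem_append.1 hq).elim (hp q) fun h => by
        rw [List.mem_singleton.1 h]; exact hx) hs'
    have h2 := ihs p (by omega) hp hs'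
    have h3 := ih (p ++ s) (by simp; omega)
      fun q hq => (List.mem_append.1 hq).elim (hp q) (hs' q)
    have h4 := mul_mem_momentSpan (letter_mem_momentSpan hx) (Submodule.sub_mem _ h3 h2)
    have e1 : ((p ++ [x] ++ s).map Prod.snd).flatten = ((p ++ x :: s).map Prod.snd).flatten := by
      simp
    have e2 : (x.2 ++ ((p ++ s).map Prod.snd).flatten).Perm
        ((p ++ x :: s).map Prod.snd).flatten := by
      simp only [List.map_append, List.flatten_append, List.map_cons, List.flatten_cons]
      rw [← List.append_assoc, ← List.append_assoc]
      exact List.perm_append_comm.append_right _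
    rw [e1] at h1
    rw [momentSpan_perm e2] at h4
    convert Submodule.add_mem _ h1 h4 using 1
    funext ω
    simp only [List.map_append, List.prod_append, List.map_cons, List.prod_cons, List.map_nil,
      List.prod_nil, mul_one, Pi.add_apply, Pi.mul_apply, Pi.sub_apply, letterC, sub_mul, mul_sub,
      map_sub, Algebra.algebraMap_eq_smul_one, smul_mul_assoc, one_mul, mul_smul_comm, map_smul,
      smul_eq_mul, mul_assoc]
    ring

/-- If neighbours always have different colours, the product of the centered letters has expectation
zero by freeness, so the previous difference is the whole moment. Otherwise two neighbours of the
same colour are merged into one letter, and the word gets shorter. -/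
theorem word_mem_momentSpan (N : ℕ) (w : List (K × List (Fin n))) (hN : w.length = N)
    (hw : ∀ q ∈ w, ∀ i ∈ q.2, g i = q.1) :
    (fun ω : FreeWord.{u} K n g => ω.E.φ (w.map ω.letter).prod) ∈
      momentSpan g (w.map Prod.snd).flatten := by
  induction N using Nat.strong_induction_on generalizing w with
  | _ N ih =>
    by_cases hchain : w.IsChain fun p q => p.1 ≠ q.1
    · rcases eq_or_ne w [] with rfl | hne
      · refine Submodule.subset_span ⟨[], by simp, by simp, ?_⟩
        funext ω
        simp [ω.E.map_one]
      · have h := sub_centered_mem_momentSpan.{u} N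
          (fun w' h1 h2 => ih w'.length h1 w' rfl h2) w [] (by simp [hN]) (by simp) hw
        rw [List.nil_append] at h
        convert h using 1
        funext ω
        have hfree : ω.E.φ (w.map ω.letterC).prod = 0 := by
          have := ω.free (w.map fun q => (q.1, ω.letterC q)) (by simpa using hne)
            (by rwa [List.isChain_map]) (by
              intro p hp
              obtain ⟨q, hq, rfl⟩ := List.mem_map.1 hp
              exact ⟨sub_mem (ω.letter_mem (hw q hq)) (algebraMap_mem _ _),
                ω.E.map_sub_algebraMap _⟩)
          rwa [List.map_map] at this
        simp [hfree]
    · rw [List.isChain_iff_forall_rel_of_append_cons_cons] at hchain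
      push Not at hchain
      obtain ⟨a, b, p, s, rfl, hab⟩ := hchain
      have h := ih _ (by simp at hN ⊢; omega) (p ++ (a.1, a.2 ++ b.2) :: s) rfl (by
        intro q hq i hi
        rcases List.mem_append.1 hq with hq | hq
        · exact hw q (by simp [hq]) i hi
        rcases List.mem_cons.1 hq with rfl | hq
        · rcases List.mem_append.1 hi with hi | hi
          · exact hw a (by simp) i hi
          · exact (hw b (by simp) i hi).trans hab.symm
        · exact hw q (by simp [hq]) i hi)
      convert h using 1
      · simp
      · funext ω
        simp [letter, mul_assoc]

/-- A moment of a free family is a universal combination of the permutation forms whose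
cycles are monochromatic. -/
theorem exists_coeff (g : Fin n → K) :
    ∃ d : Perm (Fin n) → ℂ, (∀ σ, d σ ≠ 0 → g ∘ σ = g) ∧
      ∀ ω : FreeWord.{u} K n g, ω.E.φ (List.ofFn ω.m).prod = ∑ σ, d σ * ω.E.permForm σ ω.m := by
  have h := word_mem_momentSpan.{u} (g := g) _ ((List.finRange n).map fun i => (g i, [i])) rfl
    (by simp)
  have hle : momentSpan.{u} g (List.finRange n) ≤ Submodule.span ℂ
      ((fun σ (ω : FreeWord.{u} K n g) => ω.E.permForm σ ω.m) '' {σ | g ∘ σ = g}) := by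
    refine Submodule.span_le.2 ?_
    rintro F ⟨P, hP, hperm, rfl⟩
    obtain ⟨σ, hσ, hσ'⟩ := exists_permForm_eq_prod.{u} P
      (hperm.nodup_iff.2 (List.nodup_finRange n)) (fun i => hperm.mem_iff.2 (List.mem_finRange i))
    refine Submodule.subset_span ⟨σ, funext fun i => ?_, funext fun ω => hσ' ω.E ω.m⟩
    obtain ⟨L, hL, hi⟩ := List.mem_flatten.1 (hperm.mem_iff.2 (List.mem_finRange i))
    obtain ⟨k, hk⟩ := hP L hL
    exact (hk _ (hσ L hL i hi)).trans (hk i hi).symm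
  have e : (((List.finRange n).map fun i => (g i, [i])).map Prod.snd).flatten =
      List.finRange n := by
    rw [List.map_map]
    exact List.flatMap_pure_eq_map id _ |>.trans (List.map_id _)
  rw [e] at h
  obtain ⟨l, hl, hl'⟩ := (Finsupp.mem_span_image_iff_linearCombination ℂ).1 (hle h)
  refine ⟨l, fun σ hσ => hl (Finsupp.mem_support_iff.2 hσ), fun ω => ?_⟩
  have := congrFun hl' ω
  rw [Finsupp.linearCombination_apply, Finsupp.sum_fintype _ _ (by simp)] at this
  simp only [Finset.sum_apply, Pi.smul_apply, smul_eq_mul, List.map_map] at this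
  rw [this, List.ofFn_eq_map]
  congr 3
  funext i
  simp [letter]

end FreeWord

/-! ### Associativity of freeness -/

namespace Expectation

section

variable {M : Type u} [Ring M] [StarRing M] [Algebra ℂ M] [StarModule ℂ M]

theorem Free.comp_injective {ι κ : Type*} {E : Expectation M} {A : ι → StarSubalgebra ℂ M}
    (h : E.Free A) {j : κ → ι} (hj : Injective j) : E.Free (A ∘ j) := by
  intro l hl hchain hmem
  have := h (l.map fun p => (j p.1, p.2)) (by simpa using hl)
    (by rw [List.isChain_map]; exact hchain.imp fun _ _ h => hj.ne h) (by
      intro p hp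
      obtain ⟨q, hq, rfl⟩ := List.mem_map.1 hp
      exact hmem q hq)
  rwa [List.map_map] at this

/-- A chain of centered elements of a family of subalgebras. -/
def IsCenteredChain {ι : Type*} (E : Expectation M) (A : ι → StarSubalgebra ℂ M)
    (l : List (ι × M)) : Prop :=
  l.IsChain (fun p q => p.1 ≠ q.1) ∧ ∀ p ∈ l, p.2 ∈ A p.1 ∧ E.φ p.2 = 0

/-- The linear span of the products of centered chains with colours over `j`. -/
def chainSpan {ι κ : Type*} (E : Expectation M) (A : ι → StarSubalgebra ℂ M) (p : ι → κ) (j : κ) :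
    Submodule ℂ M :=
  Submodule.span ℂ {x | ∃ l, E.IsCenteredChain A l ∧ (∀ q ∈ l, p q.1 = j) ∧
    (l.map Prod.snd).prod = x}

/-- If the chain starts with colour `i`, its first letter is absorbed into `z`. What is then put in
front of the chain splits into a centered element, which prolongs the chain, and a scalar. -/
theorem mul_mem_chainSpan {ι κ : Type*} {E : Expectation M} {A : ι → StarSubalgebra ℂ M}
    {p : ι → κ} {i : ι} {z : M} (hz : z ∈ A i) {x : M} (hx : x ∈ E.chainSpan A p (p i)) :
    z * x ∈ E.chainSpan A p (p i) := by
  have hsplit : ∀ y : M, y = (y - algebraMap ℂ M (E.φ y)) + algebraMap ℂ M (E.φ y) := fun y => by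
    simp
  have hcentered : ∀ y ∈ A i, y - algebraMap ℂ M (E.φ y) ∈ A i ∧
      E.φ (y - algebraMap ℂ M (E.φ y)) = 0 := fun y hy =>
    ⟨sub_mem hy (algebraMap_mem _ _), E.map_sub_algebraMap y⟩
  have key : ∀ z ∈ A i, ∀ l, E.IsCenteredChain A l → (∀ q ∈ l, p q.1 = p i) →
      (∀ q ∈ l.head?, q.1 ≠ i) → z * (l.map Prod.snd).prod ∈ E.chainSpan A p (p i) := by
    intro z hz l hl hp hhead
    rw [hsplit z, add_mul, ← Algebra.smul_def]
    refine Submodule.add_mem _ (Submodule.subset_span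
      ⟨(i, z - algebraMap ℂ M (E.φ z)) :: l, ⟨?_, ?_⟩, ?_, by simp⟩)
      (Submodule.smul_mem _ _ (Submodule.subset_span ⟨l, hl, hp, rfl⟩))
    · exact List.isChain_cons.2 ⟨fun q hq => (hhead q hq).symm, hl.1⟩
    · intro q hq
      rcases List.mem_cons.1 hq with rfl | hq
      · exact hcentered z hz
      · exact hl.2 q hq
    · intro q hq
      rcases List.mem_cons.1 hq with rfl | hq
      · rfl
      · exact hp q hq
  induction hx using Submodule.span_induction with
  | mem x hx =>
    obtain ⟨l, hl, hp, rfl⟩ := hx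
    rcases l with _ | ⟨q, l⟩
    · exact key z hz [] hl hp (by simp)
    by_cases hq : q.1 = i
    · have hl' : E.IsCenteredChain A l :=
        ⟨hl.1.tail, fun r hr => hl.2 r (List.mem_cons_of_mem _ hr)⟩
      rw [List.map_cons, List.prod_cons, ← mul_assoc]
      refine key _ (mul_mem hz (hq ▸ (hl.2 q List.mem_cons_self).1)) l hl'
        (fun r hr => hp r (List.mem_cons_of_mem _ hr)) fun r hr => ?_
      rw [← hq]
      exact ((List.isChain_cons.1 hl.1).1 r hr).symm
    · exact key z hz _ hl hp (by simpa using hq)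
  | zero => simp
  | add x y _ _ hx hy => rw [mul_add]; exact Submodule.add_mem _ hx hy
  | smul c x _ hx => rw [mul_smul_comm]; exact Submodule.smul_mem _ _ hx

/-- The span contains `1` and is stable under left multiplication by the generators, hence by the
algebra that they generate. -/
theorem adjoin_le_chainSpan {ι κ : Type*} {E : Expectation M} {A : ι → StarSubalgebra ℂ M}
    {p : ι → κ} {j : κ} {x : M}
    (hx : x ∈ StarAlgebra.adjoin ℂ {z | ∃ i, p i = j ∧ z ∈ A i}) : x ∈ E.chainSpan A p j := by
  have h1 : (1 : M) ∈ E.chainSpan A p j :=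
    Submodule.subset_span ⟨[], ⟨List.isChain_nil, by simp⟩, by simp, by simp⟩
  suffices ∀ w ∈ E.chainSpan A p j, x * w ∈ E.chainSpan A p j by simpa using this 1 h1
  change x ∈ Algebra.adjoin ℂ _ at hx
  induction hx using Algebra.adjoin_induction with
  | mem x hx =>
    have : ∃ i, p i = j ∧ x ∈ A i := by
      rcases hx with hx | ⟨i, hi, hx⟩
      · exact hx
      · exact ⟨i, hi, by simpa using star_mem hx⟩
    obtain ⟨i, rfl, hi⟩ := this
    exact fun w hw => mul_mem_chainSpan hi hw
  | algebraMap c =>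
    intro w hw
    rw [← Algebra.smul_def]
    exact Submodule.smul_mem _ _ hw
  | add x y _ _ hx hy =>
    intro w hw
    rw [add_mul]
    exact Submodule.add_mem _ (hx w hw) (hy w hw)
  | mul x y _ _ hx hy =>
    intro w hw
    rw [mul_assoc]
    exact hx _ (hy w hw)

/-- Freeness is associative: grouping the members of a free family yields a free family. -/
theorem Free.adjoin_fibers {ι κ : Type*} {E : Expectation M} {A : ι → StarSubalgebra ℂ M}
    (h : E.Free A) (p : ι → κ) :
    E.Free fun j => StarAlgebra.adjoin ℂ {z | ∃ i, p i = j ∧ z ∈ A i} := by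
  have hzero : ∀ l, E.IsCenteredChain A l → l ≠ [] → E.φ (l.map Prod.snd).prod = 0 :=
    fun l hl hne => h l hne hl.1 hl.2
  have hcent : ∀ j, ∀ x ∈ StarAlgebra.adjoin ℂ {z | ∃ i, p i = j ∧ z ∈ A i}, E.φ x = 0 →
      x ∈ Submodule.span ℂ {x | ∃ l, E.IsCenteredChain A l ∧ l ≠ [] ∧ (∀ q ∈ l, p q.1 = j) ∧
        (l.map Prod.snd).prod = x} := by
    intro j x hx hx0
    have hx' := adjoin_le_chainSpan (E := E) hx
    -- The statement proved by induction is the linear one: `x - φ(x) 1` lies in the span for every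
    -- `x` of the chain span, centered or not.
    rw [← sub_zero x, ← map_zero (algebraMap ℂ M), ← hx0]
    clear hx hx0
    induction hx' using Submodule.span_induction with
    | mem x hx =>
      obtain ⟨l, hl, hp, rfl⟩ := hx
      rcases eq_or_ne l [] with rfl | hne
      · simp [E.map_one]
      · rw [hzero l hl hne, map_zero, sub_zero]
        exact Submodule.subset_span ⟨l, hl, hne, hp, rfl⟩
    | zero => simp
    | add x y _ _ hx hy =>
      convert Submodule.add_mem _ hx hy using 1
      simp only [map_add]
      abel
    | smul c x _ hx =>
      convert Submodule.smul_mem _ c hx using 1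
      rw [map_smul, smul_sub, smul_eq_mul, map_mul, ← Algebra.smul_def]
  intro l hne hchain hmem
  -- Nonempty chains over different members of the grouping can be concatenated: at the junction the
  -- fine colours differ because the coarse ones do. The condition on the head keeps track of the
  -- coarse colour at the next junction.
  have key : ∀ l : List (κ × M), l ≠ [] → l.IsChain (fun p q => p.1 ≠ q.1) →
      (∀ q ∈ l, q.2 ∈ StarAlgebra.adjoin ℂ {z | ∃ i, p i = q.1 ∧ z ∈ A i} ∧ E.φ q.2 = 0) →
      (l.map Prod.snd).prod ∈ Submodule.span ℂ {x | ∃ l', E.IsCenteredChain A l' ∧ l' ≠ [] ∧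
        (∀ r ∈ l'.head?, ∀ q ∈ l.head?, p r.1 = q.1) ∧ (l'.map Prod.snd).prod = x} := by
    intro l
    induction l with
    | nil => intro h; exact absurd rfl h
    | cons q l ih =>
      intro _ hchain hmem
      have hq := hcent q.1 q.2 (hmem q List.mem_cons_self).1 (hmem q List.mem_cons_self).2
      rcases eq_or_ne l [] with rfl | hne
      · simp only [List.map_cons, List.map_nil, List.prod_cons, List.prod_nil, mul_one]
        refine Submodule.span_mono ?_ hq
        rintro _ ⟨l', h1, h2, h3, rfl⟩
        refine ⟨l', h1, h2, ?_, rfl⟩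
        intro r hr q' hq'
        simp only [List.head?_cons, Option.mem_def, Option.some.injEq] at hq'
        subst hq'
        exact h3 r (List.mem_of_mem_head? hr)
      · have hl := ih hne hchain.tail fun r hr => hmem r (List.mem_cons_of_mem _ hr)
        rw [List.map_cons, List.prod_cons]
        have h := Submodule.mul_mem_mul hq hl
        rw [Submodule.span_mul_span] at h
        refine Submodule.span_mono ?_ h
        rintro _ ⟨_, ⟨l₁, a1, a2, a3, rfl⟩, _, ⟨l₂, b1, b2, b3, rfl⟩, rfl⟩
        refine ⟨l₁ ++ l₂, ⟨?_, ?_⟩, by simp [a2], ?_, by simp⟩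
        · rw [List.isChain_append]
          refine ⟨a1.1, b1.1, fun r hr s hs hrs => ?_⟩
          obtain ⟨q', l', rfl⟩ := List.exists_cons_of_ne_nil hne
          have h1 := b3 s hs q' (by simp)
          have h2 := a3 r (List.mem_of_mem_getLast? hr)
          have h3 := (List.isChain_cons_cons.1 hchain).1
          exact h3 (by rw [← h2, hrs, h1])
        · intro r hr
          exact (List.mem_append.1 hr).elim (a1.2 r) (b1.2 r)
        · intro r hr q' hq'
          simp only [List.head?_cons, Option.mem_def, Option.some.injEq] at hq'
          subst hq'
          rw [List.head?_append_of_ne_nil _ a2] at hr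
          exact a3 r (List.mem_of_mem_head? hr)
  have hspan := key l hne hchain hmem
  have hker : Submodule.span ℂ {x | ∃ l', E.IsCenteredChain A l' ∧ l' ≠ [] ∧
        (∀ r ∈ l'.head?, ∀ q ∈ l.head?, p r.1 = q.1) ∧ (l'.map Prod.snd).prod = x} ≤
      LinearMap.ker E.φ := by
    refine Submodule.span_le.2 ?_
    rintro _ ⟨l', h1, h2, -, rfl⟩
    exact hzero l' h1 h2
  exact hker hspan

end

end Expectation

/-! ### Time `∞`: cumulants from conjugates by powers of a Haar unitary -/

namespace Expectation

section

variable {M : Type u} [Ring M] [StarRing M] [Algebra ℂ M] [StarModule ℂ M]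

/-- The conjugate of a subalgebra by a unitary element. -/
noncomputable def conjSubalgebra (C : StarSubalgebra ℂ M) (v : unitary M) : StarSubalgebra ℂ M :=
  C.map ((Unitary.conjStarAlgAut ℂ M v : M ≃⋆ₐ[ℂ] M) : M →⋆ₐ[ℂ] M)

theorem mem_conjSubalgebra {C : StarSubalgebra ℂ M} {v : unitary M} {z : M} :
    z ∈ conjSubalgebra C v ↔ ∃ c ∈ C, (v : M) * c * star (v : M) = z := Iff.rfl

theorem map_zpow_eq_zero {E : Expectation M} {v : unitary M}
    (hv : E.IsFreeUnitaryBMAt ⊤ (v : M)) {k : ℤ} (hk : k ≠ 0) :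
    E.φ ((v ^ k : unitary M) : M) = 0 := by
  have hpos : ∀ k : ℕ, k ≠ 0 → E.φ ((v ^ k : unitary M) : M) = 0 := by
    intro k hk
    have := hv.2 k (by omega)
    rw [freeUnitaryBMMoment, if_pos rfl, Complex.ofReal_zero] at this
    simpa using this
  obtain ⟨n, rfl | rfl⟩ := k.eq_nat_or_neg
  · rw [zpow_natCast]
    exact hpos n (by simpa using hk)
  · rw [zpow_neg, zpow_natCast, ← Unitary.star_eq_inv, Unitary.coe_star, E.map_star,
      hpos n (by simpa using hk), star_zero]

theorem zpow_mem_adjoin (v : unitary M) (k : ℤ) :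
    ((v ^ k : unitary M) : M) ∈ StarAlgebra.adjoin ℂ {(v : M)} := by
  have hv : (v : M) ∈ StarAlgebra.adjoin ℂ {(v : M)} :=
    StarAlgebra.subset_adjoin ℂ _ (Set.mem_singleton _)
  obtain ⟨n, rfl | rfl⟩ := k.eq_nat_or_neg
  · rw [zpow_natCast, SubmonoidClass.coe_pow]
    exact pow_mem hv n
  · rw [zpow_neg, zpow_natCast, ← Unitary.star_eq_inv, Unitary.coe_star, SubmonoidClass.coe_pow]
    exact star_mem (pow_mem hv n)

/-- The conjugates of a subalgebra by the powers of a Haar unitary free from it are free. -/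
theorem free_conjSubalgebra_zpow {E : Expectation M} {C : StarSubalgebra ℂ M} {v : unitary M}
    (hv : E.IsFreeUnitaryBMAt ⊤ (v : M))
    (hfree : E.Free ![C, StarAlgebra.adjoin ℂ {(v : M)}]) :
    E.Free fun k : ℤ => conjSubalgebra C (v ^ k) := by
  -- A product of elements `v^{k_j} c_j v^{-k_j}` is `v^{k_1} c_1 v^{k_2 - k_1} c_2 ⋯ c_m v^{-k_m}`.
  -- The inner powers are nonzero, hence centered, and alternate with the centered `c_j`.
  have key : ∀ l : List (ℤ × M), ∀ hne : l ≠ [], l.IsChain (fun p q => p.1 ≠ q.1) →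
      (∀ p ∈ l, p.2 ∈ conjSubalgebra C (v ^ p.1) ∧ E.φ p.2 = 0) →
      ∃ r : List (Fin 2 × M), E.IsCenteredChain ![C, StarAlgebra.adjoin ℂ {(v : M)}] r ∧ r ≠ [] ∧
        (∀ q ∈ r.head?, q.1 = 0) ∧
        (l.map Prod.snd).prod = ((v ^ (l.head hne).1 : unitary M) : M) * (r.map Prod.snd).prod *
          ((v ^ (-(l.getLast hne).1) : unitary M) : M) := by
    intro l
    induction l with
    | nil => intro h; exact absurd rfl h
    | cons p l ih =>
      intro _ hchain hmem
      obtain ⟨⟨c, hc, hpc⟩, hp0⟩ := hmem p List.mem_cons_self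
      have hpc' : ((v ^ p.1 : unitary M) : M) * c * star ((v ^ p.1 : unitary M) : M) = p.2 := hpc
      have hc0 : E.φ c = 0 := by
        rw [← hp0, ← hpc', E.map_conj_unitary (v ^ p.1).2]
      have hstar : star ((v ^ p.1 : unitary M) : M) = ((v ^ (-p.1) : unitary M) : M) := by
        rw [zpow_neg, ← Unitary.star_eq_inv, Unitary.coe_star]
      rcases eq_or_ne l [] with rfl | hne
      · refine ⟨[(0, c)], ⟨List.isChain_singleton _, ?_⟩, by simp, by simp, ?_⟩
        · intro q hq
          rw [List.mem_singleton] at hq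
          subst hq
          exact ⟨hc, hc0⟩
        · simp [← hpc', hstar]
      · obtain ⟨r, hr, hrne, hhead, hprod⟩ := ih hne hchain.tail
          fun q hq => hmem q (List.mem_cons_of_mem _ hq)
        obtain ⟨q, l', rfl⟩ := List.exists_cons_of_ne_nil hne
        have hpq : p.1 ≠ q.1 := (List.isChain_cons_cons.1 hchain).1
        refine ⟨(0, c) :: (1, ((v ^ (q.1 - p.1) : unitary M) : M)) :: r, ⟨?_, ?_⟩, by simp,
          by simp, ?_⟩
        · rw [List.isChain_cons_cons, List.isChain_cons]
          refine ⟨by simp, fun s hs => ?_, hr.1⟩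
          rw [hhead s hs]
          simp
        · intro s hs
          rcases List.mem_cons.1 hs with rfl | hs
          · exact ⟨hc, hc0⟩
          rcases List.mem_cons.1 hs with rfl | hs
          · exact ⟨zpow_mem_adjoin v _, map_zpow_eq_zero hv (by omega)⟩
          · exact hr.2 s hs
        · rw [List.map_cons, List.prod_cons, hprod, ← hpc', hstar]
          have h2 : ((v ^ (q.1 - p.1) : unitary M) : M) =
              ((v ^ (-p.1) : unitary M) : M) * ((v ^ q.1 : unitary M) : M) := by
            rw [← Submonoid.coe_mul, ← zpow_add]
            congr 2
            ring
          simp only [List.head_cons, List.map_cons, List.prod_cons, h2, mul_assoc,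
            List.getLast_cons_cons]
  intro l hne hchain hmem
  obtain ⟨r, hr, hrne, hhead, hprod⟩ := key l hne hchain hmem
  rw [hprod, E.map_mul_comm, ← mul_assoc, ← Submonoid.coe_mul, ← zpow_add]
  -- By traciality the two outer powers of `v` meet: they either cancel or form one more centered
  -- letter at the front of the chain.
  by_cases h0 : -(l.getLast hne).1 + (l.head hne).1 = 0
  · rw [h0, zpow_zero, OneMemClass.coe_one, one_mul]
    exact hfree r hrne hr.1 hr.2
  · have := hfree ((1, ((v ^ (-(l.getLast hne).1 + (l.head hne).1) : unitary M) : M)) :: r)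
      (by simp) (List.isChain_cons.2 ⟨fun s hs => by rw [hhead s hs]; simp, hr.1⟩) (by
        intro s hs
        rcases List.mem_cons.1 hs with rfl | hs
        · exact ⟨zpow_mem_adjoin v _, map_zpow_eq_zero hv h0⟩
        · exact hr.2 s hs)
    simpa using this

/-- The colour is constant along a cycle of `σ`, so all its letters are conjugated by the same
unitary; the conjugations telescope and disappear under the trace. -/
theorem cycleMoment_congr_conj {n : ℕ} {κ : Type*} (E : Expectation M) (σ : Perm (Fin n))
    (f : Fin n → κ) (hf : f ∘ σ = f) (v : κ → unitary M) (y : Fin n → M) (i : Fin n) :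
    E.cycleMoment σ (fun i => (v (f i) : M) * y i * star (v (f i) : M)) i =
      E.cycleMoment σ y i := by
  unfold cycleMoment
  have hfk : ∀ k : ℕ, f ((σ ^ k) i) = f i := by
    intro k
    induction k with
    | zero => rfl
    | succ k ih =>
      rw [pow_succ', Perm.mul_apply, ← ih]
      exact congrFun hf _
  simp only [hfk]
  have hmul : ∀ L : List ℕ, (L.map fun k => (v (f i) : M) * y ((σ ^ k) i) *
      star (v (f i) : M)).prod = (v (f i) : M) * (L.map fun k => y ((σ ^ k) i)).prod *
      star (v (f i) : M) := by
    intro L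
    have := map_list_prod (Unitary.conjStarAlgAut ℂ M (v (f i))) (L.map fun k => y ((σ ^ k) i))
    rw [Unitary.conjStarAlgAut_apply, List.map_map] at this
    exact this.symm
  rw [hmul, E.map_conj_unitary (v (f i)).2]

theorem permForm_congr_conj {n : ℕ} {κ : Type*} (E : Expectation M) (σ : Perm (Fin n))
    (f : Fin n → κ) (hf : f ∘ σ = f) (v : κ → unitary M) (y : Fin n → M) :
    E.permForm σ (fun i => (v (f i) : M) * y i * star (v (f i) : M)) = E.permForm σ y := by
  rw [permForm_eq, permForm_eq]
  exact Finset.prod_congr rfl fun i _ => E.cycleMoment_congr_conj σ f hf v y i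

theorem permForm_congr_words {N : Type v} [Ring N] [StarRing N] [Algebra ℂ N] [StarModule ℂ N]
    {n : ℕ} (E : Expectation M) (F : Expectation N) (m : Fin n → M) (y : Fin n → N)
    (h : ∀ L : List (Fin n), E.φ (L.map m).prod = F.φ (L.map y).prod) (σ : Perm (Fin n)) :
    E.permForm σ m = F.permForm σ y := by
  rw [permForm_eq, permForm_eq]
  refine Finset.prod_congr rfl fun i _ => ?_
  have := h ((List.range (minimalPeriod σ i)).map fun k => (σ ^ k) i)
  rwa [List.map_map, List.map_map] at this

end

end Expectation

/-- For `t = ∞`, the universal combinations attached to the colourings `f` become moments of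
words in free copies. -/
theorem MixedWord.exists_free_copies {n : ℕ} [NeZero n] (ω : MixedWord.{u} ⊤ n)
    (d : (Fin n → ZMod n) → Perm (Fin n) → ℂ) (hd : ∀ f σ, d f σ ≠ 0 → f ∘ σ = f)
    (hd' : ∀ f, ∀ ω : FreeWord.{u} (ZMod n) n f,
      ω.E.φ (List.ofFn ω.m).prod = ∑ σ, d f σ * ω.E.permForm σ ω.m) :
    (∀ k, ∑ σ, d (fun _ => k) σ * ω.E.permForm σ ω.m = ω.E.permForm (finRotate n) ω.m) ∧
    ∀ f, ∑ σ, d (f + Set.indicator (ω.left : Set (Fin n)) 1) σ * ω.E.permForm σ ω.m =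
      ∑ σ, d f σ * ω.E.permForm σ ω.m := by
  classical
  obtain ⟨X, _, _, _, _, F, A, B, x, y, -, hx, hfree, hyA, hyB, hw⟩ := ω.exists_model
  set v : unitary X := ⟨x, hx.1⟩ with hv
  set z : Fin n → X := fun i => if i ∈ ω.left then y i else x * y i * star x with hz
  have hC := Expectation.free_conjSubalgebra_zpow (v := v) hx hfree
  have hform : ∀ σ, ω.E.permForm σ ω.m = F.permForm σ z :=
    Expectation.permForm_congr_words _ _ _ _ hw
  -- Copy number `k` is the conjugate by `v^{2k}`. As `B` already sits at `v B v*`, the copies of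
  -- `A` occupy the even exponents and those of `B` the odd ones, so that all `2n` of them are
  -- distinct members of one free family.
  let b : ZMod n → unitary X := fun k => v ^ (2 * k.val : ℤ)
  let e : ZMod n × Bool → ℤ := fun p => 2 * p.1.val + if p.2 then 0 else 1
  have he : Injective e := by
    rintro ⟨k, s⟩ ⟨k', s'⟩ h
    have h1 : k.val = k'.val ∧ s = s' := by
      cases s <;> cases s' <;> simp only [e, Bool.false_eq_true, if_true, if_false] at h <;>
        refine ⟨?_, ?_⟩ <;> first | rfl | omega
    exact Prod.ext (ZMod.val_injective n h1.1) h1.2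
  have hmem : ∀ k i, (b k : X) * z i * star (b k : X) ∈
      Expectation.conjSubalgebra (A ⊔ B) (v ^ e (k, decide (i ∈ ω.left))) := by
    intro k i
    rw [Expectation.mem_conjSubalgebra]
    refine ⟨y i, ?_, ?_⟩
    · by_cases hi : i ∈ ω.left
      · exact (le_sup_left : A ≤ A ⊔ B) (hyA i hi)
      · exact (le_sup_right : B ≤ A ⊔ B) (hyB i hi)
    · by_cases hi : i ∈ ω.left
      · simp [hz, hi, e, b]
      · have : v ^ e (k, decide (i ∈ ω.left)) = b k * v := by
          simp only [hi, e, b, decide_false, Bool.false_eq_true, if_false]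
          rw [zpow_add, zpow_one]
        rw [this]
        simp [hz, hi, hv, mul_assoc]
  have hgroup := (hC.comp_injective he).adjoin_fibers Prod.fst
  -- Only permutations preserving `f` occur, and for these the conjugations by `b (f i)` do not
  -- change the form: the combination is the moment of the word in free copies.
  have hΨ : ∀ f, ∑ σ, d f σ * ω.E.permForm σ ω.m =
      F.φ (List.ofFn fun i => (b (f i) : X) * z i * star (b (f i) : X)).prod := by
    intro f
    have := hd' f ⟨X, F, _, hgroup, fun i => (b (f i) : X) * z i * star (b (f i) : X), fun i =>
      StarAlgebra.subset_adjoin ℂ _ ⟨(f i, decide (i ∈ ω.left)), rfl, hmem _ _⟩⟩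
    refine Eq.trans (Finset.sum_congr rfl fun σ _ => ?_) this.symm
    by_cases h0 : d f σ = 0
    · simp [h0]
    · rw [hform]
      exact congrArg _ (F.permForm_congr_conj σ f (hd f σ h0) b z).symm
  refine ⟨fun k => ?_, fun f => ?_⟩
  · have hmul := map_list_prod (Unitary.conjStarAlgAut ℂ X (b k)) (List.ofFn z)
    rw [Unitary.conjStarAlgAut_apply, List.map_ofFn] at hmul
    rw [hΨ, hform, permForm_finRotate (NeZero.pos n), ← F.map_conj_unitary (b k).2 (List.ofFn z).prod]
    exact congrArg _ hmul.symm
  · set f' := f + Set.indicator (ω.left : Set (Fin n)) 1 with hf'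
    let g : Fin n → ZMod n × Bool := fun i => (f i, decide (i ∈ ω.left))
    -- The shift on the letters of `A` is a relabelling of the fine colours (copy number, side). The
    -- words before and after it are governed by the same universal coefficients `d₀` for the
    -- colouring `g`, in two relabellings of one free family.
    let π : ZMod n × Bool → ZMod n × Bool := fun p => (if p.2 then p.1 + 1 else p.1, p.2)
    have hπ : Injective π := by
      rintro ⟨k, s⟩ ⟨k', s'⟩ h
      cases s <;> cases s' <;> simp [π] at h ⊢ <;> exact h
    have hπg : ∀ i, π (g i) = (f' i, decide (i ∈ ω.left)) := by
      intro i
      by_cases hi : i ∈ ω.left <;> simp [π, g, hf', hi]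
    obtain ⟨d₀, hd₀, hd₀'⟩ := FreeWord.exists_coeff.{u} g
    have h1 := hd₀' ⟨X, F, _, hC.comp_injective he,
      fun i => (b (f i) : X) * z i * star (b (f i) : X), fun i => hmem _ _⟩
    have h2 := hd₀' ⟨X, F, _, (hC.comp_injective he).comp_injective hπ,
      fun i => (b (f' i) : X) * z i * star (b (f' i) : X), fun i => by
        simp only [comp_apply, hπg]
        exact hmem _ _⟩
    rw [hΨ, hΨ]
    refine h2.trans (Eq.trans (Finset.sum_congr rfl fun σ _ => ?_) h1.symm)
    by_cases h0 : d₀ σ = 0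
    · simp [h0]
    · have hg := hd₀ σ h0
      have hgf : f ∘ σ = f := funext fun i => congrArg Prod.fst (congrFun hg i)
      have hgf' : f' ∘ σ = f' := funext fun i => by
        have := congrArg (fun p => (π p).1) (congrFun hg i)
        simpa only [comp_apply, hπg] using this
      refine congrArg _ ?_
      exact (F.permForm_congr_conj σ f' hgf' b z).trans (F.permForm_congr_conj σ f hgf b z).symm

theorem exists_isTFreeCumulant_top {n : ℕ} [NeZero n] (hn : 2 ≤ n) :
    ∃ c : Perm (Fin n) → ℂ, IsTFreeCumulant.{u} ⊤ n c := by
  choose d hd hd' using fun f : Fin n → ZMod n => FreeWord.exists_coeff.{u} f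
  refine exists_isTFreeCumulant hn (fun f ω => ∑ σ, d f σ * ω.E.permForm σ ω.m) ?_ ?_ ?_
  · intro f
    have : (fun ω : MixedWord.{u} ⊤ n => ∑ σ, d f σ * ω.E.permForm σ ω.m) =
        ∑ σ, d f σ • fun ω : MixedWord.{u} ⊤ n => ω.E.permForm σ ω.m := by
      funext ω
      simp
    rw [this]
    refine Submodule.sum_mem _ fun σ _ => ?_
    by_cases h0 : d f σ = 0
    · simp [h0]
    · exact Submodule.smul_mem _ _ (Submodule.subset_span ⟨σ, hd f σ h0, rfl⟩)
  · intro k ω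
    exact (ω.exists_free_copies d hd hd').1 k
  · intro ω
    exact ⟨ω.left, ω.card_left_pos, ω.card_left_lt, (ω.exists_free_copies d hd hd').2⟩

/-! ### Laurent coefficients as contour integrals -/

open Complex Metric in
/-- The Laurent coefficient of index `n` at the origin, as an integral over the circle of
radius `ρ`. -/
noncomputable def laurentCoeff (ρ : ℝ) (n : ℤ) (g : ℂ → ℂ) : ℂ :=
  (2 * Real.pi * I)⁻¹ * ∮ z in C(0, ρ), z ^ (-n - 1) * g z

namespace laurentCoeff

open Complex Metric

variable {ρ R : ℝ} {g h : ℂ → ℂ}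

theorem ne_zero_of_mem_sphere (hρ : 0 < ρ) {z : ℂ} (hz : z ∈ sphere (0 : ℂ) ρ) : z ≠ 0 := by
  rintro rfl
  simp at hz
  exact hρ.ne hz

theorem circleIntegrable (hρ : 0 < ρ) (hρR : ρ < R) (hg : DifferentiableOn ℂ g (ball 0 R)) (n : ℤ) :
    CircleIntegrable (fun z => z ^ n * g z) 0 ρ := by
  refine ContinuousOn.circleIntegrable hρ.le (ContinuousOn.mul ?_ ?_)
  · exact fun z hz => (continuousAt_zpow₀ z n (Or.inl (ne_zero_of_mem_sphere hρ hz))).continuousWithinAt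
  · exact hg.continuousOn.mono (sphere_subset_closedBall.trans (closedBall_subset_ball hρR))

theorem congr (hρ : 0 ≤ ρ) (n : ℤ) (hgh : Set.EqOn g h (sphere 0 ρ)) :
    laurentCoeff ρ n g = laurentCoeff ρ n h := by
  unfold laurentCoeff
  congr 1
  exact circleIntegral.integral_congr hρ fun z hz => by simp only [hgh hz]

theorem add (hρ : 0 < ρ) (hρR : ρ < R) (hg : DifferentiableOn ℂ g (ball 0 R))
    (hh : DifferentiableOn ℂ h (ball 0 R)) (n : ℤ) :
    laurentCoeff ρ n (fun z => g z + h z) = laurentCoeff ρ n g + laurentCoeff ρ n h := by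
  unfold laurentCoeff
  rw [← mul_add, ← circleIntegral.integral_add (circleIntegrable hρ hρR hg _)
    (circleIntegrable hρ hρR hh _)]
  simp only [mul_add]

theorem const_mul (ρ : ℝ) (n : ℤ) (a : ℂ) (g : ℂ → ℂ) :
    laurentCoeff ρ n (fun z => a * g z) = a * laurentCoeff ρ n g := by
  unfold laurentCoeff
  rw [mul_left_comm, ← circleIntegral.integral_const_mul a]
  simp only [mul_left_comm a]

theorem sum (hρ : 0 < ρ) (hρR : ρ < R) {ι : Type*} (s : Finset ι) (g : ι → ℂ → ℂ)
    (hg : ∀ i ∈ s, DifferentiableOn ℂ (g i) (ball 0 R)) (n : ℤ) :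
    laurentCoeff ρ n (fun z => ∑ i ∈ s, g i z) = ∑ i ∈ s, laurentCoeff ρ n (g i) := by
  unfold laurentCoeff
  rw [← Finset.mul_sum, ← circleIntegral.integral_fun_sum fun i hi =>
    circleIntegrable hρ hρR (hg i hi) _]
  simp only [Finset.mul_sum]

theorem pow_mul (hρ : 0 < ρ) (n : ℤ) (p : ℕ) (g : ℂ → ℂ) :
    laurentCoeff ρ n (fun z => z ^ p * g z) = laurentCoeff ρ (n - p) g := by
  unfold laurentCoeff
  congr 1
  refine circleIntegral.integral_congr hρ.le fun z hz => ?_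
  have hz0 := ne_zero_of_mem_sphere hρ hz
  simp only [← mul_assoc]
  rw [← zpow_natCast z p, ← zpow_add₀ hz0]
  congr 2
  ring

theorem integral_eq_zero (hρ : 0 < ρ) (hρR : ρ < R) (hg : DifferentiableOn ℂ g (ball 0 R)) :
    ∮ z in C(0, ρ), g z = 0 := by
  refine circleIntegral_eq_zero_of_differentiable_on_off_countable hρ.le Set.countable_empty
    (hg.continuousOn.mono (closedBall_subset_ball hρR)) fun z hz => ?_
  exact hg.differentiableAt (isOpen_ball.mem_nhds (ball_subset_ball hρR.le hz.1))

theorem eq_zero_of_neg (hρ : 0 < ρ) (hρR : ρ < R) (hg : DifferentiableOn ℂ g (ball 0 R)) {n : ℤ}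
    (hn : n < 0) : laurentCoeff ρ n g = 0 := by
  unfold laurentCoeff
  obtain ⟨k, hk⟩ := Int.eq_ofNat_of_zero_le (show 0 ≤ -n - 1 by omega)
  rw [integral_eq_zero hρ hρR, mul_zero]
  simp only [hk]
  simp only [zpow_natCast]
  exact (differentiableOn_id.pow k).mul hg

theorem one (hρ : 0 < ρ) : laurentCoeff ρ 0 (fun _ => 1) = 1 := by
  unfold laurentCoeff
  have := circleIntegral.integral_sub_center_inv (0 : ℂ) hρ.ne'
  simp only [sub_zero] at this
  simp only [neg_zero, zero_sub, zpow_neg_one, mul_one, this]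
  exact inv_mul_cancel₀ two_pi_I_ne_zero

theorem pow_of_ne (hρ : 0 < ρ) (n j : ℕ) :
    laurentCoeff ρ n (fun z => z ^ j) = if n = j then 1 else 0 := by
  have h : laurentCoeff ρ n (fun z => z ^ j) = laurentCoeff ρ ((n : ℤ) - j) (fun _ => 1) := by
    rw [← pow_mul hρ]
    simp
  rw [h]
  rcases lt_trichotomy n j with hlt | rfl | hgt
  · rw [if_neg hlt.ne]
    exact eq_zero_of_neg hρ (lt_add_one ρ) (differentiableOn_const 1) (by omega)
  · simp [one hρ]
  · rw [if_neg hgt.ne']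
    unfold laurentCoeff
    have hk : (-((n : ℤ) - j) - 1 + 1 : ℂ) ≠ 0 := by
      have : ((j : ℂ) - n) ≠ 0 := by
        rw [sub_ne_zero]
        exact_mod_cast hgt.ne
      simpa using this
    rw [circleIntegral.integral_eq_zero_of_hasDerivWithinAt' (f := fun z : ℂ =>
      ((-((n : ℤ) - j) - 1 + 1 : ℂ))⁻¹ * z ^ (-((n : ℤ) - j) - 1 + 1)), mul_zero]
    intro z hz
    rw [abs_of_pos hρ] at hz
    have := ((hasDerivAt_zpow (-((n : ℤ) - j) - 1 + 1) z
      (Or.inl (ne_zero_of_mem_sphere hρ hz))).const_mul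
        ((-((n : ℤ) - j) - 1 + 1 : ℂ))⁻¹).hasDerivWithinAt (s := sphere 0 |ρ|)
    convert this using 1
    push_cast at hk ⊢
    rw [← mul_assoc, inv_mul_cancel₀ hk]
    simp

end laurentCoeff

-- Repeated division by `z` with `dslope`, which remains holomorphic at the origin. An exact
-- remainder is used in place of a power series so that compositions stay within finite sums.
open Complex Metric in
theorem exists_taylor_remainder {R : ℝ} (hR : 0 < R) {g : ℂ → ℂ}
    (hg : DifferentiableOn ℂ g (ball 0 R)) (k : ℕ) :
    ∃ (a : ℕ → ℂ) (Q : ℂ → ℂ), DifferentiableOn ℂ Q (ball 0 R) ∧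
      ∀ z, g z = ∑ j ∈ Finset.range k, a j * z ^ j + z ^ k * Q z := by
  induction k with
  | zero => exact ⟨0, g, hg, by simp⟩
  | succ k ih =>
    obtain ⟨a, Q, hQ, h⟩ := ih
    refine ⟨fun j => if j = k then Q 0 else a j, dslope Q 0,
      (differentiableOn_dslope (ball_mem_nhds 0 hR)).2 hQ, fun z => ?_⟩
    have hz := sub_smul_dslope Q 0 z
    rw [sub_zero, smul_eq_mul] at hz
    have hsum : ∑ j ∈ Finset.range k, (if j = k then Q 0 else a j) * z ^ j =
        ∑ j ∈ Finset.range k, a j * z ^ j :=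
      Finset.sum_congr rfl fun j hj => by rw [if_neg (Finset.mem_range.1 hj).ne]
    simp only [Finset.sum_range_succ, if_true]
    rw [hsum, h z, pow_succ, mul_assoc, hz]
    ring

open Complex Metric in
theorem laurentCoeff.eq_of_expansion {ρ R : ℝ} (hρ : 0 < ρ) (hρR : ρ < R) {g Q : ℂ → ℂ} {a : ℕ → ℂ}
    {k n : ℕ} (hQ : DifferentiableOn ℂ Q (ball 0 R))
    (h : ∀ z ∈ ball (0 : ℂ) R, g z = ∑ j ∈ Finset.range k, a j * z ^ j + z ^ k * Q z)
    (hn : n < k) : laurentCoeff ρ n g = a n := by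
  have hsub : sphere (0 : ℂ) ρ ⊆ ball 0 R :=
    sphere_subset_closedBall.trans (closedBall_subset_ball hρR)
  have h1 : ∀ j ∈ Finset.range k, DifferentiableOn ℂ (fun z => a j * z ^ j) (ball 0 R) := by
    intro j _
    fun_prop
  have h2 : DifferentiableOn ℂ (fun z => z ^ k * Q z) (ball 0 R) :=
    (differentiableOn_id.pow k).mul hQ
  rw [laurentCoeff.congr hρ.le n fun z hz => h z (hsub hz), laurentCoeff.add hρ hρR
    (DifferentiableOn.fun_sum h1) h2, laurentCoeff.sum hρ hρR _ _ h1,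
    laurentCoeff.pow_mul hρ, laurentCoeff.eq_zero_of_neg hρ hρR hQ (by omega), add_zero,
    Finset.sum_eq_single n]
  · rw [laurentCoeff.const_mul, laurentCoeff.pow_of_ne hρ, if_pos rfl, mul_one]
  · intro j _ hj
    rw [laurentCoeff.const_mul, laurentCoeff.pow_of_ne hρ, if_neg hj.symm, mul_zero]
  · intro h'
    exact absurd (Finset.mem_range.2 hn) h'

-- Pascal's rule, through `(1 - z)^{-(p+1)} = (1 - z)^{-p} + z (1 - z)^{-(p+1)}`.
open Complex Metric in
theorem laurentCoeff.inv_one_sub_pow {ρ : ℝ} (hρ : 0 < ρ) (hρ1 : ρ < 1) (p n : ℕ) :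
    laurentCoeff ρ n (fun z => ((1 - z) ^ (p + 1))⁻¹) = ((n + p).choose p : ℂ) := by
  have hne : ∀ z ∈ ball (0 : ℂ) 1, 1 - z ≠ 0 := by
    intro z hz h
    rw [← sub_eq_zero.1 h] at hz
    simp at hz
  have hd : ∀ q : ℕ, DifferentiableOn ℂ (fun z : ℂ => ((1 - z) ^ q)⁻¹) (ball 0 1) := fun q =>
    (((differentiableOn_const 1).sub differentiableOn_id).pow q).inv
      fun z hz => pow_ne_zero _ (hne z hz)
  have hsub : sphere (0 : ℂ) ρ ⊆ ball 0 1 :=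
    sphere_subset_closedBall.trans (closedBall_subset_ball hρ1)
  have hrec : ∀ (q : ℕ) (n : ℤ), laurentCoeff ρ n (fun z => ((1 - z) ^ (q + 1))⁻¹) =
      laurentCoeff ρ n (fun z => ((1 - z) ^ q)⁻¹) +
        laurentCoeff ρ (n - 1) (fun z => ((1 - z) ^ (q + 1))⁻¹) := by
    intro q n
    have := laurentCoeff.pow_mul hρ n 1 (fun z => ((1 - z) ^ (q + 1))⁻¹)
    rw [Nat.cast_one] at this
    have h2 : DifferentiableOn ℂ (fun z : ℂ => z ^ 1 * ((1 - z) ^ (q + 1))⁻¹) (ball 0 1) :=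
      (differentiableOn_id.pow 1).mul (hd _)
    rw [← this, ← laurentCoeff.add hρ hρ1 (hd q) h2]
    refine laurentCoeff.congr hρ.le n fun z hz => ?_
    have := hne z (hsub hz)
    field_simp
    ring
  induction p generalizing n with
  | zero =>
    induction n with
    | zero =>
      rw [hrec]
      have h0 : laurentCoeff ρ (((0 : ℕ) : ℤ) - 1) (fun z => ((1 - z) ^ (0 + 1))⁻¹) = 0 :=
        laurentCoeff.eq_zero_of_neg hρ hρ1 (hd _) (by simp)
      rw [h0]
      simpa using laurentCoeff.one hρ
    | succ n ih =>
      rw [hrec]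
      have h0 : laurentCoeff ρ ((n + 1 : ℕ) : ℤ) (fun z => ((1 - z) ^ 0)⁻¹) = 0 := by
        have := laurentCoeff.pow_of_ne hρ (n + 1) 0
        simpa using this
      have h1 : (((n + 1 : ℕ) : ℤ) - 1) = (n : ℤ) := by push_cast; ring
      rw [h0, h1, ih]
      simp
  | succ p ihp =>
    induction n with
    | zero =>
      rw [hrec]
      have h0 : laurentCoeff ρ (((0 : ℕ) : ℤ) - 1) (fun z => ((1 - z) ^ (p + 1 + 1))⁻¹) = 0 :=
        laurentCoeff.eq_zero_of_neg hρ hρ1 (hd _) (by simp)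
      rw [h0, ihp]
      simp
    | succ n ihn =>
      rw [hrec]
      have h1 : (((n + 1 : ℕ) : ℤ) - 1) = (n : ℤ) := by push_cast; ring
      rw [h1, ihp, ihn]
      have : (n + 1 + (p + 1)).choose (p + 1) = (n + 1 + p).choose p + (n + (p + 1)).choose (p + 1) := by
        rw [show n + 1 + (p + 1) = (n + 1 + p) + 1 by ring, Nat.choose_succ_succ,
          show n + (p + 1) = n + 1 + p by ring]
      exact_mod_cast this.symm

open Complex Metric in
theorem exists_exp_remainder (k : ℕ) : ∃ Q : ℂ → ℂ, Differentiable ℂ Q ∧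
    ∀ z, exp z = ∑ j ∈ Finset.range k, (j.factorial : ℂ)⁻¹ * z ^ j + z ^ k * Q z := by
  induction k with
  | zero => exact ⟨exp, differentiable_exp, by simp⟩
  | succ k ih =>
    obtain ⟨Q, hQ, h⟩ := ih
    -- Away from the origin, the error bound for the exponential series gives `‖Q z - 1/k!‖ ≤ C
    -- ‖z‖`; the value at the origin follows by continuity.
    have hQ0 : Q 0 = (k.factorial : ℂ)⁻¹ := by
      have hlim : Filter.Tendsto Q (nhdsWithin 0 {0}ᶜ) (nhds (Q 0)) :=
        (hQ.continuous.tendsto 0).mono_left nhdsWithin_le_nhds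
      refine tendsto_nhds_unique hlim ?_
      rw [tendsto_iff_norm_sub_tendsto_zero]
      set C : ℝ := ((k + 1).succ : ℝ) * (((k + 1).factorial : ℝ) * ((k + 1 : ℕ) : ℝ))⁻¹ with hC
      have hbound : ∀ᶠ z : ℂ in nhdsWithin 0 {0}ᶜ,
          ‖Q z - (k.factorial : ℂ)⁻¹‖ ≤ ‖z‖ * C := by
        have h1 : ∀ᶠ z : ℂ in nhdsWithin 0 {0}ᶜ, ‖z‖ < 1 :=
          nhdsWithin_le_nhds (by simpa [ball, dist_zero_right] using ball_mem_nhds (0 : ℂ) one_pos)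
        filter_upwards [h1, self_mem_nhdsWithin] with z hz1 hz0
        have hz0' : 0 < ‖z‖ := norm_pos_iff.2 hz0
        have hb := exp_bound hz1.le (Nat.succ_pos k)
        have : exp z - ∑ m ∈ Finset.range k.succ, z ^ m / (m.factorial : ℂ) =
            z ^ k * (Q z - (k.factorial : ℂ)⁻¹) := by
          rw [h z, Finset.sum_range_succ]
          simp only [div_eq_inv_mul]
          ring
        rw [this, norm_mul, norm_pow, pow_succ, mul_assoc] at hb
        exact le_of_mul_le_mul_left hb (by positivity)
      refine squeeze_zero' (Filter.Eventually.of_forall fun z => norm_nonneg _) hbound ?_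
      have : Filter.Tendsto (fun z : ℂ => ‖z‖ * C) (nhds 0) (nhds (‖(0 : ℂ)‖ * C)) := by
        apply Continuous.tendsto
        fun_prop
      rw [norm_zero, zero_mul] at this
      exact this.mono_left nhdsWithin_le_nhds
    refine ⟨dslope Q 0, ?_, fun z => ?_⟩
    · rw [← differentiableOn_univ] at hQ ⊢
      exact (differentiableOn_dslope Filter.univ_mem).2 hQ
    · have hz := sub_smul_dslope Q 0 z
      rw [sub_zero, smul_eq_mul] at hz
      rw [Finset.sum_range_succ, h z, pow_succ, mul_assoc, hz, hQ0]
      ring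

/-! ### Lagrange inversion for the moments of free unitary Brownian motion -/

/-- The Cayley transform from the unit disc to the right half-plane. -/
noncomputable def cayley (w : ℂ) : ℂ := (1 + w) / (1 - w)

/-- The iteration converging to the inverse of `w ↦ w exp (T (1 + w) / (2 (1 - w)))`. -/
noncomputable def subordination (T : ℝ) : ℕ → ℂ → ℂ
  | 0, _ => 0
  | N + 1, z => z * Complex.exp (-(T / 2) * cayley (subordination T N z))

section

open Complex Metric

theorem one_sub_ne_zero_of_norm_lt {w : ℂ} (hw : ‖w‖ < 1) : 1 - w ≠ 0 := by
  intro h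
  rw [← sub_eq_zero.1 h] at hw
  simp at hw

theorem cayley_re_pos {w : ℂ} (hw : ‖w‖ < 1) : 0 < (cayley w).re := by
  have h1 := one_sub_ne_zero_of_norm_lt hw
  have h2 : 0 < normSq (1 - w) := normSq_pos.2 h1
  have h3 : normSq w < 1 := by
    rw [normSq_eq_norm_sq]
    nlinarith [norm_nonneg w]
  rw [normSq_apply] at h3
  have : (cayley w).re = (1 - (w.re * w.re + w.im * w.im)) / normSq (1 - w) := by
    rw [cayley, div_re]
    simp
    field_simp
    ring
  rw [this]
  exact div_pos (by linarith) h2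

theorem differentiableOn_cayley_comp {g : ℂ → ℂ} {s : Set ℂ} (hg : DifferentiableOn ℂ g s)
    (h : ∀ z ∈ s, ‖g z‖ < 1) : DifferentiableOn ℂ (fun z => cayley (g z)) s :=
  ((differentiableOn_const 1).add hg).div ((differentiableOn_const 1).sub hg)
    fun z hz => one_sub_ne_zero_of_norm_lt (h z hz)

variable {T : ℝ}

/-- The Cayley transform has positive real part on the disc, so the exponential factor has modulus
at most `1`. The iterates therefore stay in the disc. -/
theorem norm_subordination_le (hT : 0 ≤ T) (N : ℕ) {z : ℂ} (hz : ‖z‖ < 1) :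
    ‖subordination T N z‖ ≤ ‖z‖ := by
  induction N with
  | zero => simp [subordination]
  | succ N ih =>
    rw [subordination, norm_mul, norm_exp]
    refine mul_le_of_le_one_right (norm_nonneg _) (Real.exp_le_one_iff.2 ?_)
    have h := cayley_re_pos (ih.trans_lt hz)
    have : (-(T / 2 : ℂ) * cayley (subordination T N z)).re =
        -(T / 2) * (cayley (subordination T N z)).re := by
      rw [show (-(T / 2 : ℂ)) = ((-(T / 2) : ℝ) : ℂ) by push_cast; ring, re_ofReal_mul]
    rw [this]
    nlinarith

theorem differentiableOn_subordination (hT : 0 ≤ T) (N : ℕ) :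
    DifferentiableOn ℂ (subordination T N) (ball 0 1) := by
  induction N with
  | zero => exact differentiableOn_const 0
  | succ N ih =>
    have hlt : ∀ z ∈ ball (0 : ℂ) 1, ‖subordination T N z‖ < 1 := fun z hz =>
      (norm_subordination_le hT N (by simpa using hz)).trans_lt (by simpa using hz)
    exact differentiableOn_id.mul
      (((differentiableOn_const _).mul (differentiableOn_cayley_comp ih hlt)).cexp)

/-- The `N`-th iterate inverts `f(w) = w exp(T/2 · cayley w)` up to order `N`, and each iteration
gains one power of `w`: the next iterate at `f(w)` is `w exp(κ)`, where `κ` is proportional to the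
previous error. Only finitely many coefficients are needed, so an iterate takes the place of the
true inverse on the disc. -/
theorem exists_expansion_comp (hT : 0 ≤ T) {R : ℝ} (hR1 : R ≤ 1)
    (hR : ∀ w ∈ ball (0 : ℂ) R, ‖w * exp (T / 2 * cayley w)‖ < 1) (N : ℕ) :
    ∃ S : ℂ → ℂ, DifferentiableOn ℂ S (ball 0 R) ∧ ∀ w ∈ ball (0 : ℂ) R,
      subordination T N (w * exp (T / 2 * cayley w)) = w + w ^ (N + 1) * S w := by
  have hw1 : ∀ w ∈ ball (0 : ℂ) R, ‖w‖ < 1 := fun w hw => by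
    have : ‖w‖ < R := by simpa using hw
    linarith
  have hf : DifferentiableOn ℂ (fun w => w * exp (T / 2 * cayley w)) (ball 0 R) :=
    differentiableOn_id.mul (((differentiableOn_const _).mul
      (differentiableOn_cayley_comp differentiableOn_id hw1)).cexp)
  induction N with
  | zero => exact ⟨fun _ => -1, differentiableOn_const _, fun w _ => by simp [subordination]⟩
  | succ N ih =>
    obtain ⟨S, hS, h⟩ := ih
    obtain ⟨Q, hQ, hexp⟩ := exists_exp_remainder 1
    have hb : ∀ w ∈ ball (0 : ℂ) R, ‖subordination T N (w * exp (T / 2 * cayley w))‖ < 1 :=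
      fun w hw => (norm_subordination_le hT N (hR w hw)).trans_lt (hR w hw)
    set b : ℂ → ℂ := fun w => subordination T N (w * exp (T / 2 * cayley w)) with hbdef
    have hbd : DifferentiableOn ℂ b (ball 0 R) :=
      (differentiableOn_subordination hT N).comp hf fun w hw => by simpa using hR w hw
    set κ : ℂ → ℂ := fun w => -T * (w ^ (N + 1) * S w) / ((1 - w) * (1 - b w)) with hκ
    have hne : ∀ w ∈ ball (0 : ℂ) R, (1 - w) * (1 - b w) ≠ 0 := fun w hw =>
      mul_ne_zero (one_sub_ne_zero_of_norm_lt (hw1 w hw)) (one_sub_ne_zero_of_norm_lt (hb w hw))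
    have hden : DifferentiableOn ℂ (fun w => (1 - w) * (1 - b w)) (ball 0 R) :=
      ((differentiableOn_const 1).sub differentiableOn_id).mul ((differentiableOn_const 1).sub hbd)
    have hκd : DifferentiableOn ℂ κ (ball 0 R) :=
      ((differentiableOn_const _).mul ((differentiableOn_id.pow _).mul hS)).div hden hne
    refine ⟨fun w => -T * S w / ((1 - w) * (1 - b w)) * Q (κ w),
      (((differentiableOn_const _).mul hS).div hden hne).mul
        (hQ.differentiableOn.comp hκd (Set.mapsTo_univ _ _)), fun w hw => ?_⟩
    have h1 := one_sub_ne_zero_of_norm_lt (hw1 w hw)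
    have h2 : 1 - b w ≠ 0 := one_sub_ne_zero_of_norm_lt (hb w hw)
    have hcay : T / 2 * cayley w + -(T / 2) * cayley (b w) = κ w := by
      have : w ^ (N + 1) * S w = b w - w := by rw [hbdef]; simp only; rw [h w hw]; ring
      simp only [hκ, cayley, this]
      field_simp
      ring
    have : subordination T (N + 1) (w * exp (T / 2 * cayley w)) = w * exp (κ w) := by
      rw [subordination, mul_assoc, ← exp_add, ← hcay]
    rw [this, hexp]
    simp only [Finset.range_one, Finset.sum_singleton, Nat.factorial_zero, Nat.cast_one, inv_one,
      pow_zero, mul_one, pow_one]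
    have hκw : κ w = -T * (w ^ (N + 1) * S w) / ((1 - w) * (1 - b w)) := rfl
    rw [mul_add, mul_one]
    congr 1
    generalize Q (κ w) = q
    rw [hκw]
    field_simp
    ring

/-- The moments of free unitary Brownian motion as coefficients of a holomorphic function. -/
theorem laurentCoeff_exp_cayley {ρ : ℝ} (hρ : 0 < ρ) (hρ1 : ρ < 1) (T : ℝ) (k : ℕ) :
    laurentCoeff ρ ((k : ℤ) - 1) (fun w => ((1 - w) ^ 2)⁻¹ * exp (-(k * T / 2) * cayley w)) =
      exp (-(k * T / 2)) * ∑ j ∈ Finset.range k, (-(k * T)) ^ j / (j.factorial : ℂ) *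
        (k.choose (j + 1) : ℂ) := by
  obtain ⟨Q, hQ, hexp⟩ := exists_exp_remainder k
  have hw1 : ∀ w ∈ ball (0 : ℂ) 1, ‖w‖ < 1 := fun w hw => by simpa using hw
  have hsub : sphere (0 : ℂ) ρ ⊆ ball 0 1 :=
    sphere_subset_closedBall.trans (closedBall_subset_ball hρ1)
  have hd : ∀ q : ℕ, DifferentiableOn ℂ (fun z : ℂ => ((1 - z) ^ q)⁻¹) (ball 0 1) := fun q =>
    (((differentiableOn_const 1).sub differentiableOn_id).pow q).inv
      fun z hz => pow_ne_zero _ (one_sub_ne_zero_of_norm_lt (hw1 z hz))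
  set x : ℂ → ℂ := fun w => -(k * T) * (w / (1 - w)) with hx
  have hxd : DifferentiableOn ℂ x (ball 0 1) :=
    (differentiableOn_const _).mul (differentiableOn_id.div ((differentiableOn_const 1).sub
      differentiableOn_id) fun z hz => one_sub_ne_zero_of_norm_lt (hw1 z hz))
  -- Since `cayley w = 1 + 2w/(1 - w)`, the exponential is `e^{-kT/2} exp(-kT w/(1 - w))`. Expanding
  -- up to order `k` suffices for the coefficient of `w^{k-1}`.
  have heq : Set.EqOn (fun w : ℂ => ((1 - w) ^ 2)⁻¹ * exp (-(k * T / 2) * cayley w))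
      (fun w => exp (-(k * T / 2)) * ((∑ j ∈ Finset.range k,
        (-(k * T) : ℂ) ^ j / (j.factorial : ℂ) * (w ^ j * ((1 - w) ^ (j + 1 + 1))⁻¹)) +
        w ^ k * ((-(k * T)) ^ k * ((1 - w) ^ (k + 2))⁻¹ * Q (x w)))) (sphere 0 ρ) := by
    intro w hw
    have h1 := one_sub_ne_zero_of_norm_lt (hw1 w (hsub hw))
    have hc : -(k * T / 2) * cayley w = -(k * T / 2) + x w := by
      simp only [hx, cayley]
      field_simp
      ring
    simp only
    rw [hc, exp_add, mul_left_comm, hexp (x w)]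
    congr 1
    rw [mul_add, Finset.mul_sum]
    congr 1
    · refine Finset.sum_congr rfl fun j _ => ?_
      simp only [hx]
      rw [mul_pow, div_pow, show j + 1 + 1 = j + 2 from rfl, pow_add (1 - w) j 2]
      field_simp
    · simp only [hx]
      rw [mul_pow, div_pow, pow_add (1 - w) k 2]
      field_simp
  have hd1 : ∀ j ∈ Finset.range k, DifferentiableOn ℂ (fun w : ℂ =>
      (-(k * T) : ℂ) ^ j / (j.factorial : ℂ) * (w ^ j * ((1 - w) ^ (j + 1 + 1))⁻¹)) (ball 0 1) :=
    fun j _ => (differentiableOn_const _).mul ((differentiableOn_id.pow j).mul (hd _))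
  have hd2 : DifferentiableOn ℂ (fun w => ((-(k * T)) ^ k * ((1 - w) ^ (k + 2))⁻¹ * Q (x w)))
      (ball 0 1) :=
    ((differentiableOn_const _).mul (hd _)).mul
      (hQ.differentiableOn.comp hxd (Set.mapsTo_univ _ _))
  have hd3 : DifferentiableOn ℂ (fun w => w ^ k * ((-(k * T)) ^ k * ((1 - w) ^ (k + 2))⁻¹ *
      Q (x w))) (ball 0 1) := (differentiableOn_id.pow k).mul hd2
  rw [laurentCoeff.congr hρ.le _ heq, laurentCoeff.const_mul,
    laurentCoeff.add hρ hρ1 (DifferentiableOn.fun_sum hd1) hd3, laurentCoeff.pow_mul hρ,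
    laurentCoeff.eq_zero_of_neg hρ hρ1 hd2 (by omega), add_zero, laurentCoeff.sum hρ hρ1 _ _ hd1]
  congr 1
  refine Finset.sum_congr rfl fun j hj => ?_
  rw [laurentCoeff.const_mul, laurentCoeff.pow_mul hρ]
  have hj' := Finset.mem_range.1 hj
  rw [show (k : ℤ) - 1 - j = ((k - 1 - j : ℕ) : ℤ) by omega, laurentCoeff.inv_one_sub_pow hρ hρ1,
    show k - 1 - j + (j + 1) = k by omega]

end

section

open Complex Metric

/-- Lagrange inversion for the iterates of the subordination function. -/
theorem laurentCoeff_cayley_subordination {T : ℝ} (hT : 0 ≤ T) {N k : ℕ} (hk : 1 ≤ k) (hkN : k ≤ N)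
    {r : ℝ} (hr : 0 < r) (hr1 : r < 1) :
    laurentCoeff r k (fun z => cayley (subordination T N z)) =
      2 * ((k : ℂ)⁻¹ * (exp (-(k * T / 2)) * ∑ j ∈ Finset.range k,
        (-(k * T)) ^ j / (j.factorial : ℂ) * (k.choose (j + 1) : ℂ))) := by
  have hsubN : ∀ z ∈ ball (0 : ℂ) 1, ‖subordination T N z‖ < 1 := fun z hz =>
    (norm_subordination_le hT N (by simpa using hz)).trans_lt (by simpa using hz)
  have hH : DifferentiableOn ℂ (fun z => cayley (subordination T N z)) (ball 0 1) :=
    differentiableOn_cayley_comp (differentiableOn_subordination hT N) hsubN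
  -- The coefficient `a k` does not depend on the radius `r`, so it can be computed on the image
  -- under `f` of a small circle, where `f` takes values in the disc.
  obtain ⟨a, Q, hQ, hexp⟩ := exists_taylor_remainder one_pos hH (k + 1)
  rw [laurentCoeff.eq_of_expansion hr hr1 hQ (fun z _ => hexp z) (Nat.lt_succ_self k)]
  set G : ℂ → ℂ := fun w => exp (T / 2 * cayley w) with hG
  set f : ℂ → ℂ := fun w => w * G w with hf
  have hGne : ∀ w, G w ≠ 0 := fun w => exp_ne_zero _
  have hball1 : ∀ w ∈ ball (0 : ℂ) 1, ‖w‖ < 1 := fun w hw => by simpa using hw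
  have hGd : DifferentiableOn ℂ G (ball 0 1) :=
    ((differentiableOn_const _).mul (differentiableOn_cayley_comp differentiableOn_id hball1)).cexp
  have hfd : DifferentiableOn ℂ f (ball 0 1) := differentiableOn_id.mul hGd
  obtain ⟨R, hR0, hR1, hR⟩ : ∃ R : ℝ, 0 < R ∧ R ≤ 1 ∧ ∀ w ∈ ball (0 : ℂ) R, ‖f w‖ < 1 := by
    have hc : ContinuousAt f 0 :=
      (hfd.differentiableAt (ball_mem_nhds 0 one_pos)).continuousAt
    have hf0 : f 0 = 0 := by simp [hf]
    have := Metric.continuousAt_iff.1 hc 1 one_pos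
    obtain ⟨δ, hδ, h⟩ := this
    refine ⟨min δ 1, lt_min hδ one_pos, min_le_right _ _, fun w hw => ?_⟩
    have := h (x := w) (lt_of_lt_of_le (by simpa using hw) (min_le_left _ _))
    simpa [hf0] using this
  have hBR : ball (0 : ℂ) R ⊆ ball 0 1 := ball_subset_ball hR1
  obtain ⟨S, hS, hcomp⟩ := exists_expansion_comp hT hR1 hR N
  set ρ := R / 2 with hρdef
  have hρ : 0 < ρ := half_pos hR0
  have hρR : ρ < R := half_lt_self hR0
  have hρ1 : ρ < 1 := hρR.trans_le hR1
  have hsph : sphere (0 : ℂ) ρ ⊆ ball 0 R :=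
    sphere_subset_closedBall.trans (closedBall_subset_ball hρR)
  have hw0 : ∀ w ∈ sphere (0 : ℂ) ρ, w ≠ 0 := fun w hw => laurentCoeff.ne_zero_of_mem_sphere hρ hw
  have hf0 : ∀ w ∈ sphere (0 : ℂ) ρ, f w ≠ 0 := fun w hw => mul_ne_zero (hw0 w hw) (hGne w)
  set f' : ℂ → ℂ := fun w => G w * (1 + w * (T * ((1 - w) ^ 2)⁻¹)) with hf'
  have hcay : ∀ w ∈ ball (0 : ℂ) R, HasDerivAt cayley (2 * ((1 - w) ^ 2)⁻¹) w := by
    intro w hw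
    have h1 := one_sub_ne_zero_of_norm_lt (hball1 w (hBR hw))
    have := ((hasDerivAt_id w).const_add 1).div ((hasDerivAt_id w).const_sub 1) h1
    refine HasDerivAt.congr_deriv this ?_
    simp only [id]
    field_simp
    ring
  have hfder : ∀ w ∈ ball (0 : ℂ) R, HasDerivAt f (f' w) w := by
    intro w hw
    have := (hasDerivAt_id w).mul ((hcay w hw).const_mul (T / 2 : ℂ)).cexp
    refine HasDerivAt.congr_deriv this ?_
    simp only [hf', hG, id]
    ring
  have hd2 : DifferentiableOn ℂ (fun w : ℂ => ((1 - w) ^ 2)⁻¹) (ball 0 R) :=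
    (((differentiableOn_const 1).sub differentiableOn_id).pow 2).inv
      fun z hz => pow_ne_zero _ (one_sub_ne_zero_of_norm_lt (hball1 z (hBR hz)))
  have hf'd : DifferentiableOn ℂ f' (ball 0 R) :=
    (hGd.mono hBR).mul ((differentiableOn_const 1).add
      (differentiableOn_id.mul ((differentiableOn_const _).mul hd2)))
  have hzp : ∀ m : ℤ, ContinuousOn (fun w => f w ^ m) (sphere 0 ρ) := fun m =>
    ((hfd.continuousOn.mono hBR).mono hsph).zpow₀ m fun w hw => Or.inl (hf0 w hw)
  have hf'c : ContinuousOn f' (sphere 0 ρ) := hf'd.continuousOn.mono hsph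
  have hzpder : ∀ (m : ℤ), ∀ w ∈ sphere (0 : ℂ) ρ,
      HasDerivAt (fun w => f w ^ m) (m * f w ^ (m - 1) * f' w) w := fun m w hw =>
    (hasDerivAt_zpow m (f w) (Or.inl (hf0 w hw))).comp w (hfder w (hsph hw))
  -- integrals of powers of `f`
  have hJpow : ∀ m : ℤ, m ≠ 0 → ∮ w in C(0, ρ), f' w * f w ^ (m - 1) = 0 := by
    intro m hm
    refine circleIntegral.integral_eq_zero_of_hasDerivWithinAt'
      (f := fun w => (m : ℂ)⁻¹ * f w ^ m) fun w hw => ?_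
    rw [abs_of_pos hρ] at hw
    have hm' : (m : ℂ) ≠ 0 := by exact_mod_cast hm
    have := (((hzpder m w hw).const_mul (m : ℂ)⁻¹).hasDerivWithinAt (s := sphere 0 |ρ|))
    convert this using 1
    field_simp
  have hJ0 : ∮ w in C(0, ρ), f' w * f w ^ (-1 : ℤ) = 2 * Real.pi * I := by
    have h1 : ∮ w in C(0, ρ), f' w * f w ^ (-1 : ℤ) =
        ∮ w in C(0, ρ), (w⁻¹ + T * ((1 - w) ^ 2)⁻¹) := by
      refine circleIntegral.integral_congr hρ.le fun w hw => ?_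
      have := hw0 w hw
      have := hGne w
      have := one_sub_ne_zero_of_norm_lt (hball1 w (hBR (hsph hw)))
      simp only [hf, hf', zpow_neg_one]
      field_simp
    have h2 : ∮ w in C(0, ρ), w⁻¹ = 2 * Real.pi * I := by
      simpa using circleIntegral.integral_sub_center_inv (0 : ℂ) hρ.ne'
    have hd2' : DifferentiableOn ℂ (fun w : ℂ => (T : ℂ) * ((1 - w) ^ 2)⁻¹) (ball 0 R) :=
      (differentiableOn_const _).mul hd2
    rw [h1, circleIntegral.integral_add, h2, laurentCoeff.integral_eq_zero hρ hρR hd2', add_zero]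
    · exact ContinuousOn.circleIntegrable hρ.le
        (continuousOn_id.inv₀ hw0)
    · exact ContinuousOn.circleIntegrable hρ.le (hd2'.continuousOn.mono hsph)
  -- the coefficient of the iterate as an integral
  have hA : ∮ w in C(0, ρ), cayley (subordination T N (f w)) * (f' w * f w ^ (-(k : ℤ) - 1)) =
      a k * (2 * Real.pi * I) := by
    have hfQ : DifferentiableOn ℂ (fun w => f' w * Q (f w)) (ball 0 R) :=
      hf'd.mul (hQ.comp (hfd.mono hBR) fun w hw => by simpa using hR w hw)
    have h1 : ∮ w in C(0, ρ), cayley (subordination T N (f w)) * (f' w * f w ^ (-(k : ℤ) - 1)) =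
        ∮ w in C(0, ρ), ((∑ j ∈ Finset.range (k + 1), a j * (f' w * f w ^ ((j : ℤ) - k - 1))) +
          f' w * Q (f w)) := by
      refine circleIntegral.integral_congr hρ.le fun w hw => ?_
      have hfw := hf0 w hw
      simp only [hexp (f w), add_mul, Finset.sum_mul]
      congr 1
      · refine Finset.sum_congr rfl fun j _ => ?_
        rw [show (j : ℤ) - k - 1 = j + (-(k : ℤ) - 1) by ring, zpow_add₀ hfw, zpow_natCast]
        ring
      · have : f w ^ (k + 1) * f w ^ (-(k : ℤ) - 1) = 1 := by
          rw [← zpow_natCast, ← zpow_add₀ hfw]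
          simp
        linear_combination f' w * Q (f w) * this
    have hintegral : ∀ j ∈ Finset.range (k + 1), CircleIntegrable
        (fun w => a j * (f' w * f w ^ ((j : ℤ) - k - 1))) 0 ρ := fun j _ =>
      ContinuousOn.circleIntegrable hρ.le (continuousOn_const.mul (hf'c.mul (hzp _)))
    rw [h1, circleIntegral.integral_add, laurentCoeff.integral_eq_zero hρ hρR hfQ, add_zero,
      circleIntegral.integral_fun_sum hintegral, Finset.sum_eq_single k]
    · rw [circleIntegral.integral_const_mul, sub_self, zero_sub, hJ0]
    · intro j _ hj
      rw [circleIntegral.integral_const_mul, hJpow _ (by omega), mul_zero]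
    · intro h
      simp at h
    · exact ContinuousOn.circleIntegrable hρ.le
        (continuousOn_finsetSum _ fun j _ => continuousOn_const.mul (hf'c.mul (hzp _)))
    · exact ContinuousOn.circleIntegrable hρ.le (hfQ.continuousOn.mono hsph)
  -- comparison with the Cayley transform itself
  have hcayd : DifferentiableOn ℂ cayley (ball 0 R) :=
    differentiableOn_cayley_comp differentiableOn_id fun w hw => hball1 w (hBR hw)
  have hB : ∮ w in C(0, ρ), cayley (subordination T N (f w)) * (f' w * f w ^ (-(k : ℤ) - 1)) =
      ∮ w in C(0, ρ), cayley w * (f' w * f w ^ (-(k : ℤ) - 1)) := by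
    have hsubd : DifferentiableOn ℂ (fun w => subordination T N (f w)) (ball 0 R) :=
      (differentiableOn_subordination hT N).comp (hfd.mono hBR) fun w hw => by simpa using hR w hw
    have hsub1 : ∀ w ∈ ball (0 : ℂ) R, ‖subordination T N (f w)‖ < 1 := fun w hw =>
      hsubN _ (by simpa using hR w hw)
    -- The iterate differs from the true inverse by a term divisible by `w^{N+1}`. Since `N ≥ k`,
    -- this compensates the pole of `f^{-k-1}`, and the error integrates to zero.
    have herr : DifferentiableOn ℂ (fun w => w ^ (N - k) * (2 * S w / ((1 - w) *
        (1 - subordination T N (f w))) * (f' w * (G w ^ (k + 1))⁻¹))) (ball 0 R) := by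
      refine (differentiableOn_id.pow _).mul ((((differentiableOn_const 2).mul hS).div
        (((differentiableOn_const 1).sub differentiableOn_id).mul
          ((differentiableOn_const 1).sub hsubd)) ?_).mul
        (hf'd.mul (((hGd.mono hBR).pow _).inv fun w _ => pow_ne_zero _ (hGne w))))
      exact fun w hw => mul_ne_zero (one_sub_ne_zero_of_norm_lt (hball1 w (hBR hw)))
        (one_sub_ne_zero_of_norm_lt (hsub1 w hw))
    have h1 : ∮ w in C(0, ρ), cayley (subordination T N (f w)) * (f' w * f w ^ (-(k : ℤ) - 1)) =
        ∮ w in C(0, ρ), (cayley w * (f' w * f w ^ (-(k : ℤ) - 1)) + w ^ (N - k) * (2 * S w /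
          ((1 - w) * (1 - subordination T N (f w))) * (f' w * (G w ^ (k + 1))⁻¹))) := by
      refine circleIntegral.integral_congr hρ.le fun w hw => ?_
      have hc : cayley (subordination T N (f w)) = cayley w + w ^ (N + 1) * (2 * S w /
          ((1 - w) * (1 - subordination T N (f w)))) := by
        have e1 := one_sub_ne_zero_of_norm_lt (hball1 w (hBR (hsph hw)))
        have e2 := one_sub_ne_zero_of_norm_lt (hsub1 w (hsph hw))
        have e3 : w ^ (N + 1) * S w = subordination T N (f w) - w := by
          rw [show f w = w * exp (T / 2 * cayley w) from rfl, hcomp w (hsph hw)]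
          ring
        have e4 : w ^ (N + 1) * (2 * S w / ((1 - w) * (1 - subordination T N (f w)))) =
            2 * (subordination T N (f w) - w) / ((1 - w) * (1 - subordination T N (f w))) := by
          rw [← e3]
          ring
        rw [e4, cayley, cayley]
        field_simp
        ring
      have hp : w ^ (N + 1) * f w ^ (-(k : ℤ) - 1) = w ^ (N - k) * (G w ^ (k + 1))⁻¹ := by
        have e1 : f w ^ (-(k : ℤ) - 1) = (f w ^ (k + 1))⁻¹ := by
          rw [← zpow_natCast, ← zpow_neg]
          congr 1
          push_cast
          ring
        rw [e1]
        simp only [hf]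
        rw [mul_pow, mul_inv, ← mul_assoc]
        congr 1
        have : w ^ (N + 1) = w ^ (N - k) * w ^ (k + 1) := by
          rw [← pow_add]
          congr 1
          omega
        rw [this, mul_assoc, mul_inv_cancel₀ (pow_ne_zero _ (hw0 w hw)), mul_one]
      simp only [hc]
      linear_combination (2 * S w / ((1 - w) * (1 - subordination T N (f w))) * f' w) * hp
    rw [h1, circleIntegral.integral_add, laurentCoeff.integral_eq_zero hρ hρR herr, add_zero]
    · exact ContinuousOn.circleIntegrable hρ.le
        ((hcayd.continuousOn.mono hsph).mul (hf'c.mul (hzp _)))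
    · exact ContinuousOn.circleIntegrable hρ.le (herr.continuousOn.mono hsph)
  -- integration by parts
  have hC : (k : ℂ) * ∮ w in C(0, ρ), cayley w * (f' w * f w ^ (-(k : ℤ) - 1)) =
      ∮ w in C(0, ρ), 2 * ((1 - w) ^ 2)⁻¹ * f w ^ (-(k : ℤ)) := by
    have h1 : ∮ w in C(0, ρ), (2 * ((1 - w) ^ 2)⁻¹ * f w ^ (-(k : ℤ)) -
        k * (cayley w * (f' w * f w ^ (-(k : ℤ) - 1)))) = 0 := by
      refine circleIntegral.integral_eq_zero_of_hasDerivWithinAt'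
        (f := fun w => cayley w * f w ^ (-(k : ℤ))) fun w hw => ?_
      rw [abs_of_pos hρ] at hw
      have := ((hcay w (hsph hw)).mul (hzpder (-(k : ℤ)) w hw)).hasDerivWithinAt
        (s := sphere 0 |ρ|)
      refine HasDerivWithinAt.congr_deriv this ?_
      push_cast
      ring
    rw [circleIntegral.integral_sub, circleIntegral.integral_const_mul, sub_eq_zero] at h1
    · exact h1.symm
    · exact ContinuousOn.circleIntegrable hρ.le
        ((continuousOn_const.mul (hd2.continuousOn.mono hsph)).mul (hzp _))
    · exact ContinuousOn.circleIntegrable hρ.le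
        (continuousOn_const.mul ((hcayd.continuousOn.mono hsph).mul (hf'c.mul (hzp _))))
  have hD : ∮ w in C(0, ρ), 2 * ((1 - w) ^ 2)⁻¹ * f w ^ (-(k : ℤ)) =
      (2 * Real.pi * I) * (2 * laurentCoeff ρ ((k : ℤ) - 1)
        (fun w => ((1 - w) ^ 2)⁻¹ * exp (-(k * T / 2) * cayley w))) := by
    unfold laurentCoeff
    rw [mul_left_comm _ (2 : ℂ), ← mul_assoc (2 * Real.pi * I : ℂ),
      mul_inv_cancel₀ two_pi_I_ne_zero, one_mul, ← circleIntegral.integral_const_mul]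
    refine circleIntegral.integral_congr hρ.le fun w hw => ?_
    have e1 : f w ^ (-(k : ℤ)) = w ^ (-((k : ℤ) - 1) - 1) * exp (-(k * T / 2) * cayley w) := by
      simp only [hf, hG]
      rw [mul_zpow, ← exp_int_mul]
      congr 1
      · congr 1
        ring
      · congr 1
        push_cast
        ring
    simp only [e1]
    ring
  rw [laurentCoeff_exp_cayley hρ hρ1 T k] at hD
  have hk0 : (k : ℂ) ≠ 0 := by exact_mod_cast (show k ≠ 0 by omega)
  have hfin := hC
  rw [← hB, hA, hD] at hfin
  apply mul_left_cancel₀ (mul_ne_zero hk0 two_pi_I_ne_zero)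
  rw [show (k : ℂ) * (2 * Real.pi * I) * a k = k * (a k * (2 * Real.pi * I)) by ring, hfin]
  field_simp

end

theorem ofReal_freeUnitaryBMMoment {t : ENNReal} (ht : t ≠ ⊤) {k : ℕ} (hk : 1 ≤ k) :
    (freeUnitaryBMMoment t k : ℂ) =
      (k : ℂ)⁻¹ * (Complex.exp (-(k * t.toReal / 2)) * ∑ j ∈ Finset.range k,
        (-(k * t.toReal)) ^ j / (j.factorial : ℂ) * (k.choose (j + 1) : ℂ)) := by
  have hk0 : (k : ℂ) ≠ 0 := by exact_mod_cast (show k ≠ 0 by omega)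
  rw [freeUnitaryBMMoment, if_neg ht]
  push_cast
  rw [mul_left_comm, Finset.mul_sum (a := (k : ℂ)⁻¹)]
  congr 1
  · congr 1
    ring
  · refine Finset.sum_congr rfl fun j _ => ?_
    rw [zpow_sub₀ hk0, zpow_natCast, zpow_one, neg_pow, neg_pow ((k : ℂ) * _), mul_pow]
    field_simp

/-! ### From positive real part to measures on finite sets -/

section

open Complex Metric MeasureTheory

theorem laurentCoeff_eq_integral {r : ℝ} (hr : 0 < r) (n : ℤ) (g : ℂ → ℂ) :
    laurentCoeff r n g = (2 * Real.pi : ℂ)⁻¹ * ((r : ℂ) ^ (-n) *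
      ∫ θ in (0 : ℝ)..2 * Real.pi, exp (-(n * θ * I)) * g (circleMap 0 r θ)) := by
  have hr' : (r : ℂ) ≠ 0 := by exact_mod_cast hr.ne'
  rw [laurentCoeff, circleIntegral, ← intervalIntegral.integral_const_mul,
    ← intervalIntegral.integral_const_mul, ← intervalIntegral.integral_const_mul]
  congr 1
  funext θ
  have hz : circleMap 0 r θ = r * exp (θ * I) := by simp [circleMap]
  have hz0 : circleMap 0 r θ ≠ 0 := by rw [hz]; exact mul_ne_zero hr' (exp_ne_zero _)
  have h1 : (circleMap 0 r θ) * (circleMap 0 r θ) ^ (-n - 1) =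
      (r : ℂ) ^ (-n) * exp (-(n * θ * I)) := by
    rw [mul_comm, ← zpow_add_one₀ hz0, sub_add_cancel, hz, mul_zpow, ← exp_int_mul]
    congr 2
    push_cast
    ring
  rw [deriv_circleMap, smul_eq_mul]
  rw [show (2 * Real.pi * I : ℂ)⁻¹ * (circleMap 0 r θ * I * (circleMap 0 r θ ^ (-n - 1) *
      g (circleMap 0 r θ))) = (2 * Real.pi * I : ℂ)⁻¹ * I * (circleMap 0 r θ *
      circleMap 0 r θ ^ (-n - 1)) * g (circleMap 0 r θ) by ring, h1]
  have : (2 * Real.pi * I : ℂ)⁻¹ * I = (2 * Real.pi : ℂ)⁻¹ := by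
    rw [mul_inv, mul_assoc, inv_mul_cancel₀ I_ne_zero, mul_one]
  rw [this]
  ring

/-- Herglotz's argument on the circle of radius `r`: the measure has density `Re g(r e^{iθ}) / 2π`.
The real part mixes the coefficients of index `-k` and `k`; the former vanish by holomorphy and the
latter appear conjugated and halved. -/
theorem exists_measure_of_re_nonneg {r : ℝ} (hr : 0 < r) (hr1 : r < 1) {g : ℂ → ℂ}
    (hg : DifferentiableOn ℂ g (ball 0 1)) (hpos : ∀ z ∈ ball (0 : ℂ) 1, 0 ≤ (g z).re)
    (h0 : laurentCoeff r 0 g = 1) :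
    ∃ μ : Measure ℝ, IsProbabilityMeasure μ ∧ ∀ k : ℕ, 1 ≤ k →
      ∫ θ, exp (k * θ * I) ∂μ = star (laurentCoeff r k g) * r ^ k / 2 := by
  have hr' : (r : ℂ) ≠ 0 := by exact_mod_cast hr.ne'
  have hpi : (2 * Real.pi : ℂ) ≠ 0 := by exact_mod_cast Real.two_pi_pos.ne'
  have hmem : ∀ θ, circleMap 0 r θ ∈ ball (0 : ℂ) 1 := fun θ => by
    simpa [circleMap, abs_of_pos hr] using hr1
  set γ : ℝ → ℂ := fun θ => g (circleMap 0 r θ) with hγ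
  have hγc : Continuous γ :=
    hg.continuousOn.comp_continuous (continuous_circleMap 0 r) hmem
  have hintegral : ∀ n : ℤ, ∫ θ in (0 : ℝ)..2 * Real.pi, exp (-(n * θ * I)) * γ θ =
      2 * Real.pi * ((r : ℂ) ^ n * laurentCoeff r n g) := by
    intro n
    rw [laurentCoeff_eq_integral hr, zpow_neg]
    have hrn : (r : ℂ) ^ n ≠ 0 := zpow_ne_zero n hr'
    simp only [hγ]
    generalize ∫ θ in (0 : ℝ)..2 * Real.pi, exp (-(n * θ * I)) * g (circleMap 0 r θ) = J
    field_simp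
  have hre : ∀ k : ℕ, ∫ θ in (0 : ℝ)..2 * Real.pi, (((γ θ).re / (2 * Real.pi) : ℝ) : ℂ) *
      exp (k * θ * I) = ((r : ℂ) ^ (-(k : ℤ)) * laurentCoeff r (-(k : ℤ)) g +
        star ((r : ℂ) ^ (k : ℤ) * laurentCoeff r k g)) / 2 := by
    intro k
    have e1 : ∀ θ : ℝ, (((γ θ).re / (2 * Real.pi) : ℝ) : ℂ) * exp (k * θ * I) =
        (2 * (2 * Real.pi) : ℂ)⁻¹ * (exp (-((-(k : ℤ) : ℤ) * θ * I)) * γ θ +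
          (starRingEnd ℂ) (exp (-((k : ℤ) * θ * I)) * γ θ)) := by
      intro θ
      have : ((γ θ).re : ℂ) = (γ θ + (starRingEnd ℂ) (γ θ)) / 2 := re_eq_add_conj _
      push_cast
      rw [this, map_mul, ← exp_conj]
      simp only [map_neg, map_mul, conj_I, conj_ofReal, map_natCast]
      rw [show -(-(k : ℂ) * θ * I) = k * θ * I by ring,
        show -((k : ℂ) * θ * -I) = k * θ * I by ring]
      field_simp
    simp_rw [e1]
    have hc : ∀ n : ℤ, Continuous fun θ : ℝ => exp (-(n * θ * I)) * γ θ := fun n => by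
      fun_prop
    have hc' : Continuous fun θ : ℝ => (starRingEnd ℂ) (exp (-((k : ℤ) * θ * I)) * γ θ) :=
      continuous_conj.comp (hc k)
    rw [intervalIntegral.integral_const_mul, intervalIntegral.integral_add
      ((hc _).intervalIntegrable _ _) (hc'.intervalIntegrable _ _)]
    have hconj : ∫ θ in (0 : ℝ)..2 * Real.pi, (starRingEnd ℂ) (exp (-((k : ℤ) * θ * I)) * γ θ) =
        (starRingEnd ℂ) (∫ θ in (0 : ℝ)..2 * Real.pi, exp (-((k : ℤ) * θ * I)) * γ θ) := by
      rw [intervalIntegral.integral_of_le Real.two_pi_pos.le,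
        intervalIntegral.integral_of_le Real.two_pi_pos.le, integral_conj]
    rw [hconj, hintegral, hintegral]
    simp only [map_mul, conj_ofReal, map_ofNat]
    rw [star_mul', RCLike.star_def]
    simp only [map_zpow₀, conj_ofReal]
    field_simp
  set ρ : ℝ → ℝ := fun θ => (γ θ).re / (2 * Real.pi) with hρ
  have hρ0 : ∀ θ, 0 ≤ ρ θ := fun θ => div_nonneg (hpos _ (hmem θ)) Real.two_pi_pos.le
  have hρc : Continuous ρ := (continuous_re.comp hγc).div_const _
  have hone : ∫ θ in (0 : ℝ)..2 * Real.pi, ρ θ = 1 := by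
    have := hre 0
    simp only [Nat.cast_zero, zero_mul, exp_zero, mul_one, neg_zero, zpow_zero, h0,
      star_one] at this
    rw [intervalIntegral.integral_ofReal] at this
    have h2 : ((∫ θ in (0 : ℝ)..2 * Real.pi, ρ θ : ℝ) : ℂ) = 1 := by
      rw [this]; simp
    exact_mod_cast h2
  set ν : Measure ℝ := volume.restrict (Set.Ioc 0 (2 * Real.pi)) with hν
  have hρint : Integrable ρ ν :=
    (hρc.intervalIntegrable 0 (2 * Real.pi)).1
  rw [intervalIntegral.integral_of_le Real.two_pi_pos.le] at hone
  refine ⟨ν.withDensity fun θ => ENNReal.ofReal (ρ θ), ⟨?_⟩, fun k hk => ?_⟩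
  · rw [withDensity_apply _ MeasurableSet.univ, Measure.restrict_univ,
      ← ofReal_integral_eq_lintegral_ofReal hρint (Filter.Eventually.of_forall hρ0), hone,
      ENNReal.ofReal_one]
  · have := hre k
    rw [intervalIntegral.integral_of_le Real.two_pi_pos.le] at this
    rw [integral_withDensity_eq_integral_toReal_smul (by fun_prop)
      (Filter.Eventually.of_forall fun _ => ENNReal.ofReal_lt_top)]
    have hneg : laurentCoeff r (-(k : ℤ)) g = 0 :=
      laurentCoeff.eq_zero_of_neg hr hr1 hg (by omega)
    rw [hneg, mul_zero, zero_add, star_mul', zpow_natCast, star_pow, RCLike.star_def,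
      conj_ofReal] at this
    rw [RCLike.star_def, mul_comm ((starRingEnd ℂ) _), ← this]
    refine integral_congr_ae (Filter.Eventually.of_forall fun θ => ?_)
    simp only [ENNReal.toReal_ofReal (hρ0 θ), real_smul]
    rfl

/-- The law of large numbers: a measure is approximated by uniform measures on finite sets. -/
theorem exists_uniform_approx (μ : Measure ℝ) [IsProbabilityMeasure μ] (K : ℕ) {ε : ℝ}
    (hε : 0 < ε) :
    ∃ n : ℕ, 0 < n ∧ ∃ θ : ℕ → ℝ, ∀ k ≤ K,
      ‖(n : ℂ)⁻¹ * ∑ i ∈ Finset.range n, exp (k * θ i * I) - ∫ x, exp (k * x * I) ∂μ‖ < ε := by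
  set P : Measure (ℕ → ℝ) := Measure.infinitePi fun _ => μ with hP
  have hmp : ∀ i : ℕ, MeasurePreserving (fun ω : ℕ → ℝ => ω i) P μ := fun i =>
    ⟨measurable_pi_apply i, Measure.infinitePi_map_eval (fun _ => μ) i⟩
  have hlaw : ∀ k : ℕ, ∀ᵐ ω ∂P, Filter.Tendsto (fun n : ℕ => (n : ℝ)⁻¹ •
      ∑ i ∈ Finset.range n, exp (k * (ω i : ℂ) * I)) Filter.atTop
      (nhds (∫ x, exp (k * x * I) ∂μ)) := by
    intro k
    have hmeas : Measurable fun x : ℝ => exp (k * x * I) := by fun_prop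
    have hintegral : Integrable (fun x : ℝ => exp (k * x * I)) μ := by
      refine Integrable.of_bound hmeas.aestronglyMeasurable 1 (Filter.Eventually.of_forall fun x => ?_)
      have := norm_exp_ofReal_mul_I (k * x)
      push_cast at this
      rw [this]
    have h := ProbabilityTheory.strong_law_ae (μ := P) (fun i ω => exp (k * (ω i : ℂ) * I))
      ((hmp 0).integrable_comp_of_integrable hintegral)
      (fun i j hij => (ProbabilityTheory.iIndepFun_infinitePi (P := fun _ : ℕ => μ)
        (X := fun _ x => exp (k * (x : ℂ) * I)) fun _ => hmeas).indepFun hij)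
      (fun i => ⟨(hmeas.comp (measurable_pi_apply i)).aemeasurable,
        (hmeas.comp (measurable_pi_apply 0)).aemeasurable, by
          have e : ∀ i : ℕ, Measure.map (fun ω : ℕ → ℝ => exp (k * (ω i : ℂ) * I)) P =
              Measure.map (fun x : ℝ => exp (k * x * I)) μ := fun i => by
            rw [← (hmp i).map_eq, Measure.map_map hmeas (measurable_pi_apply i)]
            rfl
          rw [e, e]⟩)
    have e2 : ∫ ω, exp (k * (ω 0 : ℂ) * I) ∂P = ∫ x, exp (k * x * I) ∂μ := by
      rw [← (hmp 0).map_eq, integral_map (measurable_pi_apply 0).aemeasurable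
        hmeas.aestronglyMeasurable]
    rwa [e2] at h
  rw [← ae_all_iff] at hlaw
  obtain ⟨ω, hω⟩ := hlaw.exists
  have hev : ∀ k ≤ K, ∀ᶠ n : ℕ in Filter.atTop, ‖(n : ℂ)⁻¹ * ∑ i ∈ Finset.range n,
      exp (k * (ω i : ℂ) * I) - ∫ x, exp (k * x * I) ∂μ‖ < ε := by
    intro k _
    filter_upwards [Metric.tendsto_nhds.1 (hω k) ε hε] with n hn
    rw [dist_eq_norm, real_smul] at hn
    simpa using hn
  have hall : ∀ᶠ n : ℕ in Filter.atTop, ∀ k ≤ K, ‖(n : ℂ)⁻¹ * ∑ i ∈ Finset.range n,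
      exp (k * (ω i : ℂ) * I) - ∫ x, exp (k * x * I) ∂μ‖ < ε :=
    (Filter.eventually_all_finite (Set.finite_le_nat K)).2 hev
  obtain ⟨n, hn, hn0⟩ := (hall.and (Filter.eventually_gt_atTop 0)).exists
  exact ⟨n, hn0, ω, hn⟩

/-- The law of free unitary Brownian motion is approximated by uniform measures on finite sets. -/
theorem exists_uniform_approx_freeUnitaryBM {t : ENNReal} (ht : t ≠ ⊤) (K : ℕ) {ε : ℝ}
    (hε : 0 < ε) :
    ∃ n : ℕ, 0 < n ∧ ∃ θ : ℕ → ℝ, ∀ k ≤ K, 1 ≤ k →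
      ‖(n : ℂ)⁻¹ * ∑ i ∈ Finset.range n, exp (k * θ i * I) - freeUnitaryBMMoment t k‖ < ε := by
  have hT : 0 ≤ t.toReal := ENNReal.toReal_nonneg
  -- The measure lives on a circle of radius `r < 1` and has moments `m_k r^k`; these are close to
  -- `m_k` for `r` close to `1`.
  obtain ⟨r, hr, hr1, hrk⟩ : ∃ r : ℝ, 0 < r ∧ r < 1 ∧ ∀ k ≤ K,
      ‖(freeUnitaryBMMoment t k : ℂ) * r ^ k - freeUnitaryBMMoment t k‖ < ε / 2 := by
    have hev : ∀ k ≤ K, ∀ᶠ r : ℝ in nhdsWithin 1 (Set.Iio 1),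
        ‖(freeUnitaryBMMoment t k : ℂ) * r ^ k - freeUnitaryBMMoment t k‖ < ε / 2 := by
      intro k _
      have hc : Continuous fun r : ℝ =>
          ‖(freeUnitaryBMMoment t k : ℂ) * r ^ k - freeUnitaryBMMoment t k‖ := by fun_prop
      have := hc.tendsto 1
      simp only [ofReal_one, one_pow, mul_one, sub_self, norm_zero] at this
      exact (this.mono_left nhdsWithin_le_nhds).eventually_lt_const (half_pos hε)
    have hall := (Filter.eventually_all_finite (Set.finite_le_nat K)).2 hev
    have h0 : ∀ᶠ r : ℝ in nhdsWithin 1 (Set.Iio 1), 0 < r :=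
      nhdsWithin_le_nhds (lt_mem_nhds one_pos)
    obtain ⟨r, h1, h2, h3⟩ := (hall.and (h0.and self_mem_nhdsWithin)).exists
    exact ⟨r, h2, h3, h1⟩
  have hlt : ∀ z ∈ ball (0 : ℂ) 1, ‖subordination t.toReal K z‖ < 1 := fun z hz =>
    (norm_subordination_le hT K (by simpa using hz)).trans_lt (by simpa using hz)
  have hH : DifferentiableOn ℂ (fun z => cayley (subordination t.toReal K z)) (ball 0 1) :=
    differentiableOn_cayley_comp (differentiableOn_subordination hT K) hlt
  have h0 : laurentCoeff r 0 (fun z => cayley (subordination t.toReal K z)) = 1 := by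
    obtain ⟨a, Q, hQ, hexp⟩ := exists_taylor_remainder one_pos hH 1
    have h1 := laurentCoeff.eq_of_expansion (n := 0) hr hr1 hQ (fun z _ => hexp z) one_pos
    rw [Nat.cast_zero] at h1
    have h2 : subordination t.toReal K 0 = 0 := by
      have := norm_subordination_le hT K (z := 0) (by simp)
      simpa using this
    have h3 := hexp 0
    simp only [h2, cayley] at h3
    rw [h1]
    simpa using h3.symm
  obtain ⟨μ, _, hμ⟩ := exists_measure_of_re_nonneg hr hr1 hH
    (fun z hz => (cayley_re_pos (hlt z hz)).le) h0
  obtain ⟨n, hn, θ, h⟩ := exists_uniform_approx μ K (half_pos hε)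
  refine ⟨n, hn, θ, fun k hk hk1 => ?_⟩
  have hmom : ∫ x, exp (k * x * I) ∂μ = (freeUnitaryBMMoment t k : ℂ) * r ^ k := by
    rw [hμ k hk1, laurentCoeff_cayley_subordination hT hk1 hk hr hr1,
      ← ofReal_freeUnitaryBMMoment ht hk1, RCLike.star_def, map_mul, conj_ofReal, map_ofNat]
    ring
  have h1 := h k hk
  rw [hmom] at h1
  calc _ = ‖((n : ℂ)⁻¹ * ∑ i ∈ Finset.range n, exp (k * θ i * I) -
          (freeUnitaryBMMoment t k : ℂ) * r ^ k) +
          ((freeUnitaryBMMoment t k : ℂ) * r ^ k - freeUnitaryBMMoment t k)‖ := by congr 1; ring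
    _ ≤ _ := norm_add_le _ _
    _ < ε / 2 + ε / 2 := add_lt_add h1 (hrk k hk)
    _ = ε := add_halves ε

end

/-! ### Group algebras, and freeness in free products of groups -/

namespace MonoidAlgebra

variable {G : Type u} [Group G]

/-- The adjoint of an element of a complex group algebra: `g ↦ g⁻¹`, extended antilinearly. -/
noncomputable def adjoint (f : MonoidAlgebra ℂ G) : MonoidAlgebra ℂ G :=
  ofCoeff ((f.coeff.mapRange star (star_zero ℂ)).equivMapDomain (Equiv.inv G))

theorem coeff_adjoint (f : MonoidAlgebra ℂ G) (g : G) :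
    f.adjoint.coeff g = star (f.coeff g⁻¹) := rfl

theorem adjoint_single (g : G) (z : ℂ) : (single g z).adjoint = single g⁻¹ (star z) := by
  ext h
  classical
  rw [coeff_adjoint, coeff_single, coeff_single, Finsupp.single_apply, Finsupp.single_apply]
  by_cases hg : g = h⁻¹
  · simp [hg]
  · rw [if_neg hg, if_neg (by rintro rfl; simp at hg), star_zero]

theorem adjoint_add (f g : MonoidAlgebra ℂ G) : (f + g).adjoint = f.adjoint + g.adjoint := by
  ext h
  simp [coeff_adjoint]

theorem adjoint_mul (f g : MonoidAlgebra ℂ G) : (f * g).adjoint = g.adjoint * f.adjoint := by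
  have hzero : (0 : MonoidAlgebra ℂ G).adjoint = 0 := by
    ext h
    simp [coeff_adjoint]
  induction f using induction_linear with
  | zero => rw [zero_mul, hzero, mul_zero]
  | add x y hx hy => rw [add_mul, adjoint_add, adjoint_add, hx, hy, mul_add]
  | single a r =>
    induction g using induction_linear with
    | zero => rw [mul_zero, hzero, zero_mul]
    | add x y hx hy => rw [mul_add, adjoint_add, adjoint_add, hx, hy, add_mul]
    | single b s =>
      rw [single_mul_single, adjoint_single, adjoint_single, adjoint_single, single_mul_single,
        mul_inv_rev, star_mul]

noncomputable instance : StarRing (MonoidAlgebra ℂ G) where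
  star := adjoint
  star_involutive f := by
    ext g
    rw [coeff_adjoint, coeff_adjoint, inv_inv, star_star]
  star_add := adjoint_add
  star_mul := adjoint_mul

theorem coeff_star (f : MonoidAlgebra ℂ G) (g : G) : (star f).coeff g = star (f.coeff g⁻¹) := rfl

theorem star_single (g : G) (z : ℂ) : star (single g z) = single g⁻¹ (star z) :=
  adjoint_single g z

instance : StarModule ℂ (MonoidAlgebra ℂ G) where
  star_smul r f := by
    ext g
    simp [coeff_star]

/-- The group elements, as unitary elements of the group algebra. -/
noncomputable def unitaryOf : G →* unitary (MonoidAlgebra ℂ G) where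
  toFun g := ⟨single g 1, by simp [Unitary.mem_iff, star_single, single_mul_single, one_def]⟩
  map_one' := rfl
  map_mul' g h := Subtype.ext (by simp [single_mul_single])

theorem coe_unitaryOf (g : G) : (unitaryOf g : MonoidAlgebra ℂ G) = single g 1 := rfl

section

variable {A : Type v} [Ring A] [StarRing A] [Algebra ℂ A] [StarModule ℂ A]

/-- The `*`-homomorphism extending a unitary representation. -/
noncomputable def liftUnitary (ρ : G →* unitary A) : MonoidAlgebra ℂ G →⋆ₐ[ℂ] A where
  toAlgHom := lift ℂ A G ((unitary A).subtype.comp ρ)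
  map_star' x := by
    change lift ℂ A G ((unitary A).subtype.comp ρ) (star x) =
      star (lift ℂ A G ((unitary A).subtype.comp ρ) x)
    induction x using induction_linear with
    | zero => simp
    | add x y hx hy => rw [star_add, map_add, hx, hy, map_add, star_add]
    | single g z =>
      rw [star_single, lift_single, lift_single, star_smul]
      simp [← Unitary.star_eq_inv]

theorem liftUnitary_single (ρ : G →* unitary A) (g : G) (z : ℂ) :
    liftUnitary ρ (single g z) = z • (ρ g : A) := lift_single _ _ _

end

/-- The canonical trace of a complex group algebra: the coefficient of the unit. -/
noncomputable def trace (G : Type u) [Group G] : Expectation (MonoidAlgebra ℂ G) where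
  φ := Finsupp.lapply 1 ∘ₗ (coeffLinearEquiv ℂ).toLinearMap
  map_one := coeff_one_one
  map_mul_comm x y := by
    change (x * y).coeff 1 = (y * x).coeff 1
    rw [coeff_mul_apply_left, coeff_mul_apply_right]
    simp only [mul_one, one_mul, mul_comm]
  map_star x := by
    change (star x).coeff 1 = star (x.coeff 1)
    rw [coeff_star, inv_one]
  nonneg x := by
    change 0 ≤ ((x * star x).coeff 1).re
    rw [coeff_mul_apply_left, Finsupp.sum, Complex.re_sum]
    refine Finset.sum_nonneg fun g _ => ?_
    rw [mul_one, coeff_star, inv_inv]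
    change 0 ≤ (x.coeff g * (starRingEnd ℂ) (x.coeff g)).re
    rw [Complex.mul_conj, Complex.ofReal_re]
    exact Complex.normSq_nonneg _

theorem trace_apply (x : MonoidAlgebra ℂ G) : (trace G).φ x = x.coeff 1 := rfl

theorem trace_single [DecidableEq G] (g : G) (z : ℂ) :
    (trace G).φ (single g z) = if g = 1 then z else 0 := by
  rw [trace_apply, coeff_single, Finsupp.single_apply]

/-- The inclusion of group algebras induced by a group homomorphism. -/
noncomputable def mapGroup {H : Type v} [Group H] (f : G →* H) :
    MonoidAlgebra ℂ G →⋆ₐ[ℂ] MonoidAlgebra ℂ H :=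
  liftUnitary (unitaryOf.comp f)

theorem mapGroup_single {H : Type v} [Group H] (f : G →* H) (g : G) (z : ℂ) :
    mapGroup f (single g z) = single (f g) z := by
  rw [mapGroup, liftUnitary_single, MonoidHom.comp_apply, coe_unitaryOf, smul_single', mul_one]

theorem trace_mapGroup {H : Type v} [Group H] {f : G →* H} (hf : Injective f)
    (x : MonoidAlgebra ℂ G) : (trace H).φ (mapGroup f x) = (trace G).φ x := by
  classical
  induction x using induction_linear with
  | zero => simp
  | add x y hx hy => rw [map_add, map_add, map_add, hx, hy]
  | single g z =>
    rw [mapGroup_single, trace_single, trace_single]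
    exact if_congr ⟨fun h => hf (h.trans f.map_one.symm), fun h => by rw [h, f.map_one]⟩ rfl rfl

theorem mem_span_single_of_coeff_one_eq_zero {x : MonoidAlgebra ℂ G} (hx : x.coeff 1 = 0) :
    x ∈ Submodule.span ℂ {y | ∃ g : G, g ≠ 1 ∧ single g 1 = y} := by
  rw [← sum_coeff_single x]
  refine Submodule.sum_mem _ fun g hg => ?_
  have : single g (x.coeff g) = x.coeff g • single g (1 : ℂ) := by rw [smul_single', mul_one]
  rw [this]
  refine Submodule.smul_mem _ _ (Submodule.subset_span ⟨g, ?_, rfl⟩)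
  rintro rfl
  exact Finsupp.mem_support_iff.1 hg hx

section

open Monoid CoprodI

variable {ι : Type v} {K : ι → Type w} [∀ i, Group (K i)]

/-- The span of the reduced words of a free product whose first letter has a given index. -/
noncomputable def wordSpan (K : ι → Type w) [∀ i, Group (K i)] (i : Option ι) :
    Submodule ℂ (MonoidAlgebra ℂ (CoprodI K)) :=
  Submodule.span ℂ {y | ∃ v : Word K, v.fstIdx = i ∧ single v.prod 1 = y}

theorem mul_mem_wordSpan {i : ι} {j : Option ι} (hij : j ≠ some i)
    {x y : MonoidAlgebra ℂ (CoprodI K)}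
    (hx : x ∈ Submodule.span ℂ {y | ∃ g : K i, g ≠ 1 ∧ single (CoprodI.of g) 1 = y})
    (hy : y ∈ wordSpan K j) : x * y ∈ wordSpan K (some i) := by
  have h := Submodule.mul_mem_mul hx hy
  rw [wordSpan, Submodule.span_mul_span] at h
  refine Submodule.span_mono ?_ h
  rintro _ ⟨_, ⟨g, hg, rfl⟩, _, ⟨v, hv, rfl⟩, rfl⟩
  have hv' : v.fstIdx ≠ some i := by rwa [hv]
  exact ⟨Word.cons g v hv' hg, Word.fstIdx_cons _ _ _ _, by
    rw [Word.prod_cons]; simp [single_mul_single]⟩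

/-- The group algebras of the factors of a free product are free. -/
theorem free_mapGroup_of :
    (trace (CoprodI K)).Free fun i => (mapGroup (CoprodI.of : K i →* CoprodI K)).range := by
  classical
  have key : ∀ l : List (ι × MonoidAlgebra ℂ (CoprodI K)), l.IsChain (fun p q => p.1 ≠ q.1) →
      (∀ p ∈ l, p.2 ∈ (mapGroup (CoprodI.of : K p.1 →* CoprodI K)).range ∧
        (trace (CoprodI K)).φ p.2 = 0) →
      (l.map Prod.snd).prod ∈ wordSpan K (l.head?.map Prod.fst) := by
    intro l
    induction l with
    | nil => exact fun _ _ => Submodule.subset_span ⟨Word.empty, rfl, rfl⟩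
    | cons p l ih =>
      intro hc hm
      rw [List.map_cons, List.prod_cons]
      refine mul_mem_wordSpan (i := p.1) (j := l.head?.map Prod.fst) ?_ ?_
        (ih hc.tail fun q hq => hm q (List.mem_cons_of_mem _ hq))
      · intro h
        obtain ⟨q, hq, hqp⟩ := Option.map_eq_some_iff.1 h
        exact (List.isChain_cons.1 hc).1 q hq hqp.symm
      · obtain ⟨⟨y, hy⟩, h0⟩ := hm p List.mem_cons_self
        have hy : mapGroup CoprodI.of y = p.2 := hy
        rw [← hy, trace_mapGroup (CoprodI.of_injective _)] at h0
        rw [← hy]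
        have h := Submodule.mem_map_of_mem
          (f := (mapGroup (CoprodI.of : K p.1 →* CoprodI K)).toAlgHom.toLinearMap)
          (mem_span_single_of_coeff_one_eq_zero h0)
        rw [Submodule.map_span] at h
        refine Submodule.span_mono ?_ h
        rintro _ ⟨_, ⟨g, hg, rfl⟩, rfl⟩
        exact ⟨g, hg, (mapGroup_single _ _ _).symm⟩
  intro l hne hc hm
  obtain ⟨p, l, rfl⟩ := List.exists_cons_of_ne_nil hne
  have h := key _ hc hm
  have hle : wordSpan K (some p.1) ≤ LinearMap.ker (trace (CoprodI K)).φ := by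
    refine Submodule.span_le.2 ?_
    rintro _ ⟨v, hv, rfl⟩
    rw [SetLike.mem_coe, LinearMap.mem_ker, trace_single, if_neg]
    intro h1
    have : v = Word.empty := Word.equiv.symm.injective h1
    rw [this] at hv
    exact absurd hv (by simp [Word.fstIdx, Word.empty])
  exact hle h

end

end MonoidAlgebra

/-! ### Pull-backs and limits of expectations -/

namespace Expectation

section

variable {X : Type u} [Ring X] [StarRing X] [Algebra ℂ X] [StarModule ℂ X]
  {Y : Type v} [Ring Y] [StarRing Y] [Algebra ℂ Y] [StarModule ℂ Y]

/-- The pull-back of an expectation by a `*`-homomorphism. -/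
def comap (E : Expectation Y) (π : X →⋆ₐ[ℂ] Y) : Expectation X where
  φ := E.φ ∘ₗ π.toAlgHom.toLinearMap
  map_one := by
    change E.φ (π 1) = 1
    rw [_root_.map_one π, E.map_one]
  map_mul_comm x y := by
    change E.φ (π (x * y)) = E.φ (π (y * x))
    rw [map_mul π, map_mul π, E.map_mul_comm]
  map_star x := by
    change E.φ (π (star x)) = star (E.φ (π x))
    rw [StarHomClass.map_star, E.map_star]
  nonneg x := by
    change 0 ≤ (E.φ (π (x * star x))).re
    rw [map_mul π, StarHomClass.map_star]
    exact E.nonneg _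

theorem comap_apply (E : Expectation Y) (π : X →⋆ₐ[ℂ] Y) (x : X) :
    (E.comap π).φ x = E.φ (π x) := rfl

theorem Free.comap {ι : Type*} {E : Expectation Y} {A : ι → StarSubalgebra ℂ Y} (h : E.Free A)
    (π : X →⋆ₐ[ℂ] Y) {B : ι → StarSubalgebra ℂ X} (hB : ∀ i, ∀ x ∈ B i, π x ∈ A i) :
    (E.comap π).Free B := by
  intro l hne hc hm
  have := h (l.map fun p => (p.1, π p.2)) (by simpa using hne)
    (by rw [List.isChain_map]; exact hc) (by
      intro p hp
      obtain ⟨q, hq, rfl⟩ := List.mem_map.1 hp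
      exact ⟨hB _ _ (hm q hq).1, (hm q hq).2⟩)
  rw [comap_apply, map_list_prod, List.map_map]
  rwa [List.map_map] at this

theorem Free.mono {ι : Type*} {E : Expectation X} {A B : ι → StarSubalgebra ℂ X} (h : E.Free A)
    (hB : ∀ i, B i ≤ A i) : E.Free B :=
  fun l hne hc hm => h l hne hc fun p hp => ⟨hB _ (hm p hp).1, (hm p hp).2⟩

open Filter Topology

/-- A pointwise bounded sequence of expectations has a limit along every ultrafilter. -/
theorem exists_tendsto_ultrafilter {κ : Type*} (U : Ultrafilter κ) (E : κ → Expectation X)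
    (hE : ∀ x, ∃ C : ℝ, ∀ j, ‖(E j).φ x‖ ≤ C) :
    ∃ F : Expectation X, ∀ x, Tendsto (fun j => (E j).φ x) U (𝓝 (F.φ x)) := by
  have hlim : ∀ x, ∃ z : ℂ, Tendsto (fun j => (E j).φ x) U (𝓝 z) := by
    intro x
    obtain ⟨C, hC⟩ := hE x
    obtain ⟨z, -, hz⟩ := (isCompact_closedBall (0 : ℂ) C).ultrafilter_le_nhds
      (U.map fun j => (E j).φ x) (by
        rw [le_principal_iff]
        exact mem_map.2 (Filter.univ_mem' fun j => by simpa using hC j))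
    exact ⟨z, hz⟩
  choose f hf using hlim
  refine ⟨{ φ := { toFun := f, map_add' := fun x y => ?_, map_smul' := fun r x => ?_ }
            map_one := ?_, map_mul_comm := fun x y => ?_, map_star := fun x => ?_
            nonneg := fun x => ?_ }, hf⟩
  · refine tendsto_nhds_unique (hf (x + y)) ?_
    simpa only [map_add] using (hf x).add (hf y)
  · refine tendsto_nhds_unique (hf (r • x)) ?_
    simpa only [map_smul, smul_eq_mul, RingHom.id_apply] using (hf x).const_mul r
  · refine tendsto_nhds_unique (hf 1) ?_
    simp only [map_one]
    exact tendsto_const_nhds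
  · refine tendsto_nhds_unique (hf (x * y)) ?_
    simp only [map_mul_comm _ x y]
    exact hf (y * x)
  · refine tendsto_nhds_unique (hf (star x)) ?_
    simp only [map_star]
    exact (hf x).star
  · exact ge_of_tendsto' ((Complex.continuous_re.tendsto _).comp (hf (x * star x)))
      fun j => (E j).nonneg x

/-- Freeness passes to the limit. -/
theorem Free.of_tendsto {κ ι : Type*} {U : Filter κ} [U.NeBot] {E : κ → Expectation X}
    {F : Expectation X} (hF : ∀ x, Tendsto (fun j => (E j).φ x) U (𝓝 (F.φ x)))
    {A : ι → StarSubalgebra ℂ X} (hA : ∀ j, (E j).Free A) : F.Free A := by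
  -- Centering depends on `j`, so the letters are centered with respect to each expectation before
  -- passing to the limit. The arbitrary prefix `y` takes up the uncentered letters in the
  -- induction.
  have key : ∀ (l : List (ι × X)) (y : X), Tendsto (fun j => (E j).φ
      (y * (l.map fun p => p.2 - algebraMap ℂ X ((E j).φ p.2)).prod)) U
      (𝓝 (F.φ (y * (l.map fun p => p.2 - algebraMap ℂ X (F.φ p.2)).prod))) := by
    intro l
    induction l with
    | nil => simpa using hF
    | cons p l ih =>
      intro y
      have h := (ih (y * p.2)).sub ((hF p.2).mul (ih y))
      have hexp : ∀ (E : Expectation X) (c : ℂ) (z : X),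
          E.φ (y * ((p.2 - algebraMap ℂ X c) * z)) = E.φ (y * p.2 * z) - c * E.φ (y * z) := by
        intro E c z
        rw [sub_mul, mul_sub, map_sub, ← mul_assoc, ← Algebra.smul_def, mul_smul_comm, map_smul,
          smul_eq_mul]
      simpa only [List.map_cons, List.prod_cons, hexp] using h
  intro l hne hc hm
  have h := key l 1
  have h0 : ∀ j, (E j).φ (1 * (l.map fun p => p.2 - algebraMap ℂ X ((E j).φ p.2)).prod) = 0 := by
    intro j
    have := hA j (l.map fun p => (p.1, p.2 - algebraMap ℂ X ((E j).φ p.2))) (by simpa using hne)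
      (by rw [List.isChain_map]; exact hc) (by
        intro p hp
        obtain ⟨q, hq, rfl⟩ := List.mem_map.1 hp
        exact ⟨sub_mem (hm q hq).1 (algebraMap_mem _ _), (E j).map_sub_algebraMap _⟩)
    rw [List.map_map] at this
    rw [one_mul]
    exact this
  have h1 : F.φ (1 * (l.map fun p => p.2 - algebraMap ℂ X (F.φ p.2)).prod) = 0 :=
    tendsto_nhds_unique h (by simp only [h0]; exact tendsto_const_nhds)
  rw [one_mul] at h1
  rw [← h1]
  congr 2
  refine List.map_congr_left fun p hp => ?_
  rw [(hm p hp).2, map_zero, sub_zero]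

end

end Expectation

/-! ### A free unitary Brownian motion free from a group algebra -/

namespace MonoidAlgebra

section

variable (N : ℕ) [NeZero N]

/-- The spectral projections of the group algebra of a cyclic group. -/
noncomputable def cyclicProj (i : ZMod N) : MonoidAlgebra ℂ (Multiplicative (ZMod N)) :=
  (N : ℂ)⁻¹ • ∑ k : ZMod N, single (Multiplicative.ofAdd k) (ZMod.stdAddChar (-(k * i)))

variable {N}

theorem single_mul_cyclicProj (k i : ZMod N) :
    single (Multiplicative.ofAdd k) (1 : ℂ) * cyclicProj N i =
      ZMod.stdAddChar (k * i) • cyclicProj N i := by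
  rw [cyclicProj, mul_smul_comm, smul_comm, Finset.mul_sum]
  congr 1
  rw [Finset.smul_sum, ← Equiv.sum_comp (Equiv.addLeft k) (fun l : ZMod N => ZMod.stdAddChar (k * i) •
    single (Multiplicative.ofAdd l) (ZMod.stdAddChar (-(l * i)) : ℂ))]
  refine Finset.sum_congr rfl fun l _ => ?_
  rw [single_mul_single, smul_single', one_mul, Equiv.coe_addLeft, ofAdd_add,
    ← AddChar.map_add_eq_mul]
  congr 2
  ring

theorem cyclicProj_mul (i j : ZMod N) :
    cyclicProj N i * cyclicProj N j = if i = j then cyclicProj N j else 0 := by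
  have hN : (N : ℂ) ≠ 0 := NeZero.ne _
  have h : ∀ k : ZMod N, single (Multiplicative.ofAdd k) (ZMod.stdAddChar (-(k * i)) : ℂ) *
      cyclicProj N j = (ZMod.stdAddChar (k * (j - i)) : ℂ) • cyclicProj N j := by
    intro k
    have : single (Multiplicative.ofAdd k) (ZMod.stdAddChar (-(k * i)) : ℂ) =
        (ZMod.stdAddChar (-(k * i)) : ℂ) • single (Multiplicative.ofAdd k) (1 : ℂ) := by
      rw [smul_single', mul_one]
    rw [this, smul_mul_assoc, single_mul_cyclicProj, smul_smul, ← AddChar.map_add_eq_mul]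
    congr 2
    ring
  rw [cyclicProj, smul_mul_assoc, Finset.sum_mul, Finset.sum_congr rfl fun k _ => h k,
    ← Finset.sum_smul, AddChar.sum_mulShift _ (ZMod.isPrimitive_stdAddChar N), ZMod.card]
  by_cases hij : i = j
  · rw [if_pos (by rw [hij, sub_self]), if_pos hij, smul_smul, inv_mul_cancel₀ hN, one_smul]
  · rw [if_neg (fun h => hij (sub_eq_zero.1 h).symm), if_neg hij, Nat.cast_zero, zero_smul,
      smul_zero]

theorem sum_cyclicProj : ∑ i, cyclicProj N i = 1 := by
  have hN : (N : ℂ) ≠ 0 := NeZero.ne _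
  simp only [cyclicProj]
  rw [← Finset.smul_sum, Finset.sum_comm]
  have h : ∀ k : ZMod N, ∑ i : ZMod N, single (Multiplicative.ofAdd k)
      (ZMod.stdAddChar (-(k * i)) : ℂ) = if k = 0 then (N : ℂ) • 1 else 0 := by
    intro k
    have h1 : ∑ i : ZMod N, single (Multiplicative.ofAdd k) (ZMod.stdAddChar (-(k * i)) : ℂ) =
        (∑ i : ZMod N, (ZMod.stdAddChar (i * -k) : ℂ)) •
          single (Multiplicative.ofAdd k) (1 : ℂ) := by
      rw [Finset.sum_smul]
      refine Finset.sum_congr rfl fun i _ => ?_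
      rw [smul_single', mul_one]
      congr 2
      ring
    rw [h1, AddChar.sum_mulShift _ (ZMod.isPrimitive_stdAddChar N), ZMod.card]
    by_cases hk : k = 0
    · rw [if_pos (by rw [hk, neg_zero]), if_pos hk, hk]
      rfl
    · rw [if_neg (neg_ne_zero.2 hk), if_neg hk, Nat.cast_zero, zero_smul]
  rw [Finset.sum_congr rfl fun k _ => h k, Finset.sum_ite_eq' Finset.univ,
    if_pos (Finset.mem_univ _), smul_smul, inv_mul_cancel₀ hN, one_smul]

theorem star_cyclicProj (i : ZMod N) : star (cyclicProj N i) = cyclicProj N i := by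
  rw [cyclicProj, star_smul, star_sum]
  congr 1
  · simp
  · rw [← Equiv.sum_comp (Equiv.neg (ZMod N)) fun l : ZMod N => single (Multiplicative.ofAdd l)
      (ZMod.stdAddChar (-(l * i)) : ℂ)]
    refine Finset.sum_congr rfl fun k _ => ?_
    rw [star_single, Equiv.neg_apply, ofAdd_neg]
    congr 1
    change (starRingEnd ℂ) _ = _
    rw [← AddChar.map_neg_eq_conj]
    congr 1
    ring

theorem trace_cyclicProj (i : ZMod N) : (trace _).φ (cyclicProj N i) = (N : ℂ)⁻¹ := by
  rw [cyclicProj, map_smul, map_sum, smul_eq_mul]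
  simp only [trace_single]
  rw [Finset.sum_eq_single 0]
  · simp
  · intro k _ hk
    rw [if_neg]
    exact fun h => hk (Multiplicative.ofAdd.injective h)
  · simp

/-- A unitary element with prescribed eigenvalues. -/
theorem exists_unitary_trace_pow (θ : ZMod N → ℝ) :
    ∃ y ∈ unitary (MonoidAlgebra ℂ (Multiplicative (ZMod N))), ∀ k : ℕ, (trace _).φ (y ^ k) =
      (N : ℂ)⁻¹ * ∑ i, Complex.exp (k * θ i * Complex.I) := by
  have hmul : ∀ f g : ZMod N → ℂ, (∑ i, f i • cyclicProj N i) * (∑ i, g i • cyclicProj N i) =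
      ∑ i, (f i * g i) • cyclicProj N i := by
    intro f g
    rw [Finset.sum_mul_sum]
    refine Finset.sum_congr rfl fun i _ => ?_
    rw [Finset.sum_eq_single i]
    · rw [smul_mul_smul_comm, cyclicProj_mul, if_pos rfl]
    · intro j _ hj
      rw [smul_mul_smul_comm, cyclicProj_mul, if_neg hj.symm, smul_zero]
    · simp
  have hpow : ∀ (f : ZMod N → ℂ) (k : ℕ), (∑ i, f i • cyclicProj N i) ^ k =
      ∑ i, f i ^ k • cyclicProj N i := by
    intro f k
    induction k with
    | zero => simp [sum_cyclicProj]
    | succ k ih => rw [pow_succ, ih, hmul]; simp only [pow_succ]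
  have hstar : ∀ f : ZMod N → ℂ, star (∑ i, f i • cyclicProj N i) =
      ∑ i, star (f i) • cyclicProj N i := by
    intro f
    rw [star_sum]
    simp only [star_smul, star_cyclicProj]
  have hone : ∀ i, Complex.exp (θ i * Complex.I) * star (Complex.exp (θ i * Complex.I)) = 1 := by
    intro i
    change _ * (starRingEnd ℂ) _ = 1
    rw [Complex.mul_conj, Complex.normSq_eq_norm_sq, Complex.norm_exp_ofReal_mul_I]
    simp
  refine ⟨∑ i, Complex.exp (θ i * Complex.I) • cyclicProj N i, ?_, fun k => ?_⟩
  · rw [Unitary.mem_iff, hstar, hmul, hmul]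
    simp only [mul_comm (star _), hone, one_smul, sum_cyclicProj, and_self]
  · rw [hpow, map_sum, Finset.mul_sum]
    refine Finset.sum_congr rfl fun i _ => ?_
    rw [map_smul, trace_cyclicProj, smul_eq_mul, mul_comm, ← Complex.exp_nat_mul, mul_assoc]

end

/-- The distribution of a representation of `Q` and of a unitary element, on the group algebra of
the free product of `Q` and `ℤ`. -/
theorem exists_expectation_coprod {Q : Type u} [Group Q] {Y : Type v} [Ring Y] [StarRing Y]
    [Algebra ℂ Y] [StarModule ℂ Y] (E : Expectation Y) (ρ : Q →* unitary Y) {y : Y}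
    (hy : y ∈ unitary Y)
    (hfree : E.Free ![(liftUnitary ρ).range, StarAlgebra.adjoin ℂ {y}]) :
    ∃ F : Expectation (MonoidAlgebra ℂ (Monoid.Coprod Q (Multiplicative ℤ))),
      (∀ z, F.φ (mapGroup Monoid.Coprod.inl z) = E.φ (liftUnitary ρ z)) ∧
      (∀ k : ℕ, F.φ (single (Monoid.Coprod.inr (Multiplicative.ofAdd 1)) 1 ^ k) = E.φ (y ^ k)) ∧
      F.Free ![(mapGroup (Monoid.Coprod.inl : Q →* Monoid.Coprod Q (Multiplicative ℤ))).range,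
        StarAlgebra.adjoin ℂ {single (Monoid.Coprod.inr (Multiplicative.ofAdd 1)) 1}] := by
  obtain ⟨π, hπ⟩ : ∃ π, π = liftUnitary (Monoid.Coprod.lift ρ (zpowersHom _ ⟨y, hy⟩)) := ⟨_, rfl⟩
  have hπf : ∀ z, π (mapGroup Monoid.Coprod.inl z) = liftUnitary ρ z := by
    intro z
    induction z using induction_linear with
    | zero => rw [map_zero, map_zero, map_zero]
    | add x y hx hy => rw [map_add, map_add, hx, hy, map_add]
    | single q z =>
      rw [hπ, mapGroup_single, liftUnitary_single, Monoid.Coprod.lift_apply_inl,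
        liftUnitary_single]
  have hπu : π (single (Monoid.Coprod.inr (Multiplicative.ofAdd 1)) 1) = y := by
    rw [hπ, liftUnitary_single, Monoid.Coprod.lift_apply_inr, one_smul]
    simp [zpowersHom_apply]
  refine ⟨E.comap π, fun z => ?_, fun k => ?_, ?_⟩
  · rw [Expectation.comap_apply, hπf]
  · rw [Expectation.comap_apply, map_pow, hπu]
  · refine Expectation.Free.comap (X := MonoidAlgebra ℂ (Monoid.Coprod Q (Multiplicative ℤ)))
      hfree π ?_
    rw [Fin.forall_fin_two]
    constructor
    · rintro _ ⟨z, rfl⟩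
      exact ⟨z, (hπf z).symm⟩
    · refine StarAlgebra.adjoin_le (S := (StarAlgebra.adjoin ℂ {y}).comap π) ?_
      rw [Set.singleton_subset_iff]
      change π _ ∈ StarAlgebra.adjoin ℂ {y}
      rw [hπu]
      exact StarAlgebra.subset_adjoin ℂ _ (Set.mem_singleton _)

theorem range_mapGroup_comp_le {G : Type u} {H : Type v} {L : Type w} [Group G] [Group H] [Group L]
    (f : H →* L) (g : G →* H) : (mapGroup (f.comp g)).range ≤ (mapGroup f).range := by
  rintro _ ⟨z, rfl⟩
  refine ⟨mapGroup g z, ?_⟩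
  change mapGroup f (mapGroup g z) = mapGroup (f.comp g) z
  induction z using induction_linear with
  | zero => rw [map_zero, map_zero, map_zero]
  | add x y hx hy => rw [map_add, map_add, hx, hy, map_add]
  | single q z => rw [mapGroup_single, mapGroup_single, mapGroup_single, MonoidHom.comp_apply]

/-- Approximate models: a group algebra, and a unitary element free from it with prescribed
eigenvalues. -/
theorem exists_free_unitary (Q : Type u) [Group Q] {n : ℕ} (hn : 0 < n) (θ : ℕ → ℝ) :
    ∃ (H : Type u) (_ : Group H) (f : Q →* H) (y : MonoidAlgebra ℂ H), Injective f ∧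
      y ∈ unitary (MonoidAlgebra ℂ H) ∧
      (∀ k : ℕ, (trace H).φ (y ^ k) =
        (n : ℂ)⁻¹ * ∑ i ∈ Finset.range n, Complex.exp (k * θ i * Complex.I)) ∧
      (trace H).Free ![(mapGroup f).range, StarAlgebra.adjoin ℂ {y}] := by
  obtain ⟨N, rfl⟩ : ∃ N, n = N + 1 := ⟨n - 1, by omega⟩
  obtain ⟨y, hy, hyk⟩ := exists_unitary_trace_pow (N := N + 1) fun i => θ (ZMod.val i)
  -- Both factors are taken equal to `Q × ℤ/(N+1)`, which avoids a dependent family; `Q` is used in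
  -- the first and the cyclic group in the second.
  let K : Fin 2 → Type u := fun _ => Q × Multiplicative (ZMod (N + 1))
  have hf := (Monoid.CoprodI.of_injective (M := K) 0).comp
    (Prod.mk_left_injective (1 : Multiplicative (ZMod (N + 1))))
  have hg := (Monoid.CoprodI.of_injective (M := K) 1).comp (Prod.mk_right_injective (1 : Q))
  obtain ⟨g, hgg⟩ : ∃ g : Multiplicative (ZMod (N + 1)) →* Monoid.CoprodI K,
    g = (Monoid.CoprodI.of (M := K) (i := 1)).comp (MonoidHom.inr Q _) := ⟨_, rfl⟩
  have hgi : Injective g := by rw [hgg]; exact hg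
  refine ⟨Monoid.CoprodI K, inferInstance,
    (Monoid.CoprodI.of (M := K) (i := 0)).comp (MonoidHom.inl Q _), mapGroup g y, hf,
    Unitary.map_mem (mapGroup g) hy, fun k => ?_, (free_mapGroup_of (K := K)).mono ?_⟩
  · rw [← map_pow, trace_mapGroup hgi, hyk, Finset.sum_range]
    rfl
  · rw [Fin.forall_fin_two]
    constructor
    · exact range_mapGroup_comp_le _ _
    · refine StarAlgebra.adjoin_le ?_
      rw [Set.singleton_subset_iff]
      have := range_mapGroup_comp_le (Monoid.CoprodI.of (M := K) (i := 1)) (MonoidHom.inr Q _)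
      rw [← hgg] at this
      exact this ⟨y, rfl⟩

end MonoidAlgebra

open Filter Topology MonoidAlgebra in
/-- Existence of a free unitary Brownian motion at a finite time, free from a given group
algebra. -/
theorem exists_freeUnitaryBM (Q : Type u) [Group Q] {t : ENNReal} (ht : t ≠ ⊤) :
    ∃ (X : Type u) (_ : Ring X) (_ : StarRing X) (_ : Algebra ℂ X) (_ : StarModule ℂ X)
      (F : Expectation X) (ι : MonoidAlgebra ℂ Q →⋆ₐ[ℂ] X) (x : X),
      (∀ y, F.φ (ι y) = (trace Q).φ y) ∧ F.IsFreeUnitaryBMAt t x ∧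
      F.Free ![ι.range, StarAlgebra.adjoin ℂ {x}] := by
  -- The approximate models live in different groups. Their expectations are pulled back to the one
  -- algebra of `Q * ℤ`, where a limit makes sense.
  have h : ∀ j : ℕ, ∃ E : Expectation (MonoidAlgebra ℂ (Monoid.Coprod Q (Multiplicative ℤ))),
      (∀ y, E.φ (mapGroup Monoid.Coprod.inl y) = (trace Q).φ y) ∧
      (∀ k : ℕ, k ≤ j → 1 ≤ k →
        ‖E.φ (single (Monoid.Coprod.inr (Multiplicative.ofAdd 1)) 1 ^ k) -
          freeUnitaryBMMoment t k‖ < 1 / ((j : ℝ) + 1)) ∧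
      E.Free ![(mapGroup (Monoid.Coprod.inl : Q →* Monoid.Coprod Q (Multiplicative ℤ))).range,
        StarAlgebra.adjoin ℂ {single (Monoid.Coprod.inr (Multiplicative.ofAdd 1)) 1}] := by
    intro j
    obtain ⟨n, hn, θ, hθ⟩ := exists_uniform_approx_freeUnitaryBM ht j
      (ε := 1 / ((j : ℝ) + 1)) (by positivity)
    obtain ⟨H, _, f, y, hf, hy, hyk, hfree⟩ := exists_free_unitary Q hn θ
    obtain ⟨E, h1, h2, h3⟩ := exists_expectation_coprod (trace H) (unitaryOf.comp f) hy hfree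
    exact ⟨E, fun z => (h1 z).trans (trace_mapGroup hf z),
      fun k hk hk1 => by rw [h2, hyk]; exact hθ k hk hk1, h3⟩
  choose E hE1 hE2 hE3 using h
  -- Group elements are unitary, so every expectation is bounded by `1` on them; this gives bounds
  -- uniform in `j` on all of the algebra.
  obtain ⟨F, hF⟩ := Expectation.exists_tendsto_ultrafilter (hyperfilter ℕ) E (by
    intro x
    induction x using induction_linear with
    | zero => exact ⟨0, fun j => by simp⟩
    | add x y hx hy =>
      obtain ⟨C, hC⟩ := hx
      obtain ⟨D, hD⟩ := hy
      exact ⟨C + D, fun j => by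
        rw [map_add]
        exact (norm_add_le _ _).trans (add_le_add (hC j) (hD j))⟩
    | single g z =>
      refine ⟨‖z‖, fun j => ?_⟩
      have : single g z = z • (unitaryOf g : MonoidAlgebra ℂ _) := by
        rw [coe_unitaryOf, smul_single', mul_one]
      rw [this, map_smul, smul_eq_mul, norm_mul]
      exact mul_le_of_le_one_right (norm_nonneg _) ((E j).norm_map_unitary_le (unitaryOf g).2))
  have hle : (hyperfilter ℕ : Filter ℕ) ≤ atTop := Nat.hyperfilter_le_atTop
  refine ⟨_, inferInstance, inferInstance, inferInstance, inferInstance, F,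
    mapGroup Monoid.Coprod.inl, single (Monoid.Coprod.inr (Multiplicative.ofAdd 1)) 1,
    fun y => ?_, ⟨(unitaryOf _).2, fun k hk => ?_⟩, Expectation.Free.of_tendsto hF hE3⟩
  · refine tendsto_nhds_unique (hF _) ?_
    simp only [hE1]
    exact tendsto_const_nhds
  · refine tendsto_nhds_unique (hF _) (Tendsto.mono_left ?_ hle)
    rw [tendsto_iff_norm_sub_tendsto_zero]
    refine squeeze_zero' (Eventually.of_forall fun _ => norm_nonneg _) ?_
      (tendsto_one_div_add_atTop_nhds_zero_nat (𝕜 := ℝ))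
    filter_upwards [eventually_ge_atTop k] with j hj
    exact (hE2 j k hj hk).le

/-! ### From the model to a `t`-free pair -/

namespace Expectation

section

variable {X : Type u} [Ring X] [StarRing X] [Algebra ℂ X] [StarModule ℂ X]

/-- With two colours, a list of pairwise distinct colours has at most two entries. -/
theorem independent_pair {E : Expectation X} {A B : StarSubalgebra ℂ X}
    (hcomm : ∀ a ∈ A, ∀ b ∈ B, a * b = b * a)
    (hzero : ∀ a ∈ A, ∀ b ∈ B, E.φ a = 0 → E.φ b = 0 → E.φ (a * b) = 0) :
    E.Independent ![A, B] := by
  refine ⟨?_, ?_⟩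
  · rw [Fin.forall_fin_two]
    constructor <;> rw [Fin.forall_fin_two] <;> refine ⟨fun h => ?_, fun h => ?_⟩
    · exact absurd rfl h
    · exact hcomm
    · exact fun b hb a ha => (hcomm a ha b hb).symm
    · exact absurd rfl h
  · intro l hne hp hm
    match l, hne, hp, hm with
    | [p], _, _, hm => simpa using (hm p (by simp)).2
    | [⟨i, a⟩, ⟨j, b⟩], _, hp, hm =>
      have hij : i ≠ j := by simpa using hp
      have ha := hm (i, a) (by simp)
      have hb := hm (j, b) (by simp)
      have : (([(i, a), (j, b)] : List (Fin 2 × X)).map Prod.snd).prod = a * b := by simp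
      rw [this]
      match i, j with
      | 0, 0 => exact absurd rfl hij
      | 0, 1 => exact hzero a ha.1 b hb.1 ha.2 hb.2
      | 1, 0 =>
        rw [E.map_mul_comm]
        exact hzero b hb.1 a ha.1 hb.2 ha.2
      | 1, 1 => exact absurd rfl hij
    | p :: q :: r :: l, _, hp, _ =>
      simp only [List.pairwise_cons, List.mem_cons] at hp
      have h1 := hp.1 q (Or.inl rfl)
      have h2 := hp.1 r (Or.inr (Or.inl rfl))
      have h3 := hp.2.1 r (Or.inl rfl)
      omega

theorem Independent.mono {ι : Type*} {E : Expectation X} {A B : ι → StarSubalgebra ℂ X}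
    (h : E.Independent A) (hB : ∀ i, B i ≤ A i) : E.Independent B :=
  ⟨fun i j hij a ha b hb => h.1 i j hij a (hB i ha) b (hB j hb),
    fun l hne hc hm => h.2 l hne hc fun p hp => ⟨hB _ (hm p hp).1, (hm p hp).2⟩⟩

theorem Independent.mono_pair {E : Expectation X} {A A' B B' : StarSubalgebra ℂ X}
    (h : E.Independent ![A, B]) (hA : A' ≤ A) (hB : B' ≤ B) : E.Independent ![A', B'] := by
  refine h.mono fun i => ?_
  fin_cases i
  · exact hA
  · exact hB

theorem Free.mono_pair {E : Expectation X} {A A' B B' : StarSubalgebra ℂ X}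
    (h : E.Free ![A, B]) (hA : A' ≤ A) (hB : B' ≤ B) : E.Free ![A', B'] := by
  refine h.mono fun i => ?_
  fin_cases i
  · exact hA
  · exact hB

/-- In a model of the `t`-free product, the subalgebras `A` and `x B x*` are `t`-free. -/
theorem tfree_conjSubalgebra {F : Expectation X} {t : ENNReal} {x : unitary X}
    {A B : StarSubalgebra ℂ X} (hind : F.Independent ![A, B]) (hx : F.IsFreeUnitaryBMAt t (x : X))
    (hfree : F.Free ![A ⊔ B, StarAlgebra.adjoin ℂ {(x : X)}]) :
    F.TFree t A (conjSubalgebra B x) := by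
  obtain ⟨β, hβ⟩ : ∃ β : conjSubalgebra B x →⋆ₐ[ℂ] X, ∀ b, β b = star (x : X) * b * x := by
    refine ⟨((Unitary.conjStarAlgAut ℂ X x⁻¹ : X ≃⋆ₐ[ℂ] X) : X →⋆ₐ[ℂ] X).comp
      (conjSubalgebra B x).subtype, fun b => ?_⟩
    change Unitary.conjStarAlgAut ℂ X x⁻¹ (b : X) = _
    rw [Unitary.conjStarAlgAut_apply, ← Unitary.star_eq_inv, Unitary.coe_star, star_star]
  have hx1 : star (x : X) * x = 1 := Unitary.star_mul_self_of_mem x.2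
  have hx2 : (x : X) * star (x : X) = 1 := Unitary.mul_star_self_of_mem x.2
  have hA : A.subtype.range ≤ A := by
    rintro _ ⟨a, rfl⟩
    exact a.2
  have hB : β.range ≤ B := by
    rintro _ ⟨b, rfl⟩
    obtain ⟨c, hc, hb⟩ := mem_conjSubalgebra.1 b.2
    change β b ∈ B
    have : β b = c := by
      rw [hβ, ← hb, mul_assoc, mul_assoc, mul_assoc, hx1, mul_one, ← mul_assoc, hx1, one_mul]
    rwa [this]
  have hw : ∀ b : conjSubalgebra B x, (b : X) = (x : X) * β b * star (x : X) := by
    intro b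
    rw [hβ, mul_assoc, mul_assoc, mul_assoc, hx2, mul_one, ← mul_assoc, hx2, one_mul]
  have hr : ∀ b, F.φ (β b) = (F.restrict (conjSubalgebra B x)).φ b := by
    intro b
    rw [hβ, F.map_mul_comm, ← mul_assoc, hx2, one_mul]
    rfl
  have hl : ∀ a, F.φ (A.subtype a) = (F.restrict A).φ a := fun a => rfl
  have hAB : A.subtype.range ⊔ β.range ≤ A ⊔ B := sup_le_sup hA hB
  have h : IsTFreeProduct t (F.restrict A) (F.restrict (conjSubalgebra B x)) F A.subtype β
      (x : X) :=
    ⟨hl, hr, hind.mono_pair hA hB, hx, hfree.mono_pair hAB le_rfl⟩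
  have hword : ∀ l : List (A ⊕ conjSubalgebra B x),
      F.φ (l.map (Sum.elim (fun a : A => (a : X)) (fun b : conjSubalgebra B x => (b : X)))).prod =
        F.φ (l.map (Sum.elim (fun a : A => A.subtype a)
          (fun b : conjSubalgebra B x => (x : X) * β b * star (x : X)))).prod := by
    intro l
    rw [funext hw]
    rfl
  exact ⟨X, _, _, _, _, F, A.subtype, β, x, h, hword⟩

end

end Expectation

/-! ### Alternating moments in the absence of cancellations -/

section

variable {Q : Type v} [Group Q] [DecidableEq Q]

/-- All products of consecutive elements of `g :: cs` are nontrivial, where the last element is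
understood to be multiplied by `d`. -/
def NonvanishingIntervals (d : Q) : Q → List Q → Bool
  | g, [] => g * d ≠ 1
  | g, c :: cs => g ≠ 1 && NonvanishingIntervals d (g * c) cs && NonvanishingIntervals d c cs

/-- All products of consecutive elements of `g :: cs`, except possibly the full product, are
nontrivial, where the last element is understood to be multiplied by `d`. -/
def NonvanishingProperIntervals (d : Q) : Q → List Q → Bool
  | _, [] => true
  | g, c :: cs => g ≠ 1 && NonvanishingProperIntervals d (g * c) cs && NonvanishingIntervals d c cs

/-- All products of cyclically consecutive elements of `p :: cs`, except possibly the full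
product, are nontrivial, where the gap before `p` is not taken into account. -/
def NonvanishingCyclicIntervals : Q → List Q → Bool
  | _, [] => true
  | p, c :: cs => NonvanishingCyclicIntervals (p * c) cs && NonvanishingProperIntervals p c cs

namespace Expectation

variable {X : Type u} [Ring X] [StarRing X] [Algebra ℂ X] [StarModule ℂ X]
  {F : Expectation X} {A V : StarSubalgebra ℂ X} {e : Q →* X} {r : ℂ}

theorem IsCenteredChain.append_pair {K : List (Fin 2 × X)} (hK : F.IsCenteredChain ![A, V] K)
    (hlast : ∀ p ∈ K.getLast?, p.1 = 1) {a v : X} (ha : a ∈ A) (ha0 : F.φ a = 0) (hv : v ∈ V)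
    (hv0 : F.φ v = 0) : F.IsCenteredChain ![A, V] (K ++ [(0, a), (1, v)]) := by
  refine ⟨List.isChain_append.2 ⟨hK.1, by simp, ?_⟩, ?_⟩
  · intro p hp q hq
    rw [hlast p hp]
    simp only [List.head?_cons, Option.mem_some_iff] at hq
    rw [← hq]
    exact one_ne_zero
  · intro p hp
    rcases List.mem_append.1 hp with hp | hp
    · exact hK.2 p hp
    · simp only [List.mem_cons, List.not_mem_nil, or_false] at hp
      rcases hp with rfl | rfl
      · exact ⟨ha, ha0⟩
      · exact ⟨hv, hv0⟩

/-- The splitting `v = r + (v - r)` of one factor. A scalar lets the neighbouring group elements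
merge; a centered factor separates them. -/
theorem map_mul_gap (c : X) (v : X) (y z : X) (r : ℂ) :
    F.φ (y * (c * (v * z))) = r * F.φ (y * (c * z)) +
      F.φ (y * (c * ((v - algebraMap ℂ X r) * z))) := by
  rw [sub_mul, mul_sub, mul_sub, map_sub, ← Algebra.smul_def, mul_smul_comm, mul_smul_comm,
    map_smul, smul_eq_mul]
  ring

/-- `K` is the part already resolved into a centered chain and `g` the group element being
accumulated after it. Each factor is split into its expectation, which multiplies `g` by the next
element, and its centered part, which closes `g`. Every accumulated product is nontrivial, hence
centered, and freeness kills each resulting term. -/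
theorem map_eq_zero_of_nonvanishingIntervals (hfree : F.Free ![A, V]) (heA : ∀ g, e g ∈ A)
    (he : ∀ g, F.φ (e g) = if g = 1 then 1 else 0) (d : Q) (l : List (X × Q))
    (hl : ∀ p ∈ l, p.1 ∈ V ∧ F.φ p.1 = r) (g : Q) (K : List (Fin 2 × X))
    (hK : F.IsCenteredChain ![A, V] K) (hlast : ∀ p ∈ K.getLast?, p.1 = 1)
    (hgood : NonvanishingIntervals d g (l.map Prod.snd)) :
    F.φ ((K.map Prod.snd).prod * (e g * ((l.map fun p => p.1 * e p.2).prod * e d))) = 0 := by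
  induction l generalizing g K with
  | nil =>
    have hgd : g * d ≠ 1 := by simpa [NonvanishingIntervals] using hgood
    have hchain : F.IsCenteredChain ![A, V] (K ++ [(0, e (g * d))]) := by
      refine ⟨List.isChain_append.2 ⟨hK.1, by simp, ?_⟩, ?_⟩
      · intro p hp q hq
        rw [hlast p hp]
        simp only [List.head?_cons, Option.mem_some_iff] at hq
        rw [← hq]
        exact one_ne_zero
      · intro p hp
        rcases List.mem_append.1 hp with hp | hp
        · exact hK.2 p hp
        · rw [List.mem_singleton] at hp
          subst hp
          exact ⟨heA _, by rw [he, if_neg hgd]⟩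
    have := hfree _ (by simp) hchain.1 hchain.2
    simpa using this
  | cons p l ih =>
    simp only [List.map_cons, NonvanishingIntervals, Bool.and_eq_true, decide_eq_true_eq] at hgood
    obtain ⟨⟨hg, h1⟩, h2⟩ := hgood
    obtain ⟨hpV, hpr⟩ := hl p List.mem_cons_self
    have hl' := fun q hq => hl q (List.mem_cons_of_mem _ hq)
    rw [List.map_cons, List.prod_cons, mul_assoc, mul_assoc, map_mul_gap _ _ _ _ r]
    have e1 := ih hl' (g * p.2) K hK hlast h1
    have e2 := ih hl' p.2 (K ++ [(0, e g), (1, p.1 - algebraMap ℂ X r)])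
      (hK.append_pair hlast (heA g) (by rw [he, if_neg hg])
        (sub_mem hpV (algebraMap_mem _ _)) (by rw [← hpr, map_sub_algebraMap])) (by simp) h2
    rw [map_mul e, mul_assoc] at e1
    rw [e1, mul_zero, zero_add, ← e2]
    simp [mul_assoc]

/-- The case in which the first factor is already centered. If all the other factors contribute
scalars, the full product of group elements may be trivial, but then the term is a multiple of `φ(v)
= 0`. This is why only proper intervals have to be controlled. -/
theorem map_eq_zero_of_nonvanishingProperIntervals (hfree : F.Free ![A, V]) (heA : ∀ g, e g ∈ A)
    (he : ∀ g, F.φ (e g) = if g = 1 then 1 else 0) (d : Q) (l : List (X × Q))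
    (hl : ∀ p ∈ l, p.1 ∈ V ∧ F.φ p.1 = r) (g : Q) {v : X} (hv : v ∈ V) (hv0 : F.φ v = 0)
    (hgood : NonvanishingProperIntervals d g (l.map Prod.snd)) :
    F.φ (v * (e g * ((l.map fun p => p.1 * e p.2).prod * e d))) = 0 := by
  have hv1 : F.IsCenteredChain ![A, V] [(1, v)] :=
    ⟨List.isChain_singleton _, by
      intro p hp
      rw [List.mem_singleton] at hp
      subst hp
      exact ⟨hv, hv0⟩⟩
  induction l generalizing g with
  | nil =>
    by_cases hgd : g * d = 1
    · simp [← map_mul e, hgd, hv0]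
    · simpa using map_eq_zero_of_nonvanishingIntervals (r := r) hfree heA he d [] (by simp) g
        [(1, v)] hv1 (by simp) (by simpa [NonvanishingIntervals] using hgd)
  | cons p l ih =>
    simp only [List.map_cons, NonvanishingProperIntervals, Bool.and_eq_true,
      decide_eq_true_eq] at hgood
    obtain ⟨⟨hg, h1⟩, h2⟩ := hgood
    obtain ⟨hpV, hpr⟩ := hl p List.mem_cons_self
    have hl' := fun q hq => hl q (List.mem_cons_of_mem _ hq)
    rw [List.map_cons, List.prod_cons, mul_assoc, mul_assoc, map_mul_gap _ _ _ _ r]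
    have e1 := ih hl' (g * p.2) h1
    have e2 := map_eq_zero_of_nonvanishingIntervals hfree heA he d l hl' p.2
      ([(1, v)] ++ [(0, e g), (1, p.1 - algebraMap ℂ X r)])
      (hv1.append_pair (by simp) (heA g) (by rw [he, if_neg hg])
        (sub_mem hpV (algebraMap_mem _ _)) (by rw [← hpr, map_sub_algebraMap])) (by simp) h2
    rw [map_mul e, mul_assoc] at e1
    rw [e1, mul_zero, zero_add, ← e2]
    simp [mul_assoc]

/-- The expectation of an alternating product of group elements and of elements of a free
subalgebra, in the absence of nontrivial cancellations. -/
theorem map_alternating (hfree : F.Free ![A, V]) (heA : ∀ g, e g ∈ A)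
    (he : ∀ g, F.φ (e g) = if g = 1 then 1 else 0) (l : List (X × Q))
    (hl : ∀ p ∈ l, p.1 ∈ V ∧ F.φ p.1 = r) (g : Q)
    (hgood : NonvanishingCyclicIntervals g (l.map Prod.snd)) :
    F.φ (e g * (l.map fun p => p.1 * e p.2).prod) =
      if g * (l.map Prod.snd).prod = 1 then r ^ l.length else 0 := by
  induction l generalizing g with
  | nil => simp [he]
  | cons p l ih =>
    simp only [List.map_cons, NonvanishingCyclicIntervals, Bool.and_eq_true] at hgood
    obtain ⟨hpV, hpr⟩ := hl p List.mem_cons_self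
    have hl' := fun q hq => hl q (List.mem_cons_of_mem _ hq)
    have e1 := ih hl' (g * p.2) hgood.1
    have e2 := map_eq_zero_of_nonvanishingProperIntervals hfree heA he g l hl' p.2
      (v := p.1 - algebraMap ℂ X r) (sub_mem hpV (algebraMap_mem _ _)) (by rw [← hpr, map_sub_algebraMap]) hgood.2
    have h := map_mul_gap (F := F) (e g) p.1 1 (e p.2 * (l.map fun p => p.1 * e p.2).prod) r
    rw [one_mul, one_mul, one_mul] at h
    rw [List.map_cons, List.prod_cons, mul_assoc, h, ← mul_assoc (e g), ← map_mul e, e1,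
      F.map_mul_comm (e g)]
    have : F.φ ((p.1 - algebraMap ℂ X r) * (e p.2 * (l.map fun p => p.1 * e p.2).prod) * e g)
        = 0 := by
      rw [← e2]
      simp only [mul_assoc]
    rw [this, add_zero, List.map_cons, List.prod_cons, List.length_cons, ← mul_assoc]
    split_ifs
    · rw [pow_succ']
    · rw [mul_zero]

end Expectation

end

/-! ### Computation of moments of words in two cyclic groups -/

/-- A letter of one of the two factors of the free product of two cyclic groups of order `60`,
the second factor being indicated by `true`. -/
abbrev Letter := Bool × ZMod 60

/-- The abelianization of the free product of two cyclic groups of order `60`. -/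
abbrev LetterGroup := Multiplicative (ZMod 60 × ZMod 60)

namespace Letter

/-- The class of a letter in the abelianized group. -/
def toGroup (c : Letter) : LetterGroup :=
  Multiplicative.ofAdd (if c.1 then (0, c.2) else (c.2, 0))

/-- Multiplication of a reduced word by a letter. -/
def push (c : Letter) : List Letter → List Letter
  | [] => if c.2 = 0 then [] else [c]
  | d :: l =>
    if c.2 = 0 then d :: l
    else if c.1 = d.1 then (if c.2 + d.2 = 0 then l else (c.1, c.2 + d.2) :: l)
    else c :: d :: l

/-- Reduction of a word. -/
def reduce (l : List Letter) : List Letter := l.foldr push []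

/-- The word `a₁ b₁ ⋯ a_k b_k`. -/
def ofPairs (l : List (ZMod 60 × ZMod 60)) : List Letter :=
  l.flatMap fun p => [(false, p.1), (true, p.2)]

/-- A left inverse of `ofPairs`. -/
def toPairs : List Letter → List (ZMod 60 × ZMod 60)
  | c :: d :: l => (c.2, d.2) :: toPairs l
  | _ => []

/-- The expectation of a word, computed within a given number of cyclic reductions. The result is
`some (some k)` for an expectation equal to the `k`-th power of the parameter, `some none` for a
vanishing expectation, and `none` if nontrivial cancellations prevent the computation. -/
def wordValue : ℕ → List Letter → Option (Option ℕ)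
  | 0, _ => none
  | n + 1, l =>
    match reduce l with
    | [] => some (some 0)
    | [c] => if c.2 = 0 then none else some none
    | c :: d :: r =>
      if ofPairs (toPairs (c :: d :: r)) = c :: d :: r then
        if NonvanishingCyclicIntervals 1 ((c :: d :: r).map toGroup) then
          some (if ((c :: d :: r).map toGroup).prod = 1 then some (toPairs (c :: d :: r)).length
            else none)
        else none
      -- A reduced word that starts in the second factor or has odd length is rotated by traciality,
      -- and may then reduce further.
      else wordValue n (d :: r ++ [c])

/-- The product of two computed expectations. -/
def mulValue : Option (Option ℕ) → Option (Option ℕ) → Option (Option ℕ)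
  | some (some i), some (some j) => some (some (i + j))
  | some _, some _ => some none
  | _, _ => none

/-- The product of the expectations of several words. -/
def wordsValue (P : List (List Letter)) : Option (Option ℕ) :=
  -- The bound `10` is fuel: were it too small, the value would be `none` and no moment would be
  -- asserted.
  P.foldr (fun l v => mulValue (wordValue 10 l) v) (some (some 0))

/-- Addition of a monomial to a polynomial given by the list of its coefficients. -/
def addMonomial : ℕ → List ℕ → List ℕ
  | 0, [] => [1]
  | 0, a :: p => (a + 1) :: p
  | k + 1, [] => 0 :: addMonomial k []
  | k + 1, a :: p => a :: addMonomial k p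

/-- Addition of computed expectations. -/
def addValue : Option (Option ℕ) → Option (List ℕ) → Option (List ℕ)
  | some none, some p => some p
  | some (some k), some p => some (addMonomial k p)
  | _, _ => none

/-- The sum over a list of families of words of the products of their expectations. -/
def sumValue (W : List (List (List Letter))) : Option (List ℕ) :=
  W.foldr (fun P v => addValue (wordsValue P) v) (some [])

/-- The value of a computed expectation. -/
def evalValue (q : ℂ) : Option ℕ → ℂ
  | none => 0
  | some k => q ^ k

/-- The value of a polynomial given by the list of its coefficients. -/
def evalPoly (q : ℂ) (p : List ℕ) : ℂ := p.foldr (fun (a : ℕ) z => (a : ℂ) + q * z) 0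

theorem evalPoly_addMonomial (q : ℂ) (k : ℕ) (p : List ℕ) :
    evalPoly q (addMonomial k p) = q ^ k + evalPoly q p := by
  induction k generalizing p with
  | zero =>
    cases p with
    | nil => simp [addMonomial, evalPoly]
    | cons a p =>
      simp only [addMonomial, evalPoly, List.foldr_cons, pow_zero]
      push_cast
      ring
  | succ k ih =>
    cases p with
    | nil =>
      have := ih []
      simp only [evalPoly, List.foldr_nil] at this
      simp only [addMonomial, evalPoly, List.foldr_cons, List.foldr_nil, this]
      push_cast
      ring
    | cons a p =>
      have := ih p
      simp only [evalPoly] at this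
      simp only [addMonomial, evalPoly, List.foldr_cons, this]
      ring

theorem mulValue_eq_some {v w : Option (Option ℕ)} {z : Option ℕ} (h : mulValue v w = some z)
    (q : ℂ) :
    ∃ v' w', v = some v' ∧ w = some w' ∧ evalValue q z = evalValue q v' * evalValue q w' := by
  rcases v with _ | _ | i <;> rcases w with _ | _ | j <;>
    simp only [mulValue, reduceCtorEq, Option.some.injEq] at h <;> subst h <;>
    exact ⟨_, _, rfl, rfl, by simp [evalValue, pow_add]⟩

theorem addValue_eq_some {v : Option (Option ℕ)} {w : Option (List ℕ)} {p : List ℕ}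
    (h : addValue v w = some p) (q : ℂ) :
    ∃ v' p', v = some v' ∧ w = some p' ∧ evalPoly q p = evalValue q v' + evalPoly q p' := by
  rcases v with _ | _ | i <;> rcases w with _ | p' <;>
    simp only [addValue, reduceCtorEq, Option.some.injEq] at h <;> subst h
  · exact ⟨_, _, rfl, rfl, by simp [evalValue]⟩
  · exact ⟨_, _, rfl, rfl, by simp [evalValue, evalPoly_addMonomial]⟩

section

variable {X : Type u} [Ring X] [StarRing X]

/-- The element of the model represented by a letter. -/
def toElement (e : LetterGroup →* X) (x : unitary X) (c : Letter) : X :=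
  if c.1 then x * e c.toGroup * star (x : X) else e c.toGroup

variable {e : LetterGroup →* X} {x : unitary X}

theorem toGroup_mul (b : Bool) (g h : ZMod 60) :
    toGroup (b, g) * toGroup (b, h) = toGroup (b, g + h) := by
  cases b <;> simp [toGroup, ← ofAdd_add]

theorem toGroup_eq_one {c : Letter} : c.toGroup = 1 ↔ c.2 = 0 := by
  obtain ⟨b, g⟩ := c
  cases b <;> simp [toGroup, ← ofAdd_zero, Prod.ext_iff]

theorem toElement_of_eq_zero {c : Letter} (hc : c.2 = 0) : toElement e x c = 1 := by
  rw [toElement, toGroup_eq_one.2 hc, map_one, mul_one]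
  split_ifs
  · exact Unitary.mul_star_self_of_mem x.2
  · rfl

theorem toElement_mul (b : Bool) (g h : ZMod 60) :
    toElement e x (b, g) * toElement e x (b, h) = toElement e x (b, g + h) := by
  simp only [toElement]
  rw [← toGroup_mul, map_mul]
  split_ifs
  · have hx : star (x : X) * x = 1 := Unitary.star_mul_self_of_mem x.2
    simp only [mul_assoc]
    rw [← mul_assoc (star (x : X)) (x : X), hx, one_mul]
  · rfl

theorem toElement_mul_neg (b : Bool) (g : ZMod 60) :
    toElement e x (b, g) * toElement e x (b, -g) = 1 := by
  rw [toElement_mul, add_neg_cancel, toElement_of_eq_zero rfl]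

theorem prod_push (c : Letter) (l : List Letter) :
    ((push c l).map (toElement e x)).prod = toElement e x c * (l.map (toElement e x)).prod := by
  cases l with
  | nil =>
    rw [push]
    split_ifs with h
    · rw [toElement_of_eq_zero h, one_mul]
    · simp
  | cons d l =>
    rw [push]
    split_ifs with h h' h''
    · rw [toElement_of_eq_zero h, one_mul]
    · obtain ⟨b, g⟩ := c
      obtain ⟨b', g'⟩ := d
      obtain rfl : b = b' := h'
      rw [List.map_cons, List.prod_cons, ← mul_assoc, toElement_mul, toElement_of_eq_zero h'',
        one_mul]
    · obtain ⟨b, g⟩ := c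
      obtain ⟨b', g'⟩ := d
      obtain rfl : b = b' := h'
      rw [List.map_cons, List.prod_cons, List.map_cons, List.prod_cons, ← mul_assoc, toElement_mul]
    · simp

theorem prod_reduce (l : List Letter) :
    ((reduce l).map (toElement e x)).prod = (l.map (toElement e x)).prod := by
  induction l with
  | nil => rfl
  | cons c l ih =>
    have : reduce (c :: l) = push c (reduce l) := rfl
    rw [this, prod_push, ih, List.map_cons, List.prod_cons]

/-- The alternating word of a list of pairs. -/
def gapPairs (x : unitary X) (l : List (ZMod 60 × ZMod 60)) : List (X × LetterGroup) :=
  l.flatMap fun p => [(star (x : X), toGroup (false, p.1)), ((x : X), toGroup (true, p.2))]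

/-- Each pair contributes `e(a) x e(b) x*`; moving one `x*` from the end to the front makes group
elements alternate with `x*` and `x`. -/
theorem star_mul_prod_ofPairs (l : List (ZMod 60 × ZMod 60)) :
    star (x : X) * ((ofPairs l).map (toElement e x)).prod =
      ((gapPairs x l).map fun p => p.1 * e p.2).prod * star (x : X) := by
  induction l with
  | nil => simp [ofPairs, gapPairs]
  | cons p l ih =>
    have h1 : ofPairs (p :: l) = (false, p.1) :: (true, p.2) :: ofPairs l := rfl
    have h2 : gapPairs x (p :: l) = (star (x : X), toGroup (false, p.1)) ::
      ((x : X), toGroup (true, p.2)) :: gapPairs x l := rfl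
    rw [h1, h2]
    simp only [List.map_cons, List.prod_cons, mul_assoc, ← ih]
    simp only [toElement, if_true, Bool.false_eq_true, if_false, mul_assoc]

theorem map_snd_gapPairs (l : List (ZMod 60 × ZMod 60)) :
    (gapPairs x l).map Prod.snd = (ofPairs l).map toGroup := by
  simp [gapPairs, ofPairs, List.map_flatMap]

theorem length_gapPairs (l : List (ZMod 60 × ZMod 60)) :
    (gapPairs x l).length = 2 * l.length := by
  simp [gapPairs, mul_comm]

variable [Algebra ℂ X] [StarModule ℂ X] {F : Expectation X} {A : StarSubalgebra ℂ X} {r : ℂ}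

/-- The group `LetterGroup` is represented, with its canonical trace, in a subalgebra `A` which is
free from a unitary element `x` of expectation `r`. -/
structure IsModel (F : Expectation X) (A : StarSubalgebra ℂ X) (e : LetterGroup →* X)
    (x : unitary X) (r : ℂ) : Prop where
  free : F.Free ![A, StarAlgebra.adjoin ℂ {(x : X)}]
  mem : ∀ g, e g ∈ A
  map_group : ∀ g, F.φ (e g) = if g = 1 then 1 else 0
  map_unitary : F.φ x = r
  map_star_unitary : F.φ (star (x : X)) = r

/-- The expectation of a word without nontrivial cancellations. -/
theorem IsModel.map_ofPairs (H : IsModel F A e x r) (l : List (ZMod 60 × ZMod 60))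
    (hl : NonvanishingCyclicIntervals 1 ((ofPairs l).map toGroup)) :
    F.φ ((ofPairs l).map (toElement e x)).prod =
      if ((ofPairs l).map toGroup).prod = 1 then (r ^ 2) ^ l.length else 0 := by
  have hx1 : star (x : X) * x = 1 := Unitary.star_mul_self_of_mem x.2
  have hx2 : (x : X) * star (x : X) = 1 := Unitary.mul_star_self_of_mem x.2
  have hxV : (x : X) ∈ StarAlgebra.adjoin ℂ {(x : X)} :=
    StarAlgebra.subset_adjoin ℂ _ (Set.mem_singleton _)
  have h := Expectation.map_alternating (r := r) H.free H.mem H.map_group (gapPairs x l) (by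
    intro p hp
    simp only [gapPairs, List.mem_flatMap, List.mem_cons, List.not_mem_nil, or_false] at hp
    obtain ⟨_, _, rfl | rfl⟩ := hp
    · exact ⟨star_mem hxV, H.map_star_unitary⟩
    · exact ⟨hxV, H.map_unitary⟩) 1 (by rwa [map_snd_gapPairs])
  rw [map_snd_gapPairs, length_gapPairs, one_mul, map_one, one_mul, pow_mul] at h
  rw [← h]
  calc F.φ ((ofPairs l).map (toElement e x)).prod
      = F.φ (x * (star (x : X) * ((ofPairs l).map (toElement e x)).prod)) := by
        rw [← mul_assoc, hx2, one_mul]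
    _ = F.φ (((gapPairs x l).map fun p => p.1 * e p.2).prod) := by
        rw [star_mul_prod_ofPairs, F.map_mul_comm, mul_assoc, hx1, mul_one]

theorem IsModel.map_toElement (H : IsModel F A e x r) {c : Letter} (hc : c.2 ≠ 0) :
    F.φ (toElement e x c) = 0 := by
  have h : F.φ (e c.toGroup) = 0 := by rw [H.map_group, if_neg (mt toGroup_eq_one.1 hc)]
  rw [toElement]
  split_ifs
  · rw [F.map_conj_unitary x.2, h]
  · exact h

theorem IsModel.map_eq_of_wordValue (H : IsModel F A e x r) {n : ℕ} {l : List Letter}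
    {v : Option ℕ} (h : wordValue n l = some v) :
    F.φ (l.map (toElement e x)).prod = evalValue (r ^ 2) v := by
  induction n generalizing l with
  | zero => simp [wordValue] at h
  | succ n ih =>
    rw [← prod_reduce]
    rw [wordValue] at h
    split at h
    case h_1 hl =>
      obtain rfl := Option.some.inj h
      simp [hl, evalValue, F.map_one]
    case h_2 c hl =>
      split_ifs at h with hc
      obtain rfl := Option.some.inj h
      simpa [hl, evalValue] using H.map_toElement hc
    case h_3 c d s hl =>
      rw [hl]
      split_ifs at h with h1 h2 h3
      · obtain rfl := Option.some.inj h
        have := H.map_ofPairs (toPairs (c :: d :: s)) (by rwa [h1])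
        rw [h1, if_pos h3] at this
        exact this
      · obtain rfl := Option.some.inj h
        have := H.map_ofPairs (toPairs (c :: d :: s)) (by rwa [h1])
        rw [h1, if_neg h3] at this
        exact this
      · rw [← ih h, List.map_append, List.prod_append, List.map_singleton, List.prod_singleton,
          F.map_mul_comm, List.map_cons (l := d :: s), List.prod_cons]

theorem IsModel.map_eq_of_wordsValue (H : IsModel F A e x r) {P : List (List Letter)}
    {v : Option ℕ} (h : wordsValue P = some v) :
    (P.map fun l => F.φ (l.map (toElement e x)).prod).prod = evalValue (r ^ 2) v := by
  induction P generalizing v with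
  | nil =>
    obtain rfl : some 0 = v := Option.some.inj h
    simp [evalValue]
  | cons l P ih =>
    obtain ⟨v1, v2, h1, h2, h3⟩ := mulValue_eq_some (v := wordValue 10 l) (w := wordsValue P) h
      (r ^ 2)
    rw [List.map_cons, List.prod_cons, ih h2, H.map_eq_of_wordValue h1, h3]

theorem IsModel.map_eq_of_sumValue (H : IsModel F A e x r) {W : List (List (List Letter))}
    {p : List ℕ} (h : sumValue W = some p) :
    (W.map fun P => (P.map fun l => F.φ (l.map (toElement e x)).prod).prod).sum =
      evalPoly (r ^ 2) p := by
  induction W generalizing p with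
  | nil =>
    obtain rfl : [] = p := Option.some.inj h
    rfl
  | cons P W ih =>
    obtain ⟨v1, v2, h1, h2, h3⟩ := addValue_eq_some (v := wordsValue P) (w := sumValue W) h
      (r ^ 2)
    rw [List.map_cons, List.sum_cons, ih h2, H.map_eq_of_wordsValue h1, h3]

end

end Letter

/-! ### Sums of permutation forms over rearrangements -/

/-- The words of given length in a list of letters. -/
def List.wordsOfLength {α : Type*} (s : List α) : ℕ → List (List α)
  | 0 => [[]]
  | n + 1 => s.flatMap fun a => (s.wordsOfLength n).map (a :: ·)

theorem List.mem_wordsOfLength {α : Type*} {s : List α} {n : ℕ} {l : List α} :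
    l ∈ s.wordsOfLength n ↔ l.length = n ∧ ∀ a ∈ l, a ∈ s := by
  induction n generalizing l with
  | zero => cases l <;> simp [wordsOfLength]
  | succ n ih =>
    cases l with
    | nil => simp [wordsOfLength]
    | cons a l =>
      simp only [wordsOfLength, mem_flatMap, mem_map, cons.injEq, length_cons, mem_cons,
        forall_eq_or_imp, Nat.add_right_cancel_iff]
      constructor
      · rintro ⟨b, hb, l', hl', rfl, rfl⟩
        exact ⟨(ih.1 hl').1, hb, (ih.1 hl').2⟩
      · rintro ⟨h1, h2, h3⟩
        exact ⟨a, h2, l, ih.2 ⟨h1, h3⟩, rfl, rfl⟩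

theorem List.nodup_wordsOfLength {α : Type*} {s : List α} (hs : s.Nodup) (n : ℕ) :
    (s.wordsOfLength n).Nodup := by
  induction n with
  | zero => simp [wordsOfLength]
  | succ n ih =>
    refine nodup_flatMap.2 ⟨fun a _ => ih.map fun l l' h => (cons.inj h).2, ?_⟩
    refine hs.imp fun {a b} hab l h h' => ?_
    obtain ⟨k, -, rfl⟩ := mem_map.1 h
    obtain ⟨k', -, h2⟩ := mem_map.1 h'
    exact hab (cons.inj h2).1.symm

/-- The distinct rearrangements of a list. -/
def List.rearrangements {α : Type*} [DecidableEq α] (s : List α) : List (List α) :=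
  (s.dedup.wordsOfLength s.length).filter fun l => l.isPerm s

theorem List.mem_rearrangements {α : Type*} [DecidableEq α] {s l : List α} :
    l ∈ s.rearrangements ↔ l.Perm s := by
  rw [rearrangements, mem_filter, mem_wordsOfLength, isPerm_iff]
  exact ⟨fun h => h.2, fun h => ⟨⟨h.length_eq, fun a ha => mem_dedup.2 (h.subset ha)⟩, h⟩⟩

theorem List.nodup_rearrangements {α : Type*} [DecidableEq α] (s : List α) :
    s.rearrangements.Nodup :=
  (nodup_wordsOfLength (nodup_dedup s) _).filter _

theorem List.sum_perm_ofFn {α : Type*} [Fintype α] [DecidableEq α] (d : α) {n : ℕ} {s : List α}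
    (hs : s.length = n) (g : (Fin n → α) → ℂ) :
    ∑ f : Fin n → α with (List.ofFn f).Perm s, g f =
      (s.rearrangements.map fun l => g fun i => l.getD i d).sum := by
  rw [← List.sum_toFinset _ (nodup_rearrangements s)]
  have hlen : ∀ l : List α, l.Perm s → (List.ofFn fun i : Fin n => l.getD i d) = l := by
    intro l hl
    have hl' : l.length = n := hl.length_eq.trans hs
    refine List.ext_getElem (by simp [hl']) fun k h1 h2 => ?_
    rw [List.getElem_ofFn, List.getD_eq_getElem _ _ h2]
  have hfn : ∀ f : Fin n → α, (fun i : Fin n => (List.ofFn f).getD i d) = f := by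
    intro f
    funext i
    rw [List.getD_eq_getElem _ _ (by simp)]
    simp
  refine Finset.sum_nbij' (fun f => List.ofFn f) (fun l i => l.getD i d) ?_ ?_ ?_ ?_ ?_
  · intro f hf
    rw [List.mem_toFinset, mem_rearrangements]
    exact (Finset.mem_filter.1 hf).2
  · intro l hl
    rw [List.mem_toFinset, mem_rearrangements] at hl
    rw [Finset.mem_filter, hlen l hl]
    exact ⟨Finset.mem_univ _, hl⟩
  · exact fun f _ => hfn f
  · intro l hl
    rw [List.mem_toFinset, mem_rearrangements] at hl
    exact hlen l hl
  · intro f _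
    rw [hfn]

theorem Expectation.permForm_eq_zero_of_fixed {M : Type u} [Ring M] [StarRing M] [Algebra ℂ M]
    [StarModule ℂ M] (E : Expectation M) {n : ℕ} {σ : Perm (Fin n)} {i : Fin n} (hi : σ i = i)
    {m : Fin n → M} (hm : E.φ (m i) = 0) : E.permForm σ m = 0 := by
  rw [permForm]
  refine Finset.prod_eq_zero (i := i) (Finset.mem_filter.2 ⟨Finset.mem_univ _, fun j hj => ?_⟩) ?_
  · rw [hj.eq_of_left hi]
  · have h1 : minimalPeriod σ i = 1 := minimalPeriod_eq_one_iff_isFixedPt.2 hi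
    have h2 : (List.ofFn fun k : Fin (minimalPeriod σ i) => m ((σ ^ (k : ℕ)) i)) = [m i] := by
      rw [List.ofFn_congr h1, List.ofFn_succ]
      simp
    rw [h2, List.prod_singleton, hm]

namespace Letter

section

variable {X : Type u} [Ring X] [StarRing X] [Algebra ℂ X] [StarModule ℂ X]
  {F : Expectation X} {A : StarSubalgebra ℂ X} {e : LetterGroup →* X} {x : unitary X} {r : ℂ}

/-- The sum of `φ_σ` over the rearrangements of a word. -/
noncomputable def orbitSum (F : Expectation X) (e : LetterGroup →* X) (x : unitary X)
    (s : List Letter) {n : ℕ} (σ : Perm (Fin n)) : ℂ :=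
  ∑ f : Fin n → Letter with (List.ofFn f).Perm s, F.permForm σ (toElement e x ∘ f)

/-- Conjugating the permutation amounts to permuting the letters, and the set of rearrangements is
stable under this. Hence only the class sums of `c` enter the final equations. -/
theorem orbitSum_eq_of_isConj {s : List Letter} {n : ℕ} {σ τ : Perm (Fin n)} (h : IsConj σ τ) :
    orbitSum F e x s σ = orbitSum F e x s τ := by
  obtain ⟨ρ, rfl⟩ := isConj_iff.1 h
  simp only [orbitSum, Expectation.permForm_conj]
  refine (Finset.sum_equiv (ρ⁻¹.arrowCongr (Equiv.refl Letter)) (fun f => ?_) fun f _ => ?_).symm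
  · have := (Equiv.Perm.ofFn_comp_perm ρ f)
    simp only [Finset.mem_filter, Finset.mem_univ, true_and]
    exact ⟨fun h => this.trans h, fun h => this.symm.trans h⟩
  · rfl

theorem IsModel.orbitSum_eq_zero (H : IsModel F A e x r) {s : List Letter} (hs : ∀ c ∈ s, c.2 ≠ 0)
    {n : ℕ} {σ : Perm (Fin n)} {i : Fin n} (hi : σ i = i) : orbitSum F e x s σ = 0 := by
  refine Finset.sum_eq_zero fun f hf => F.permForm_eq_zero_of_fixed hi (H.map_toElement (hs _ ?_))
  exact (Finset.mem_filter.1 hf).2.subset ((List.mem_ofFn).2 ⟨i, rfl⟩)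

/-- The families of words in the cycles `P` obtained from the rearrangements of a word. -/
def cycleWords {n : ℕ} (P : List (List (Fin n))) (s : List Letter) : List (List (List Letter)) :=
  s.rearrangements.map fun l => P.map fun L => L.map fun i : Fin n => l.getD i (false, 0)

theorem IsModel.orbitSum_eq (H : IsModel F A e x r) {n : ℕ} {P : List (List (Fin n))}
    (hne : ∀ L ∈ P, L ≠ []) (hnd : P.flatten.Nodup) (hmem : ∀ i, i ∈ P.flatten) {σ : Perm (Fin n)}
    (hσ : ∀ L ∈ P, ∀ k (hk : k < L.length),
      σ L[k] = L[(k + 1) % L.length]'(Nat.mod_lt _ (by omega)))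
    {s : List Letter} (hs : s.length = n) {p : List ℕ} (hp : sumValue (cycleWords P s) = some p) :
    orbitSum F e x s σ = evalPoly (r ^ 2) p := by
  rw [← H.map_eq_of_sumValue hp, cycleWords, List.map_map, orbitSum,
    List.sum_perm_ofFn (false, 0) hs]
  congr 1
  refine List.map_congr_left fun l _ => ?_
  rw [permForm_eq_prod_of_lists hne hnd hmem hσ]
  simp only [Function.comp_def, List.map_map]

end

end Letter

/-! ### Order `7`: the model and the four equations -/

theorem Multiset.eq_of_sum_eq_seven {s : Multiset ℕ} (h2 : ∀ a ∈ s, 2 ≤ a) (hs : s.sum = 7) :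
    s = {7} ∨ s = {5, 2} ∨ s = {4, 3} ∨ s = {3, 2, 2} := by
  induction s using Quotient.inductionOn with
  | h l =>
    rw [quot_mk_to_coe] at *
    simp only [mem_coe] at h2
    rw [sum_coe] at hs
    match l, h2, hs with
    | [], _, hs => simp at hs
    | [a], _, hs =>
      obtain rfl : a = 7 := by simpa using hs
      exact Or.inl rfl
    | [a, b], h2, hs =>
      have ha := h2 a (by simp)
      have hb := h2 b (by simp)
      simp only [List.sum_cons, List.sum_nil] at hs
      obtain rfl : b = 7 - a := by omega
      have : a ≤ 5 := by omega
      interval_cases a <;> decide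
    | [a, b, c], h2, hs =>
      have ha := h2 a (by simp)
      have hb := h2 b (by simp)
      have hc := h2 c (by simp)
      simp only [List.sum_cons, List.sum_nil] at hs
      obtain rfl : c = 7 - a - b := by omega
      have : a ≤ 3 := by omega
      have : b ≤ 3 := by omega
      interval_cases a <;> interval_cases b <;> first | omega | decide
    | a :: b :: c :: d :: l, h2, hs =>
      have ha := h2 a (by simp)
      have hb := h2 b (by simp)
      have hc := h2 c (by simp)
      have hd := h2 d (by simp)
      simp only [List.sum_cons] at hs
      omega

theorem freeUnitaryBMMoment_one {t : ENNReal} (ht : t ≠ ⊤) :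
    freeUnitaryBMMoment t 1 = Real.exp (-t.toReal / 2) := by
  simp [freeUnitaryBMMoment, ht]

/-- The trace factorizes on group elements because a product `f a * g b` is trivial only trivially;
the general case is bilinear. This gives the independence of the two cyclic factors. -/
theorem MonoidAlgebra.trace_mapGroup_mul_mapGroup {G : Type u} {H : Type v} {K : Type w} [Group G]
    [Group H] [Group K] (f : G →* K) (g : H →* K) (hfg : ∀ a b, f a * g b = 1 → a = 1 ∧ b = 1)
    (y : MonoidAlgebra ℂ G) (z : MonoidAlgebra ℂ H) :
    (trace K).φ (mapGroup f y * mapGroup g z) = (trace G).φ y * (trace H).φ z := by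
  classical
  induction y using induction_linear with
  | zero => simp
  | add y y' hy hy' => rw [map_add, add_mul, map_add, hy, hy', map_add, add_mul]
  | single a r =>
    induction z using induction_linear with
    | zero => simp
    | add z z' hz hz' => rw [map_add, mul_add, map_add, hz, hz', map_add, mul_add]
    | single b s =>
      rw [mapGroup_single, mapGroup_single, single_mul_single, trace_single, trace_single,
        trace_single]
      by_cases h : f a * g b = 1
      · obtain ⟨rfl, rfl⟩ := hfg a b h
        simp
      · rw [if_neg h]
        by_cases ha : a = 1
        · rw [if_neg (c := b = 1), mul_zero]
          rintro rfl
          simp [ha] at h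
        · rw [if_neg ha, zero_mul]

namespace Letter

section

variable {X : Type u} [Ring X] [StarRing X] [Algebra ℂ X] [StarModule ℂ X]
  {F : Expectation X} {A : StarSubalgebra ℂ X} {e : LetterGroup →* X} {x : unitary X} {r : ℂ}

/-- This orthogonality shows that a nontrivial letter of one subalgebra does not belong to the
other, so that words in both kinds of letters are genuinely mixed. -/
theorem IsModel.map_pair (H : IsModel F A e x r) {a b : ZMod 60} (h : a ≠ 0 ∨ b ≠ 0) :
    F.φ (toElement e x (false, a) * toElement e x (true, b)) = 0 := by
  by_cases ha : a = 0
  · rw [toElement_of_eq_zero ha, one_mul]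
    exact H.map_toElement (h.resolve_left (not_not.2 ha))
  by_cases hb : b = 0
  · rw [toElement_of_eq_zero (c := (true, b)) hb, mul_one]
    exact H.map_toElement ha
  have ha' : toGroup (false, a) ≠ 1 := mt toGroup_eq_one.1 ha
  have hb' : toGroup (true, b) ≠ 1 := mt toGroup_eq_one.1 hb
  have := H.map_ofPairs [(a, b)] (by
    simp [ofPairs, NonvanishingCyclicIntervals, NonvanishingProperIntervals,
      NonvanishingIntervals, ha', hb'])
  rw [if_neg] at this
  · simpa [ofPairs] using this
  · intro h1
    refine ha ?_
    have h2 : toGroup (false, a) * toGroup (true, b) = 1 := by simpa [ofPairs] using h1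
    have h3 := congrArg (fun g : LetterGroup => (Multiplicative.toAdd g).1) h2
    simpa [toGroup] using h3

end

open MonoidAlgebra in
/-- Existence of a pair of `t`-free subalgebras containing the letters. -/
theorem exists_model {t : ENNReal} (ht : t ≠ ⊤) :
    ∃ (X : Type u) (_ : Ring X) (_ : StarRing X) (_ : Algebra ℂ X) (_ : StarModule ℂ X)
      (F : Expectation X) (A B C : StarSubalgebra ℂ X) (e : LetterGroup →* X) (x : unitary X),
      IsModel F C e x (Real.exp (-t.toReal / 2) : ℝ) ∧ F.TFree t A B ∧
      (∀ g, toElement e x (false, g) ∈ A) ∧ (∀ g, toElement e x (true, g) ∈ B) ∧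
      (∀ g, g ≠ 0 → toElement e x (true, g) ∉ A) ∧
      (∀ g, g ≠ 0 → toElement e x (false, g) ∉ B) := by
  obtain ⟨X, _, _, _, _, F, ι, x, hι, hx, hfree⟩ := exists_freeUnitaryBM (ULift.{u} LetterGroup) ht
  let e : LetterGroup →* X :=
    (ι : MonoidAlgebra ℂ (ULift.{u} LetterGroup) →* X).comp
      ((MonoidAlgebra.of ℂ (ULift.{u} LetterGroup)).comp MulEquiv.ulift.symm.toMonoidHom)
  have he : ∀ g, e g = ι (single (ULift.up g) 1) := fun g => rfl
  obtain ⟨f₁, hf₁⟩ : ∃ f : Multiplicative (ZMod 60) →* ULift.{u} LetterGroup,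
      ∀ g, f (Multiplicative.ofAdd g) = ULift.up (toGroup (false, g)) :=
    ⟨MulEquiv.ulift.symm.toMonoidHom.comp
      (AddMonoidHom.inl (ZMod 60) (ZMod 60)).toMultiplicative, fun g => rfl⟩
  obtain ⟨f₂, hf₂⟩ : ∃ f : Multiplicative (ZMod 60) →* ULift.{u} LetterGroup,
      ∀ g, f (Multiplicative.ofAdd g) = ULift.up (toGroup (true, g)) :=
    ⟨MulEquiv.ulift.symm.toMonoidHom.comp
      (AddMonoidHom.inr (ZMod 60) (ZMod 60)).toMultiplicative, fun g => rfl⟩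
  let y : unitary X := ⟨x, hx.1⟩
  have hA : ∀ z, ι (mapGroup f₁ z) ∈ (ι.comp (mapGroup f₁)).range := fun z => ⟨z, rfl⟩
  have hB : ∀ z, ι (mapGroup f₂ z) ∈ (ι.comp (mapGroup f₂)).range := fun z => ⟨z, rfl⟩
  have hle : (ι.comp (mapGroup f₁)).range ⊔ (ι.comp (mapGroup f₂)).range ≤ ι.range := by
    refine sup_le ?_ ?_
    · rintro _ ⟨z, rfl⟩
      exact ⟨mapGroup f₁ z, rfl⟩
    · rintro _ ⟨z, rfl⟩
      exact ⟨mapGroup f₂ z, rfl⟩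
  have hf : ∀ a b, f₁ a * f₂ b = 1 → a = 1 ∧ b = 1 := by
    intro a b h
    have h' : ULift.up (toGroup (false, a.toAdd)) * ULift.up (toGroup (true, b.toAdd)) =
        (1 : ULift.{u} LetterGroup) := by
      rw [← hf₁, ← hf₂]
      exact h
    have h'' : toGroup (false, a.toAdd) * toGroup (true, b.toAdd) = 1 := congrArg ULift.down h'
    have h1 := congrArg (fun g : LetterGroup => (Multiplicative.toAdd g).1) h''
    have h2 := congrArg (fun g : LetterGroup => (Multiplicative.toAdd g).2) h''
    exact ⟨by simpa [toGroup] using h1, by simpa [toGroup] using h2⟩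
  have hind : F.Independent ![(ι.comp (mapGroup f₁)).range, (ι.comp (mapGroup f₂)).range] := by
    refine Expectation.independent_pair ?_ ?_
    · rintro _ ⟨z, rfl⟩ _ ⟨z', rfl⟩
      change ι (mapGroup f₁ z) * ι (mapGroup f₂ z') = ι (mapGroup f₂ z') * ι (mapGroup f₁ z)
      rw [← map_mul ι, ← map_mul ι]
      congr 1
      exact mul_comm (G := MonoidAlgebra ℂ (ULift.{u} LetterGroup)) _ _
    · rintro _ ⟨z, rfl⟩ _ ⟨z', rfl⟩
      change F.φ (ι (mapGroup f₁ z)) = 0 → F.φ (ι (mapGroup f₂ z')) = 0 →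
        F.φ (ι (mapGroup f₁ z) * ι (mapGroup f₂ z')) = 0
      have h1 := trace_mapGroup_mul_mapGroup f₁ f₂ hf z 1
      rw [map_one, mul_one, (trace _).map_one, mul_one] at h1
      intro hz _
      rw [hι, h1] at hz
      rw [← map_mul ι, hι, trace_mapGroup_mul_mapGroup f₁ f₂ hf, hz, zero_mul]
  have hφx : F.φ x = ((Real.exp (-t.toReal / 2) : ℝ) : ℂ) := by
    have := hx.2 1 le_rfl
    rwa [pow_one, freeUnitaryBMMoment_one ht] at this
  have H : IsModel F ι.range e y (Real.exp (-t.toReal / 2) : ℝ) := by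
    refine ⟨hfree, fun g => ⟨_, rfl⟩, fun g => ?_, hφx, ?_⟩
    · rw [he, hι, trace_single]
      exact if_congr ⟨fun h => congrArg ULift.down h, fun h => by rw [h]; rfl⟩ rfl rfl
    · change F.φ (star x) = _
      rw [F.map_star, hφx]
      exact Complex.conj_ofReal _
  have hfalse : ∀ g, toElement e y (false, g) =
      ι (mapGroup f₁ (single (Multiplicative.ofAdd g) 1)) := by
    intro g
    rw [mapGroup_single, hf₁]
    rfl
  have htrue : ∀ g, toElement e y (true, g) =
      x * ι (mapGroup f₂ (single (Multiplicative.ofAdd g) 1)) * star x := by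
    intro g
    rw [mapGroup_single, hf₂]
    rfl
  have hsingle : ∀ (g : ZMod 60) (z : ℂ), (single (Multiplicative.ofAdd g) z : MonoidAlgebra ℂ _) =
      z • single (Multiplicative.ofAdd g) 1 := fun g z => by rw [smul_single', mul_one]
  refine ⟨X, inferInstance, inferInstance, inferInstance, inferInstance, F, _, _, ι.range, e, y, H,
    Expectation.tfree_conjSubalgebra (x := y) hind hx (hfree.mono_pair hle le_rfl),
    fun g => ?_, fun g => ?_, fun g hg hmem => ?_, fun g hg hmem => ?_⟩
  · rw [hfalse]
    exact hA _
  · rw [htrue]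
    exact ⟨_, hB _, rfl⟩
  · obtain ⟨z, hz⟩ := hmem
    have hz : ι (mapGroup f₁ z) = toElement e y (true, g) := hz
    -- All of `A` is orthogonal to nontrivial letters of `B`. A letter of `B` lying in `A` would be
    -- orthogonal to itself, whereas it is unitary.
    have hzero : ∀ z, F.φ (ι (mapGroup f₁ z) * toElement e y (true, -g)) = 0 := by
      intro z
      induction z using induction_linear with
      | zero => simp
      | add z z' h h' => rw [map_add, map_add, add_mul, map_add, h, h', add_zero]
      | single a s =>
        rw [← ofAdd_toAdd a, hsingle, map_smul, map_smul, ← hfalse, smul_mul_assoc, map_smul,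
          H.map_pair (Or.inr (neg_ne_zero.2 hg)), smul_zero]
    have := hzero z
    rw [hz, toElement_mul_neg, F.map_one] at this
    exact one_ne_zero this
  · obtain ⟨_, ⟨z, rfl⟩, hz⟩ := Expectation.mem_conjSubalgebra.1 hmem
    have hz : x * ι (mapGroup f₂ z) * star x = toElement e y (false, g) := hz
    have hzero : ∀ z, F.φ (toElement e y (false, -g) * (x * ι (mapGroup f₂ z) * star x)) = 0 := by
      intro z
      induction z using induction_linear with
      | zero => simp
      | add z z' h h' =>
        rw [map_add, map_add, mul_add, add_mul, mul_add, map_add, h, h', add_zero]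
      | single a s =>
        rw [← ofAdd_toAdd a, hsingle, map_smul, map_smul, mul_smul_comm, smul_mul_assoc, ← htrue,
          mul_smul_comm, map_smul, H.map_pair (Or.inl (neg_ne_zero.2 hg)), smul_zero]
    have := hzero z
    rw [hz, F.map_mul_comm, toElement_mul_neg, F.map_one] at this
    exact one_ne_zero this

end Letter

namespace Letter

section

variable {X : Type u} [Ring X] [StarRing X] [Algebra ℂ X] [StarModule ℂ X]
  {F : Expectation X} {C : StarSubalgebra ℂ X} {e : LetterGroup →* X} {x : unitary X} {r : ℂ}

/-- The four classes of permutations of seven elements without fixed points. -/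
theorem IsModel.sum_mul_orbitSum (H : IsModel F C e x r) (c : Perm (Fin 7) → ℂ) {s : List Letter}
    (hs : ∀ a ∈ s, a.2 ≠ 0) (hlen : s.length = 7) {p₁ p₂ p₃ p₄ : List ℕ}
    (h₁ : sumValue (cycleWords [([0, 1, 2, 3, 4, 5, 6] : List (Fin 7))] s) = some p₁)
    (h₂ : sumValue (cycleWords [([0, 1, 2, 3, 4] : List (Fin 7)), [5, 6]] s) = some p₂)
    (h₃ : sumValue (cycleWords [([0, 1, 2, 3] : List (Fin 7)), [4, 5, 6]] s) = some p₃)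
    (h₄ : sumValue (cycleWords [([0, 1, 2] : List (Fin 7)), [3, 4], [5, 6]] s) = some p₄) :
    ∑ σ, c σ * orbitSum F e x s σ =
      (∑ σ with σ.cycleType = {7}, c σ) * evalPoly (r ^ 2) p₁ +
      (∑ σ with σ.cycleType = {5, 2}, c σ) * evalPoly (r ^ 2) p₂ +
      (∑ σ with σ.cycleType = {4, 3}, c σ) * evalPoly (r ^ 2) p₃ +
      (∑ σ with σ.cycleType = {3, 2, 2}, c σ) * evalPoly (r ^ 2) p₄ := by
  have T₁ := H.orbitSum_eq (σ := List.formPerm [0, 1, 2, 3, 4, 5, 6]) (by decide) (by decide)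
    (by decide) (by decide) hlen h₁
  have T₂ := H.orbitSum_eq (σ := List.formPerm [0, 1, 2, 3, 4] * List.formPerm [5, 6]) (by decide)
    (by decide) (by decide) (by decide) hlen h₂
  have T₃ := H.orbitSum_eq (σ := List.formPerm [0, 1, 2, 3] * List.formPerm [4, 5, 6]) (by decide)
    (by decide) (by decide) (by decide) hlen h₃
  have T₄ := H.orbitSum_eq
    (σ := List.formPerm [0, 1, 2] * List.formPerm [3, 4] * List.formPerm [5, 6]) (by decide)
    (by decide) (by decide) (by decide) hlen h₄
  rw [Finset.sum_filter, Finset.sum_filter, Finset.sum_filter, Finset.sum_filter, Finset.sum_mul,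
    Finset.sum_mul, Finset.sum_mul, Finset.sum_mul, ← Finset.sum_add_distrib,
    ← Finset.sum_add_distrib, ← Finset.sum_add_distrib]
  refine Finset.sum_congr rfl fun σ _ => ?_
  have hconj : ∀ {τ : Perm (Fin 7)}, τ.cycleType = σ.cycleType →
      orbitSum F e x s σ = orbitSum F e x s τ := fun h =>
    (orbitSum_eq_of_isConj (Perm.isConj_iff_cycleType_eq.2 h)).symm
  have d₁ : ({7} : Multiset ℕ) ≠ {5, 2} := by decide
  have d₂ : ({7} : Multiset ℕ) ≠ {4, 3} := by decide
  have d₃ : ({7} : Multiset ℕ) ≠ {3, 2, 2} := by decide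
  have d₄ : ({5, 2} : Multiset ℕ) ≠ {4, 3} := by decide
  have d₅ : ({5, 2} : Multiset ℕ) ≠ {3, 2, 2} := by decide
  have d₆ : ({4, 3} : Multiset ℕ) ≠ {3, 2, 2} := by decide
  have t₁ : (List.formPerm [0, 1, 2, 3, 4, 5, 6] : Perm (Fin 7)).cycleType = {7} := by
    decide
  have t₂ : (List.formPerm [0, 1, 2, 3, 4] * List.formPerm [5, 6] : Perm (Fin 7)).cycleType = {5, 2} := by
    decide
  have t₃ : (List.formPerm [0, 1, 2, 3] * List.formPerm [4, 5, 6] : Perm (Fin 7)).cycleType = {4, 3} := by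
    decide
  have t₄ : (List.formPerm [0, 1, 2] * List.formPerm [3, 4] * List.formPerm [5, 6] : Perm (Fin 7)).cycleType = {3, 2, 2} := by
    decide
  -- A fixed point isolates a centered letter and makes the form vanish. Without fixed points the
  -- cycle type is a partition of `7` into parts at least `2`, and there are four of these.
  by_cases hσ : ∃ i, σ i = i
  · obtain ⟨i, hi⟩ := hσ
    have hsum : σ.cycleType.sum ≠ 7 := by
      rw [Perm.sum_cycleType]
      refine ne_of_lt (lt_of_lt_of_eq (Finset.card_lt_univ_of_notMem (x := i) ?_) (by simp))
      rw [Perm.mem_support, not_not]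
      exact hi
    rw [H.orbitSum_eq_zero hs hi, if_neg (by rintro h; simp [h] at hsum),
      if_neg (by rintro h; simp [h] at hsum), if_neg (by rintro h; simp [h] at hsum),
      if_neg (by rintro h; simp [h] at hsum)]
    ring
  · push Not at hσ
    have hsum : σ.cycleType.sum = 7 := by
      rw [Perm.sum_cycleType, Finset.eq_univ_iff_forall.2 fun i => Perm.mem_support.2 (hσ i)]
      rfl
    rcases Multiset.eq_of_sum_eq_seven (fun a ha => Perm.two_le_of_mem_cycleType ha) hsum with
      h | h | h | h
    · rw [h, if_pos rfl, if_neg d₁, if_neg d₂, if_neg d₃, ← T₁,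
        hconj (t₁.trans h.symm)]
      ring
    · rw [h, if_neg d₁.symm, if_pos rfl, if_neg d₄, if_neg d₅, ← T₂,
        hconj (t₂.trans h.symm)]
      ring
    · rw [h, if_neg d₂.symm, if_neg d₄.symm, if_pos rfl, if_neg d₆, ← T₃,
        hconj (t₃.trans h.symm)]
      ring
    · rw [h, if_neg d₃.symm, if_neg d₅.symm, if_neg d₆.symm, if_pos rfl, ← T₄,
        hconj (t₄.trans h.symm)]
      ring

end

/-- Every rearrangement of `s` is a mixed word, so the cumulant relation holds for each of them and
may be summed. -/
theorem sum_mul_orbitSum_eq_zero {t : ENNReal} {n : ℕ} {c : Perm (Fin n) → ℂ}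
    (hc : IsTFreeCumulant.{u} t n c) {X : Type u} [Ring X] [StarRing X] [Algebra ℂ X]
    [StarModule ℂ X] {F : Expectation X} {A B : StarSubalgebra ℂ X} {e : LetterGroup →* X}
    {x : unitary X} (hAB : F.TFree t A B) (hA : ∀ g, toElement e x (false, g) ∈ A)
    (hB : ∀ g, toElement e x (true, g) ∈ B) (hA' : ∀ g, g ≠ 0 → toElement e x (true, g) ∉ A)
    (hB' : ∀ g, g ≠ 0 → toElement e x (false, g) ∉ B) {s : List Letter}
    (hs : ∀ a ∈ s, a.2 ≠ 0) (hfalse : ∃ a ∈ s, a.1 = false) (htrue : ∃ a ∈ s, a.1 = true) :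
    ∑ σ, c σ * orbitSum F e x s σ = 0 := by
  simp only [orbitSum, Finset.mul_sum]
  rw [Finset.sum_comm]
  refine Finset.sum_eq_zero fun f hf => ?_
  have hperm : (List.ofFn f).Perm s := (Finset.mem_filter.1 hf).2
  refine hc.2 X F A B hAB _ ?_ ?_ ?_
  · intro i
    rcases hfi : f i with ⟨b, g⟩
    rw [Function.comp_apply, hfi]
    cases b
    · exact Or.inl (hA g)
    · exact Or.inr (hB g)
  · intro hall
    obtain ⟨a, ha, ha1⟩ := htrue
    obtain ⟨i, rfl⟩ := List.mem_ofFn.1 (hperm.mem_iff.2 ha)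
    have hi : f i = (true, (f i).2) := Prod.ext ha1 rfl
    exact hA' _ (hs _ ha) (hi ▸ hall i)
  · intro hall
    obtain ⟨a, ha, ha1⟩ := hfalse
    obtain ⟨i, rfl⟩ := List.mem_ofFn.1 (hperm.mem_iff.2 ha)
    have hi : f i = (false, (f i).2) := Prod.ext ha1 rfl
    exact hB' _ (hs _ ha) (hi ▸ hall i)

end Letter

open Letter in
/-- There is no `t`-free cumulant of order `7` for `0 < t < ∞`. -/
theorem not_isTFreeCumulant {t : ENNReal} (h0 : t ≠ 0) (ht : t ≠ ⊤) (c : Perm (Fin 7) → ℂ) :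
    ¬ IsTFreeCumulant.{u} t 7 c := by
  intro hc
  obtain ⟨X, _, _, _, _, F, A, B, C, e, x, H, hAB, hA, hB, hA', hB'⟩ := exists_model.{u} ht
  have hzero : ∀ {s : List Letter}, (∀ a ∈ s, a.2 ≠ 0) → (∃ a ∈ s, a.1 = false) →
      (∃ a ∈ s, a.1 = true) → ∑ σ, c σ * orbitSum F e x s σ = 0 := fun h1 h2 h3 =>
    sum_mul_orbitSum_eq_zero hc hAB hA hB hA' hB' h1 h2 h3
  -- The residues `30`, `20`, `15`, `12` have orders `2`, `3`, `4`, `5`, whence the modulus `60`. In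
  -- this first word, two letters of order `2` meet five of order `5`: the `7` arrangements in which
  -- the former are cyclically adjacent have moment `1`, the other `14` have moment `q²`.
  have E₁ := H.sum_mul_orbitSum c
    (s := (false, 30) :: (false, 30) :: List.replicate 5 (true, 12)) (by decide +kernel) rfl
    (p₁ := [7, 0, 14]) (p₂ := [1]) (p₃ := []) (p₄ := [])
    (by decide +kernel) (by decide +kernel) (by decide +kernel) (by decide +kernel)
  have E₂ := H.sum_mul_orbitSum c
    (s := (false, 30) :: (false, 30) :: (true, 30) :: (true, 30) :: List.replicate 3 (true, 20))
    (by decide +kernel) rfl (p₁ := [77, 0, 133]) (p₂ := [15, 0, 5]) (p₃ := [4, 0, 2]) (p₄ := [2])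
    (by decide +kernel) (by decide +kernel) (by decide +kernel) (by decide +kernel)
  have E₃ := H.sum_mul_orbitSum c
    (s := List.replicate 3 (false, 20) ++ List.replicate 4 (true, 15)) (by decide +kernel) rfl
    (p₁ := [7, 0, 21, 7]) (p₂ := []) (p₃ := [1]) (p₄ := [])
    (by decide +kernel) (by decide +kernel) (by decide +kernel) (by decide +kernel)
  have E₄ := H.sum_mul_orbitSum c
    (s := List.replicate 3 (false, 20) ++ List.replicate 4 (true, 30)) (by decide +kernel) rfl
    (p₁ := [14, 0, 21]) (p₂ := [5, 0, 5]) (p₃ := [1]) (p₄ := [1])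
    (by decide +kernel) (by decide +kernel) (by decide +kernel) (by decide +kernel)
  rw [hzero (by decide +kernel) (by decide +kernel) (by decide +kernel)] at E₁ E₂ E₃ E₄
  have hc7 := hc.1
  set q : ℂ := ((Real.exp (-t.toReal / 2) : ℝ) : ℂ) ^ 2 with hq
  generalize (∑ σ : Perm (Fin 7) with σ.cycleType = {7}, c σ) = C₁ at E₁ E₂ E₃ E₄ hc7
  generalize (∑ σ : Perm (Fin 7) with σ.cycleType = {5, 2}, c σ) = C₂ at E₁ E₂ E₃ E₄
  generalize (∑ σ : Perm (Fin 7) with σ.cycleType = {4, 3}, c σ) = C₃ at E₁ E₂ E₃ E₄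
  generalize (∑ σ : Perm (Fin 7) with σ.cycleType = {3, 2, 2}, c σ) = C₄ at E₁ E₂ E₃ E₄
  simp only [evalPoly, List.foldr_cons, List.foldr_nil] at E₁ E₂ E₃ E₄
  push_cast at E₁ E₂ E₃ E₄
  -- `E₁`, `E₃` and `E₄` express the other class sums in terms of `C₁`. Substituted in `E₂`, they
  -- leave `-14 q³ (1 - q)² C₁ = 0`, which is a contradiction because `0 < q < 1`.
  have hmain : C₁ * (q ^ 3 * (1 - q) ^ 2) = 0 := by
    linear_combination (1 / 14) * (E₁ * (-(15 + 5 * q ^ 2) + 10 * (1 + q ^ 2)) + E₂ +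
      E₃ * (-(4 + 2 * q ^ 2) + 2) - 2 * E₄)
  have hq' : q = ((Real.exp (-t.toReal) : ℝ) : ℂ) := by
    rw [hq, ← Complex.ofReal_pow, ← Real.exp_nat_mul]
    congr 2
    push_cast
    ring
  have hpos : 0 < t.toReal := ENNReal.toReal_pos h0 ht
  have hq0 : q ≠ 0 := by
    rw [hq', Complex.ofReal_ne_zero]
    exact (Real.exp_pos _).ne'
  have hq1 : 1 - q ≠ 0 := by
    rw [hq', sub_ne_zero, ← Complex.ofReal_one, Ne, Complex.ofReal_inj]
    exact (Real.exp_lt_one_iff.2 (by linarith)).ne'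
  exact mul_ne_zero hc7 (mul_ne_zero (pow_ne_zero 3 hq0) (pow_ne_zero 2 hq1)) hmain

theorem mainTheorem1 (t : ENNReal) :
    (∃ c : Equiv.Perm (Fin 7) → ℂ, IsTFreeCumulant.{u} t 7 c) ↔ t = 0 ∨ t = ⊤ := by
  constructor
  · rintro ⟨c, hc⟩
    by_contra! h
    exact not_isTFreeCumulant h.1 h.2 c hc
  · rintro (rfl | rfl)
    · exact exists_isTFreeCumulant_zero (by norm_num)
    · exact exists_isTFreeCumulant_top (by norm_num)
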